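/- **Conventions.** Let $V=\coprod_{n\in\mathbb Z}V_{(n)}$ be a vertex operator algebra over $\mathbb C$ with $Y(u,x)v=\sum_n u_nv\,x^{-n-1}$, and let $g$ be an automorphism of $V$. For $z\in\mathbb C^\times$ put $\log z=\log|z|+i\arg z$ with $0\le\arg z<2\pi$, and $l_p(z)=\log z+2\pi ip$ for $p\in\mathbb Z$. For $a\in\mathbb C$ let $V^{[a+\mathbb Z]}$ be the generalized eigenspace of $g$ with eigenvalue $e^{2\pi ia}$, and let $P(V)$ be the set of all $a$ with $0\le\operatorname{Re}a<1$ and $V^{[a+\mathbb Z]}\ne0$. Write $g=\sigma g_u$ with $\sigma$ the semisimple part of $g$ (equal to $\mu$ on the generalized eigenspace with eigenvalue $\mu$) and $g_u=\sigma^{-1}g$ locally unipotent, and set $\mathcal N=\frac1{2\pi i}\log g_u=\frac1{2\pi i}\sum_{j\ge1}\frac{(-1)^{j+1}}{j}(g_u-1)^j$, a locally nilpotent operator. A $\overline{\mathbb C}_+$-graded weak $g$-twisted $V$-module is a vector space $W=\coprod W_n^{[\alpha]}$, the sum over $n\in\mathbb C$ with $\operatorname{Re}n\ge0$ and $\alpha\in\mathbb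 C/\mathbb Z$, with an action of $g$ and a linear map $Y^g:V\otimes W\to W\{x\}[\log x]$, $Y^g(v,x)w=\sum_{k}\sum_{n\in\mathbb C}Y^g_{n,k}(v)w\,x^{-n-1}(\log x)^k$, such that the following hold. Here $W_n=\coprod_\alpha W_n^{[\alpha]}$, $\pi_n$ is the projection onto $W_n$ (or onto $V_{(n)}$), $W'=\coprod (W_n^{[\alpha]})^*$, and $Y^{g;p}(v,z)$ is $Y^g(v,x)$ with $x^n=e^{n\,l_p(z)}$, $\log x=l_p(z)$. 1. $Y^{g;p+1}(gv,z)w=Y^{g;p}(v,z)w$ for all $p\in\mathbb Z$, $z\in\mathbb C^\times$. 2. $Y^g(\mathbf 1,x)w=w$. 3. For all $u,v\in V$, $w\in W$, $w'\in W'$ there are $N\in\mathbb N$, $t\in\mathbb Z_+$ and complex numbers $a_{ijkl},m_i,n_j$ ($0\le i,j,k,l\le N$) such that for every $p\in\mathbb Z$ the series $\sum_n\langle w',Y^{g;p}(u,z_1)\pi_nY^{g;p}(v,z_2)w\rangle$, $\sum_n\langle w',Y^{g;p}(v,z_2)\pi_nY^{g;p}(u,z_1)w\rangle$, $\sum_n\langle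 w',Y^{g;p}(\pi_nY(u,z_1-z_2)v,z_2)w\rangle$ converge absolutely for $|z_1|>|z_2|>0$, for $|z_2|>|z_1|>0$ and for $|z_2|>|z_1-z_2|>0$, respectively, and, when moreover $|\arg z_1-\arg z_2|<\frac\pi2$, have sum $\sum a_{ijkl}e^{m_il_p(z_1)}e^{n_jl_p(z_2)}l_p(z_1)^kl_p(z_2)^l(z_1-z_2)^{-t}$. 4. For $v\in V_{(m)}$ and $w\in W_d$, $Y^g_{n,k}(v)w$ lies in $W_{m-n-1+d}$ if $\operatorname{Re}(m-n-1+d)\ge0$ and is $0$ otherwise; $\coprod_{\operatorname{Re}n=0}W_n$ is the space of all $w$ with $Y^g_{n,k}(v)w=0$ whenever $v\in V_{(m)}$ and $\operatorname{Re}(m-n-1)<0$; each element of $\coprod_nW_n^{[a+\mathbb Z]}$ is a generalized eigenvector of $g$ with eigenvalue $e^{2\pi ia}$; and $gY^g(u,x)w=Y^g(gu,x)gw$. 5. $\frac{d}{dx}Y^g(v,x)=Y^g(L(-1)v,x)$. Let $Y^g_0(v,x)=\sum_nY^g_{n,0}(v)x^{-n-1}$ be the non-logarithmic component of $Y^g(v,x)$;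 in $Y^g_0(v,z)$ powers of $z$ are formed as $z^n=e^{n\log z}$. **Theorem.** Let $W$ be a $\overline{\mathbb C}_+$-graded weak $g$-twisted $V$-module, $a,b\in P(V)$, $u\in V^{[a+\mathbb Z]}$, $v\in V^{[b+\mathbb Z]}$, $w\in W$ and $w'\in W'$. Then there are a polynomial $G(z_1,z_2)\in\mathbb C[z_1,z_2]$ and $r,s,t\in\mathbb Z$ such that the following hold. * For $|z_1|>|z_2|>0$ the series $\langle w',Y^g_0(u,z_1)Y^g_0(v,z_2)w\rangle=\sum_{n\in\mathbb C}\langle w',Y^g_0(u,z_1)\pi_nY^g_0(v,z_2)w\rangle$, and for $|z_2|>|z_1|>0$ the series $\langle w',Y^g_0(v,z_2)Y^g_0(u,z_1)w\rangle=\sum_{n\in\mathbb C}\langle w',Y^g_0(v,z_2)\pi_nY^g_0(u,z_1)w\rangle$, converges absolutely to $$e^{-a\log z_1}e^{-b\log z_2}\frac{G(z_1,z_2)}{z_1^rz_2^s(z_1-z_2)^t}.\qquad(*)$$ * For $|z_2|>|z_1-z_2|>0$ the series $$\Big\langle w',Y^g_0\Big(Y\Big(\Big(1+\tfrac{z_1-z_2}{z_2}\Big)^{\mathcal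 N}u,z_1-z_2\Big)v,z_2\Big)w\Big\rangle=\sum_{i\in\mathbb N}\sum_{n\in\mathbb Z}\Big(\tfrac{z_1-z_2}{z_2}\Big)^i\Big\langle w',Y^g_0\Big(\pi_nY\Big(\tbinom{\mathcal N}{i}u,z_1-z_2\Big)v,z_2\Big)w\Big\rangle$$ converges absolutely as a double series, and its sum is given by $(*)$ with $\log z_1$ replaced by the unique $\ell_1$ such that $e^{\ell_1}=z_1$ and $|\operatorname{Im}\ell_1-\arg z_2|<\frac\pi2$. In particular its sum is $(*)$ when $|\arg z_1-\arg z_2|<\frac\pi2$. -/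

import Mathlib

open scoped DirectSum

noncomputable section

/-! ### Graded spaces -/

theorem bijective_coeLinearMap {ι M : Type*} [DecidableEq ι] [AddCommGroup M] [Module ℂ M]
    (A : ι → Submodule ℂ M) (h : DirectSum.IsInternal A) :
    Function.Bijective (DirectSum.coeLinearMap A) := h

/-- The isomorphism `M ≃ ⨁ i, A i` given by a direct sum decomposition. -/
def gradedDecomp {ι M : Type*} [DecidableEq ι] [AddCommGroup M] [Module ℂ M]
    (A : ι → Submodule ℂ M) (h : DirectSum.IsInternal A) : M ≃ₗ[ℂ] ⨁ i, A i :=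
  (LinearEquiv.ofBijective (DirectSum.coeLinearMap A) (bijective_coeLinearMap A h)).symm

theorem gradedDecomp_apply {ι M : Type*} [DecidableEq ι] [AddCommGroup M] [Module ℂ M]
    (A : ι → Submodule ℂ M) (h : DirectSum.IsInternal A) {i : ι} {x : M} (hx : x ∈ A i) :
    gradedDecomp A h x = DirectSum.lof ℂ ι (fun i => A i) i ⟨x, hx⟩ := by
  rw [gradedDecomp, LinearEquiv.symm_apply_eq, LinearEquiv.ofBijective_apply,
    DirectSum.coeLinearMap_lof]

/-- For a direct sum decomposition `M = ⨁ i, A i` and a set `S` of indices, the projection of `M`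
onto `⨁ i ∈ S, A i` along the other summands. -/
def gradedProj {ι M : Type*} [DecidableEq ι] [AddCommGroup M] [Module ℂ M]
    (A : ι → Submodule ℂ M) (h : DirectSum.IsInternal A) (S : Set ι) : M →ₗ[ℂ] M := by
  classical
  exact (DirectSum.toModule ℂ ι M (fun i => if i ∈ S then (A i).subtype else 0)).comp
    (gradedDecomp A h).toLinearMap

open Classical in
theorem gradedProj_apply {ι M : Type*} [DecidableEq ι] [AddCommGroup M] [Module ℂ M]
    (A : ι → Submodule ℂ M) (h : DirectSum.IsInternal A) (S : Set ι) {i : ι} {x : M}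
    (hx : x ∈ A i) : gradedProj A h S x = if i ∈ S then x else 0 := by
  rw [gradedProj, LinearMap.comp_apply, LinearEquiv.coe_coe, gradedDecomp_apply A h hx,
    DirectSum.toModule_lof]
  split_ifs <;> simp

/-! ### Branches of the logarithm -/

/-- The argument of `z`, normalized by `0 ≤ arg z < 2π`. -/
def argPos (z : ℂ) : ℝ := if 0 ≤ z.arg then z.arg else z.arg + 2 * Real.pi

/-- The branch `log z + 2πip` of the logarithm, where `log z = log |z| + i arg z` with
`0 ≤ arg z < 2π`. -/
def logBranch (p : ℤ) (z : ℂ) : ℂ :=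
  (Real.log ‖z‖ : ℂ) + (argPos z : ℂ) * Complex.I + 2 * (Real.pi : ℂ) * (p : ℂ) * Complex.I

/-- The family `f` of complex numbers is absolutely summable, with sum `s`. -/
def AbsConvTo {ι : Type*} (f : ι → ℂ) (s : ℂ) : Prop :=
  Summable (fun i => ‖f i‖) ∧ HasSum f s

/-! ### Vertex operator algebras and their automorphisms -/

/-- A vertex operator algebra structure on `V`. Here `mode n u v` is `uₙ v`, i.e.
`Y(u, x) v = ∑ₙ (mode n u v) x^(-n-1)`. -/
structure VertexOperatorAlgebra (V : Type*) [AddCommGroup V] [Module ℂ V] where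
  /-- the homogeneous subspaces `V₍ₙ₎` -/
  deg : ℤ → Submodule ℂ V
  mode : ℤ → V →ₗ[ℂ] V →ₗ[ℂ] V
  /-- the vacuum vector -/
  vac : V
  /-- the conformal vector -/
  conf : V
  /-- the central charge -/
  charge : ℂ
  isInternal : DirectSum.IsInternal deg
  finite_deg : ∀ n, Module.Finite ℂ (deg n)
  deg_bddBelow : ∃ n₀ : ℤ, ∀ n < n₀, deg n = ⊥
  vac_mem : vac ∈ deg 0
  conf_mem : conf ∈ deg 2
  truncation : ∀ u v, ∃ n₀ : ℤ, ∀ n ≥ n₀, mode n u v = 0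
  mode_mem : ∀ (k l n : ℤ), ∀ u ∈ deg k, ∀ v ∈ deg l, mode n u v ∈ deg (k + l - n - 1)
  vac_mode : ∀ (n : ℤ) (v : V), mode n vac v = if n = -1 then v else 0
  creation : ∀ v, mode (-1) v vac = v
  creation_nonneg : ∀ (n : ℤ) (v : V), 0 ≤ n → mode n v vac = 0
  /-- the Jacobi identity, in components; all sums are finite -/
  jacobi : ∀ (u v w : V) (l m n : ℤ),
    (∑ᶠ i : ℕ, ((-1 : ℂ) ^ i * ((Ring.choose l i : ℤ) : ℂ)) •
        mode (l + m - i) u (mode (n + i) v w))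
      - (∑ᶠ i : ℕ, ((-1 : ℂ) ^ ((i : ℤ) + l) * ((Ring.choose l i : ℤ) : ℂ)) •
        mode (l + n - i) v (mode (m + i) u w))
      = ∑ᶠ i : ℕ, ((Ring.choose m i : ℤ) : ℂ) • mode (m + n - i) (mode (l + i) u v) w
  /-- the Virasoro relations for `L(n) = ωₙ₊₁` -/
  virasoro : ∀ (m n : ℤ) (v : V),
    mode (m + 1) conf (mode (n + 1) conf v) - mode (n + 1) conf (mode (m + 1) conf v)
      = ((m - n : ℤ) : ℂ) • mode (m + n + 1) conf v
        + (if m + n = 0 then (((m : ℂ) ^ 3 - (m : ℂ)) / 12 * charge) • v else 0)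
  /-- `L(0) v = n v` for `v ∈ V₍ₙ₎` -/
  L0_apply : ∀ (n : ℤ), ∀ v ∈ deg n, mode 1 conf v = (n : ℂ) • v
  /-- `Y(L(-1)v, x) = d/dx Y(v, x)` -/
  L1_derivative : ∀ (n : ℤ) (v w : V), mode n (mode 0 conf v) w = -(n : ℂ) • mode (n - 1) v w

namespace VertexOperatorAlgebra

variable {V : Type*} [AddCommGroup V] [Module ℂ V] (A : VertexOperatorAlgebra V)

/-- `π_n (Y(u, z) v)`, the weight-`n` component of `Y(u, z) v`. -/
def modeSum (z : ℂ) (u v : V) (n : ℤ) : V :=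
  ∑ᶠ m : ℤ, z ^ (-m - 1) • gradedProj A.deg A.isInternal {n} (A.mode m u v)

/-- An automorphism of a vertex operator algebra. -/
structure Automorphism where
  toEquiv : V ≃ₗ[ℂ] V
  map_vac : toEquiv A.vac = A.vac
  map_conf : toEquiv A.conf = A.conf
  map_mode : ∀ (n : ℤ) (u v : V), toEquiv (A.mode n u v) = A.mode n (toEquiv u) (toEquiv v)

namespace Automorphism

variable {A} (g : A.Automorphism)

/-- `g` as a linear endomorphism. -/
def toEnd : Module.End ℂ V := g.toEquiv.toLinearMap

/-- The generalized eigenspace `V^[a+ℤ]` of `g` with eigenvalue `exp (2πia)`. -/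
def genSpace (a : ℂ) : Submodule ℂ V :=
  g.toEnd.maxGenEigenspace (Complex.exp (2 * (Real.pi : ℂ) * Complex.I * a))

/-- The set `P(V)` of `g`-weights of `V`. -/
def weights : Set ℂ := {a | 0 ≤ a.re ∧ a.re < 1 ∧ g.genSpace a ≠ ⊥}

theorem deg_le_eigenspace (n : ℤ) : A.deg n ≤ Module.End.eigenspace (A.mode 1 A.conf) (n : ℂ) :=
  fun v hv => Module.End.mem_eigenspace_iff.2 (A.L0_apply n v hv)

theorem eigenspace_le_deg (n : ℤ) : Module.End.eigenspace (A.mode 1 A.conf) (n : ℂ) ≤ A.deg n := by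
  have hind : iSupIndep (fun m : ℤ => Module.End.eigenspace (A.mode 1 A.conf) (m : ℂ)) :=
    (Module.End.eigenspaces_iSupIndep (A.mode 1 A.conf)).comp Int.cast_injective
  have htop := A.isInternal.submodule_iSup_eq_top
  intro v hv
  have hv' : v ∈ A.deg n ⊔ ⨆ (m : ℤ) (_ : m ≠ n), A.deg m := by
    have : (⨆ i, A.deg i) ≤ A.deg n ⊔ ⨆ (m : ℤ) (_ : m ≠ n), A.deg m := by
      refine iSup_le fun i => ?_
      by_cases hi : i = n
      · subst hi; exact le_sup_left
      · exact le_sup_of_le_right (le_iSup₂_of_le i hi le_rfl)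
    exact this (htop ▸ Submodule.mem_top)
  obtain ⟨x, hx, y, hy, rfl⟩ := Submodule.mem_sup.1 hv'
  have hyE : y ∈ Module.End.eigenspace (A.mode 1 A.conf) (n : ℂ) := by
    simpa using Submodule.sub_mem _ hv (deg_le_eigenspace n hx)
  have hyS : y ∈ ⨆ (m : ℤ) (_ : m ≠ n), Module.End.eigenspace (A.mode 1 A.conf) (m : ℂ) :=
    (iSup₂_mono fun m _ => deg_le_eigenspace m) hy
  have : y = 0 := (Submodule.disjoint_def.1 (hind n)) y hyE hyS
  simpa [this] using hx

theorem map_deg (n : ℤ) {v : V} (hv : v ∈ A.deg n) : g.toEnd v ∈ A.deg n := by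
  refine eigenspace_le_deg n (Module.End.mem_eigenspace_iff.2 ?_)
  have h := g.map_mode 1 A.conf v
  rw [g.map_conf, A.L0_apply n v hv, map_smul] at h
  exact h.symm

/-- `V` is the direct sum of the generalized eigenspaces of `g`. -/
theorem isInternal_maxGenEigenspace :
    DirectSum.IsInternal (fun μ : ℂ => g.toEnd.maxGenEigenspace μ) := by
  rw [DirectSum.isInternal_submodule_iff_iSupIndep_and_iSup_eq_top]
  refine ⟨g.toEnd.independent_maxGenEigenspace, ?_⟩
  rw [eq_top_iff, ← A.isInternal.submodule_iSup_eq_top]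
  refine iSup_le fun n => ?_
  have := A.finite_deg n
  have hmap : ∀ x ∈ A.deg n, g.toEnd x ∈ A.deg n := fun x hx => g.map_deg n hx
  let f : Module.End ℂ (A.deg n) := g.toEnd.restrict hmap
  have htop := Module.End.iSup_maxGenEigenspace_eq_top f
  intro x hx
  have hx' : (⟨x, hx⟩ : A.deg n) ∈ ⨆ μ, f.maxGenEigenspace μ := by
    rw [htop]; trivial
  have hle : Submodule.map (A.deg n).subtype (⨆ μ, f.maxGenEigenspace μ)
      ≤ ⨆ μ, g.toEnd.maxGenEigenspace μ := by
    rw [Submodule.map_iSup]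
    refine iSup_mono fun μ => ?_
    rintro _ ⟨y, hy, rfl⟩
    obtain ⟨k, hk⟩ := (Module.End.mem_maxGenEigenspace _ _ _).1 hy
    refine (Module.End.mem_maxGenEigenspace _ _ _).2 ⟨k, ?_⟩
    have key : ∀ (k : ℕ) (y : A.deg n),
        (((f - μ • 1) ^ k) y : V) = ((g.toEnd - μ • 1) ^ k) (y : V) := by
      intro k
      induction k with
      | zero => intro y; simp
      | succ k ih =>
        intro y
        rw [pow_succ, pow_succ, Module.End.mul_apply, Module.End.mul_apply, ih]
        rfl
    rw [Submodule.subtype_apply, ← key, hk]; rfl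
  exact hle ⟨_, hx', rfl⟩

/-- The semisimple part `σ` of `g`: it acts on the generalized eigenspace of `g` with
eigenvalue `μ` as multiplication by `μ`. -/
def semisimplePart : Module.End ℂ V :=
  (DirectSum.toModule ℂ ℂ V (fun μ => μ • (g.toEnd.maxGenEigenspace μ).subtype)).comp
    (gradedDecomp _ g.isInternal_maxGenEigenspace).toLinearMap

/-- The locally unipotent part `g_u = σ⁻¹ g` of `g`: it acts on the generalized eigenspace of `g`
with eigenvalue `μ` (which is nonzero) as `μ⁻¹ g`. -/
def unipotentPart : Module.End ℂ V :=
  (DirectSum.toModule ℂ ℂ V (fun μ => μ⁻¹ • g.toEnd.comp (g.toEnd.maxGenEigenspace μ).subtype)).comp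
    (gradedDecomp _ g.isInternal_maxGenEigenspace).toLinearMap

theorem semisimplePart_apply {μ : ℂ} {v : V} (hv : v ∈ g.toEnd.maxGenEigenspace μ) :
    g.semisimplePart v = μ • v := by
  rw [semisimplePart, LinearMap.comp_apply, LinearEquiv.coe_coe, gradedDecomp_apply _ _ hv,
    DirectSum.toModule_lof]
  simp

theorem unipotentPart_apply {μ : ℂ} {v : V} (hv : v ∈ g.toEnd.maxGenEigenspace μ) :
    g.unipotentPart v = μ⁻¹ • g.toEnd v := by
  rw [unipotentPart, LinearMap.comp_apply, LinearEquiv.coe_coe, gradedDecomp_apply _ _ hv,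
    DirectSum.toModule_lof]
  simp

theorem maxGenEigenspace_zero : g.toEnd.maxGenEigenspace 0 = ⊥ := by
  refine (Submodule.eq_bot_iff _).2 fun v hv => ?_
  obtain ⟨k, hk⟩ := (Module.End.mem_maxGenEigenspace _ _ _).1 hv
  have hinj : Function.Injective (g.toEnd ^ k) := by
    rw [Module.End.coe_pow]
    exact Function.Injective.iterate g.toEquiv.injective k
  apply hinj
  simpa using hk

/-- `g = σ g_u`. -/
theorem semisimplePart_mul_unipotentPart : g.semisimplePart * g.unipotentPart = g.toEnd := by
  refine LinearMap.ext fun v => ?_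
  have hv : v ∈ ⨆ μ, g.toEnd.maxGenEigenspace μ := by
    rw [g.isInternal_maxGenEigenspace.submodule_iSup_eq_top]; trivial
  induction hv using Submodule.iSup_induction' with
  | zero => simp
  | add x y _ _ hx hy => simp only [map_add, hx, hy]
  | mem μ v hv =>
    rw [Module.End.mul_apply, g.unipotentPart_apply hv, map_smul, g.semisimplePart_apply
      (Module.End.mapsTo_maxGenEigenspace_of_comm (Commute.refl g.toEnd) μ hv), smul_smul]
    by_cases hμ : μ = 0
    · subst hμ
      rw [maxGenEigenspace_zero] at hv
      simp [(Submodule.mem_bot ℂ).1 hv]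
    · simp [inv_mul_cancel₀ hμ]

/-- `g_u - 1` is locally nilpotent. -/
theorem unipotentPart_locallyUnipotent (v : V) :
    ∃ k : ℕ, ((g.unipotentPart - 1) ^ k) v = 0 := by
  have hv : v ∈ ⨆ μ, g.toEnd.maxGenEigenspace μ := by
    rw [g.isInternal_maxGenEigenspace.submodule_iSup_eq_top]; trivial
  have hle : (⨆ μ, g.toEnd.maxGenEigenspace μ) ≤ g.unipotentPart.maxGenEigenspace 1 := by
    refine iSup_le fun μ x hx => ?_
    by_cases hμ : μ = 0
    · subst hμ
      rw [maxGenEigenspace_zero] at hx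
      rw [(Submodule.mem_bot ℂ).1 hx]
      exact Submodule.zero_mem _
    · obtain ⟨k, hk⟩ := (Module.End.mem_maxGenEigenspace _ _ _).1 hx
      refine (Module.End.mem_maxGenEigenspace _ _ _).2 ⟨k, ?_⟩
      have key : ∀ (k : ℕ), ∀ y ∈ g.toEnd.maxGenEigenspace μ,
          ((g.unipotentPart - (1 : ℂ) • 1) ^ k) y
            = (μ⁻¹) ^ k • ((g.toEnd - μ • 1) ^ k) y := by
        intro k
        induction k with
        | zero => intro y _; simp
        | succ k ih =>
          intro y hy
          have h1 : (g.unipotentPart - (1 : ℂ) • 1) y = μ⁻¹ • (g.toEnd - μ • 1) y := by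
            simp [g.unipotentPart_apply hy, smul_sub, smul_smul, inv_mul_cancel₀ hμ]
          have h2 : (g.toEnd - μ • 1) y ∈ g.toEnd.maxGenEigenspace μ := by
            have := Submodule.sub_mem _
              (Module.End.mapsTo_maxGenEigenspace_of_comm (Commute.refl g.toEnd) μ hy)
              (Submodule.smul_mem _ μ hy)
            simpa using this
          rw [pow_succ, Module.End.mul_apply, h1, map_smul, ih _ h2, pow_succ (g.toEnd - μ • 1),
            Module.End.mul_apply, smul_smul, pow_succ, mul_comm]
      rw [key k x hx, hk, smul_zero]
  obtain ⟨k, hk⟩ := (Module.End.mem_maxGenEigenspace _ _ _).1 (hle hv)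
  exact ⟨k, by simpa using hk⟩

theorem finite_support_log (v : V) : (Function.support fun j : ℕ =>
    ((-1 : ℂ) ^ j / (2 * (Real.pi : ℂ) * Complex.I * ((j : ℂ) + 1))) •
      ((g.unipotentPart - 1) ^ (j + 1)) v).Finite := by
  obtain ⟨k, hk⟩ := g.unipotentPart_locallyUnipotent v
  refine (Set.finite_lt_nat k).subset fun j hj => ?_
  by_contra hlt
  have hlt' : k ≤ j := by simpa using hlt
  apply hj
  have : ((g.unipotentPart - 1) ^ (j + 1)) v = 0 := by
    rw [show j + 1 = (j + 1 - k) + k by omega, pow_add, Module.End.mul_apply, hk, map_zero]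
  simp only [this, smul_zero]

/-- The operator `𝒩 = log(g_u) / (2πi) = ∑_{j ≥ 1} (-1)^(j+1) (g_u - 1)^j / (2πi j)`, a finite sum
on each vector. -/
def nilLog : Module.End ℂ V where
  toFun v := ∑ᶠ j : ℕ, ((-1 : ℂ) ^ j / (2 * (Real.pi : ℂ) * Complex.I * ((j : ℂ) + 1))) •
      ((g.unipotentPart - 1) ^ (j + 1)) v
  map_add' x y := by
    rw [← finsum_add_distrib (g.finite_support_log x) (g.finite_support_log y)]
    simp only [map_add, smul_add]
  map_smul' c x := by
    rw [RingHom.id_apply, smul_finsum' c (g.finite_support_log x)]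
    refine finsum_congr fun j => ?_
    rw [map_smul, smul_comm]

/-- The binomial coefficient `binom(𝒩, i) = 𝒩(𝒩-1)⋯(𝒩-i+1) / i!`, so that
`(1 + x)^𝒩 u = ∑ i, (binom(𝒩, i) u) x^i`. -/
def binomNilLog (i : ℕ) : Module.End ℂ V :=
  ((i.factorial : ℂ)⁻¹) • Polynomial.aeval g.nilLog (descPochhammer ℂ i)

end Automorphism

end VertexOperatorAlgebra

/-! ### Twisted modules -/

/-- The additive group `ℂ/ℤ`. -/
abbrev CModZ : Type := ℂ ⧸ AddSubgroup.zmultiples (1 : ℂ)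

instance : DecidableEq CModZ := Classical.decEq _

section Series

variable {V W : Type*} [AddCommGroup V] [Module ℂ V] [AddCommGroup W] [Module ℂ W]
  (modes : ℂ → ℕ → V →ₗ[ℂ] W →ₗ[ℂ] W)

/-- For a linear map `Y : V ⊗ W → W{x}[log x]` with
`Y(v, x) w = ∑ₙ ∑ₖ (modes n k v w) x^(-n-1) (log x)^k` and a projection `π` of `W`, the vector
`π (Y(v, x) w)`, evaluated at `x^n = exp (n l)`, `log x = l`. -/
def evalProj (π : W →ₗ[ℂ] W) (l : ℂ) (v : V) (w : W) : W :=
  ∑ᶠ q : ℂ × ℕ, (Complex.exp ((-q.1 - 1) * l) * l ^ q.2) • π (modes q.1 q.2 v w)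

/-- The value of `⟨w', Y(v, x) w⟩` at `x^n = exp (n l)`, `log x = l`. -/
def evalPair (w' : Module.Dual ℂ W) (l : ℂ) (v : V) (w : W) : ℂ :=
  ∑ᶠ q : ℂ × ℕ, (Complex.exp ((-q.1 - 1) * l) * l ^ q.2) * w' (modes q.1 q.2 v w)

/-- The non-logarithmic component `Y₀(v, x) = ∑ₙ (modes n 0 v) x^(-n-1)` of `Y(v, x)`. -/
def nonlog : ℂ → ℕ → V →ₗ[ℂ] W →ₗ[ℂ] W := fun n k => if k = 0 then modes n 0 else 0

end Series

/-- The subspace `W_n = ⨁ α, W_n^[α]` of a doubly graded space. -/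
def degSpace {W : Type*} [AddCommGroup W] [Module ℂ W] (D : ℂ × CModZ → Submodule ℂ W)
    (n : ℂ) : Submodule ℂ W := ⨆ α : CModZ, D (n, α)

/-- The graded dual `⨁ (W_n^[α])^*` of `W = ⨁ W_n^[α]`, realized as the space of those linear
functionals on `W` that vanish on all but finitely many of the summands. -/
def gradedDual {W : Type*} [AddCommGroup W] [Module ℂ W] (D : ℂ × CModZ → Submodule ℂ W) :
    Set (Module.Dual ℂ W) := {w' | {i | ∃ x ∈ D i, w' x ≠ 0}.Finite}

/-- A weak `g`-twisted `V`-module graded by the closed right half plane. -/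
structure WeakTwistedModule {V : Type*} [AddCommGroup V] [Module ℂ V]
    (A : VertexOperatorAlgebra V) (g : A.Automorphism)
    (W : Type*) [AddCommGroup W] [Module ℂ W] where
  /-- the summand `W_n^[α]`; it is zero unless `Re n ≥ 0` -/
  piece : ℂ × CModZ → Submodule ℂ W
  piece_eq_bot : ∀ (n : ℂ) (α : CModZ), n.re < 0 → piece (n, α) = ⊥
  isInternal : DirectSum.IsInternal piece
  /-- `modes n k v w` is `Y^g_{n,k}(v) w`, the coefficient of `x^(-n-1) (log x)^k` in
  `Y^g(v, x) w` -/
  modes : ℂ → ℕ → V →ₗ[ℂ] W →ₗ[ℂ] W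
  /-- `Y^g(v, x) w` is a polynomial in `log x` -/
  log_bounded : ∀ (v : V) (w : W), ∃ N : ℕ, ∀ (n : ℂ) (k : ℕ), N < k → modes n k v w = 0
  /-- the action of `g` on `W` -/
  act : W ≃ₗ[ℂ] W
  /-- `Y^{g;p+1}(gv, z) w = Y^{g;p}(v, z) w`, in each degree `n` -/
  equivariance : ∀ (p : ℤ) (z : ℂ), z ≠ 0 → ∀ (v : V) (w : W) (n : ℂ),
    evalProj modes (gradedProj piece isInternal {i | i.1 = n}) (logBranch (p + 1) z) (g.toEnd v) w
      = evalProj modes (gradedProj piece isInternal {i | i.1 = n}) (logBranch p z) v w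
  identity : ∀ (n : ℂ) (k : ℕ) (w : W),
    modes n k A.vac w = if n = -1 ∧ k = 0 then w else 0
  duality : ∀ (u v : V) (w : W), ∀ w' ∈ gradedDual piece,
    ∃ (N : ℕ) (c : Fin (N + 1) → Fin (N + 1) → Fin (N + 1) → Fin (N + 1) → ℂ)
      (m n : Fin (N + 1) → ℂ) (t : ℕ), 0 < t ∧
      ∀ (p : ℤ) (z₁ z₂ : ℂ),
        let l₁ := logBranch p z₁
        let l₂ := logBranch p z₂
        let f : ℂ := ∑ i, ∑ j, ∑ k, ∑ l, c i j k l * Complex.exp (m i * l₁) *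
          Complex.exp (n j * l₂) * l₁ ^ (k : ℕ) * l₂ ^ (l : ℕ) * ((z₁ - z₂) ^ t)⁻¹
        let prod₁₂ : ℂ → ℂ := fun d => evalPair modes w' l₁ u
          (evalProj modes (gradedProj piece isInternal {i | i.1 = d}) l₂ v w)
        let prod₂₁ : ℂ → ℂ := fun d => evalPair modes w' l₂ v
          (evalProj modes (gradedProj piece isInternal {i | i.1 = d}) l₁ u w)
        let iter : ℤ → ℂ := fun d => evalPair modes w' l₂ (A.modeSum (z₁ - z₂) u v d) w
        (‖z₂‖ < ‖z₁‖ → 0 < ‖z₂‖ → Summable (fun d => ‖prod₁₂ d‖) ∧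
          (|argPos z₁ - argPos z₂| < Real.pi / 2 → HasSum prod₁₂ f)) ∧
        (‖z₁‖ < ‖z₂‖ → 0 < ‖z₁‖ → Summable (fun d => ‖prod₂₁ d‖) ∧
          (|argPos z₁ - argPos z₂| < Real.pi / 2 → HasSum prod₂₁ f)) ∧
        (‖z₁ - z₂‖ < ‖z₂‖ → 0 < ‖z₁ - z₂‖ → Summable (fun d => ‖iter d‖) ∧
          (|argPos z₁ - argPos z₂| < Real.pi / 2 → HasSum iter f))
  /-- the degree condition; it says `modes n k v w = 0` when `Re (m - n - 1 + d) < 0` -/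
  modes_mem : ∀ (m : ℤ), ∀ v ∈ A.deg m, ∀ (d : ℂ), ∀ w ∈ degSpace piece d, ∀ (n : ℂ) (k : ℕ),
    modes n k v w ∈ degSpace piece (m - n - 1 + d)
  /-- the sum of the `W_n` with `n` imaginary is the space of vectors annihilated by all components
  of twisted vertex operators whose weights have negative real parts -/
  imaginary_degrees : ∀ w : W, (w ∈ ⨆ (n : ℂ) (_ : n.re = 0), degSpace piece n) ↔
    ∀ (m : ℤ), ∀ v ∈ A.deg m, ∀ (n : ℂ) (k : ℕ), ((m : ℂ) - n - 1).re < 0 → modes n k v w = 0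
  /-- `W^[a+ℤ]` consists of generalized eigenvectors of `g` with eigenvalue `exp (2πia)` -/
  act_generalized : ∀ (a : ℂ), ∀ w ∈ ⨆ n : ℂ, piece (n, (a : CModZ)),
    w ∈ Module.End.maxGenEigenspace act.toLinearMap
      (Complex.exp (2 * (Real.pi : ℂ) * Complex.I * a))
  act_modes : ∀ (n : ℂ) (k : ℕ) (v : V) (w : W),
    act (modes n k v w) = modes n k (g.toEnd v) (act w)
  /-- `d/dx Y^g(v, x) = Y^g(L(-1)v, x)`, in components -/
  L1_derivative : ∀ (n : ℂ) (k : ℕ) (v : V) (w : W),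
    modes n k (A.mode 0 A.conf v) w
      = -n • modes (n - 1) k v w + ((k : ℂ) + 1) • modes (n - 1) (k + 1) v w

namespace WeakTwistedModule

variable {V : Type*} [AddCommGroup V] [Module ℂ V] {A : VertexOperatorAlgebra V}
  {g : A.Automorphism} {W : Type*} [AddCommGroup W] [Module ℂ W] (M : WeakTwistedModule A g W)

/-- The projection `π_d : W → W_d`. -/
def proj (d : ℂ) : W →ₗ[ℂ] W := gradedProj M.piece M.isInternal {i | i.1 = d}

/-- The term `⟨w', Y^g_0(u, z₁) π_d Y^g_0(v, z₂) w⟩` of the product `⟨w', Y^g_0(u, z₁) Y^g_0(v, z₂) w⟩`.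
Powers of `z₁`, `z₂` are formed with the branch of the logarithm for which `0 ≤ arg < 2π`. -/
def productTerm (w' : Module.Dual ℂ W) (u : V) (z₁ : ℂ) (v : V) (z₂ : ℂ) (w : W) (d : ℂ) : ℂ :=
  evalPair (nonlog M.modes) w' (logBranch 0 z₁) u
    (evalProj (nonlog M.modes) (M.proj d) (logBranch 0 z₂) v w)

/-- The terms `((z₁-z₂)/z₂)^i ⟨w', Y^g_0(π_d Y(binom(𝒩, i) u, z₁-z₂) v, z₂) w⟩` of the iterate
`⟨w', Y^g_0(Y((1 + (z₁-z₂)/z₂)^𝒩 u, z₁-z₂) v, z₂) w⟩`. -/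
def iterateTerm (w' : Module.Dual ℂ W) (u : V) (z₁ : ℂ) (v : V) (z₂ : ℂ) (w : W)
    (q : ℕ × ℤ) : ℂ :=
  ((z₁ - z₂) / z₂) ^ q.1 * evalPair (nonlog M.modes) w' (logBranch 0 z₂)
    (A.modeSum (z₁ - z₂) (g.binomNilLog q.1 u) v q.2) w

end WeakTwistedModule

end

/-!
The idea is that the non-logarithmic component is the full twisted vertex operator applied to a
modified vector: `Y^g_0(v, x) = Y^g(x^𝒩 v, x)`, where `x^𝒩 = exp(log x · 𝒩)` is a polynomial in `log x`
on each vector. Indeed, for homogeneous vectors and a fixed `n`, the polynomial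
`F(l) = ∑ₖ l^k Y^g_{n,k}(exp(l𝒩) v) w` satisfies `exp(2πi(a - n)) F(l + 2πi) = F(l)` by equivariance and
`g = exp(2πia) exp(2πi𝒩)`, so it is constant, and it vanishes unless `n ∈ a + ℤ`
(`sum_modes_expNilLog`). Consequently the products and iterates of non-logarithmic components are finite
combinations, with powers of `log z₁` and `log z₂` as coefficients, of the series in the duality property
(`productTerm_eq_sum`, `iterate_eq_sum`; the latter uses that `exp(l𝒩)` is an automorphism,
`expNilLog_mode`). This gives their absolute convergence, and expresses their sums at `z₂ = -1` by one
exponential polynomial in `y`, where `z₁ = -exp y` (`exists_expPoly`). The point `z₂ = -1` is far from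
the branch cut of the logarithm, so that every `z₁` with `Re (z₁ / z₂) > 0` is available.

By linearity (`RationalSums.of_mem_iSup`) all vectors may be taken homogeneous. For degree reasons, and
because only the exponents `n ∈ a + ℤ` and `n ∈ b + ℤ` occur, a product is then, up to
`z₁^(-a) z₂^(-b)` and integral powers of `z₁` and `z₂`, a Laurent series in one variable `z₂ / z₁` or
`z₁ / z₂` with finitely many negative powers (`exists_series_productTerm`). A Laurent series which
equals an exponential polynomial in `log ζ` on the interval `(0, 1)` is a Laurent polynomial: the
translation `y ↦ y - 1` of `y = log ζ` satisfies a polynomial equation `q = 0` on the exponential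
polynomial, while it multiplies the coefficient of `ζ^k` by `exp(-k)`, so that only the finitely many `k`
with `q(exp(-k)) = 0` contribute (`ExpPoly.finite_support_of_hasSum`). After multiplication by
a power of `z₁ - z₂` this applies to both products, and the identity theorem shows that they give the
same rational function.

The iterate depends on `z₂` only through an explicit factor once `(z₁ - z₂) / z₂` is fixed
(`iterate_scaling`), so its value follows from the one at `z₂ = -1`. The double series is summed with the
help of `(1 + x)^𝒩 = ∑ₖ log(1 + x)^k 𝒩^k / k!`, where `binom(𝒩, i)` has the coefficient of `X^i` in
`log(1 + X)^k / k!` at `𝒩^k` (`binomNilLog_apply`, `iterate_family_hasSum`).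
-/

noncomputable section

theorem absConvTo_iff {ι : Type*} {f : ι → ℂ} {s : ℂ} : AbsConvTo f s ↔ HasSum f s :=
  ⟨fun h => h.2, fun h => ⟨h.summable.norm, h⟩⟩

theorem HasSum.congr_eq {ι : Type*} {f h : ι → ℂ} {s t : ℂ} (hf : HasSum f s)
    (hfh : ∀ i, h i = f i) (hst : t = s) : HasSum h t := by
  rw [hst, funext hfh]; exact hf

/-! ### Powers of the formal logarithm -/

namespace LogSeries

open PowerSeries Finset

/-- `binom(s, i)` as a polynomial function of `s`. -/
def binom (s : ℂ) (i : ℕ) : ℂ := ((i.factorial : ℂ)⁻¹) * (descPochhammer ℂ i).eval s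

theorem binom_zero (s : ℂ) : binom s 0 = 1 := by simp [binom]

theorem binom_succ (s : ℂ) (i : ℕ) : ((i : ℂ) + 1) * binom s (i + 1) = (s - i) * binom s i := by
  have h : ((i.factorial : ℂ)) ≠ 0 := by exact_mod_cast i.factorial_ne_zero
  have h' : ((i : ℂ) + 1) ≠ 0 := by exact_mod_cast i.succ_ne_zero
  rw [binom, binom, descPochhammer_succ_eval, Nat.factorial_succ]
  push_cast
  field_simp

theorem binom_natCast (n i : ℕ) : binom n i = n.choose i := by
  have h : ((i.factorial : ℂ)) ≠ 0 := by exact_mod_cast i.factorial_ne_zero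
  rw [binom, descPochhammer_eval_eq_descFactorial, Nat.descFactorial_eq_factorial_mul_choose]
  push_cast
  field_simp

theorem one_add_X_mul_deriv_log : (1 + X) * d⁄dX ℂ (log ℂ) = 1 := by
  rw [deriv_log, add_mul, one_mul]
  ext n
  cases n with
  | zero => simp
  | succ n => simp [coeff_succ_X_mul, coeff_one, pow_succ]

theorem coeff_log_pow_of_lt {i k : ℕ} (h : i < k) : coeff i (log ℂ ^ k) = 0 := by
  have : (X : ℂ⟦X⟧) ^ k ∣ log ℂ ^ k := pow_dvd_pow_of_dvd (X_dvd_iff.2 constantCoeff_log) k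
  exact X_pow_dvd_iff.1 this i h

/-- The coefficients of `(1 + X)^s = exp(s log(1 + X))`. Both sides satisfy
`(1 + X) F' = s F`, `F(0) = 1`. -/
theorem sum_pow_mul_coeff_log_pow (s : ℂ) {K i : ℕ} (h : i < K) :
    ∑ k ∈ range K, s ^ k / (k.factorial : ℂ) * coeff i (log ℂ ^ k) = binom s i := by
  obtain ⟨K, rfl⟩ : ∃ K', K = K' + 1 := ⟨K - 1, by omega⟩
  set F : ℂ⟦X⟧ := ∑ k ∈ range (K + 1), (s ^ k / (k.factorial : ℂ)) • log ℂ ^ k with hF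
  have hc : ∀ i, coeff i F = ∑ k ∈ range (K + 1), s ^ k / (k.factorial : ℂ) * coeff i (log ℂ ^ k) := by
    intro i; simp [hF]
  have hode : (1 + X) * d⁄dX ℂ F = s • F - (s ^ (K + 1) / (K.factorial : ℂ)) • log ℂ ^ K := by
    have h1 : (1 + X) * d⁄dX ℂ F
        = ∑ k ∈ range K, (s ^ (k + 1) / (k.factorial : ℂ)) • log ℂ ^ k := by
      have hd : ∀ k : ℕ, (1 + X) * d⁄dX ℂ (log ℂ ^ (k + 1)) = ((k : ℂ) + 1) • log ℂ ^ k := by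
        intro k
        rw [Derivation.leibniz_pow, Nat.add_sub_cancel, ← Nat.cast_smul_eq_nsmul ℂ, mul_smul_comm,
          smul_eq_mul, mul_left_comm, one_add_X_mul_deriv_log, mul_one]
        push_cast; rfl
      rw [hF, sum_range_succ', map_add, map_sum, mul_add, mul_sum]
      rw [pow_zero, pow_zero, Derivation.map_smul, Derivation.map_one_eq_zero, smul_zero, mul_zero,
        add_zero]
      refine sum_congr rfl fun k _ => ?_
      rw [Derivation.map_smul, mul_smul_comm, hd, smul_smul]
      congr 1
      have h : ((k.factorial : ℂ)) ≠ 0 := by exact_mod_cast k.factorial_ne_zero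
      have h' : ((k : ℂ) + 1) ≠ 0 := by exact_mod_cast k.succ_ne_zero
      rw [Nat.factorial_succ]
      push_cast
      field_simp
    rw [h1, hF, sum_range_succ, smul_add, smul_sum, smul_smul]
    have : s * (s ^ K / (K.factorial : ℂ)) = s ^ (K + 1) / (K.factorial : ℂ) := by ring
    rw [this, add_sub_cancel_right]
    refine sum_congr rfl fun k _ => ?_
    rw [smul_smul]; congr 1; ring
  rw [← hc]
  clear hc
  have h0 : coeff 0 F = 1 := by
    rw [hF, sum_range_succ']
    simp
  induction i with
  | zero => rw [h0, binom_zero]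
  | succ i ih =>
    have hi := ih (by omega)
    have h2 := congrArg (coeff i) hode
    have h' : ((i : ℂ) + 1) ≠ 0 := by exact_mod_cast i.succ_ne_zero
    have h3 : coeff i (X * d⁄dX ℂ F) = i * coeff i F := by
      cases i with
      | zero => simp
      | succ j => rw [coeff_succ_X_mul, coeff_derivative]; push_cast; ring
    rw [add_mul, one_mul, map_add, h3, coeff_derivative, map_sub, map_smul, map_smul,
      coeff_log_pow_of_lt (by omega : i < K), smul_zero, sub_zero, smul_eq_mul, hi] at h2
    apply mul_left_cancel₀ h'
    rw [binom_succ]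
    linear_combination h2

theorem descPochhammer_eq_sum (i : ℕ) :
    ((i.factorial : ℂ)⁻¹) • descPochhammer ℂ i = ∑ k ∈ range (i + 1),
      (coeff i (log ℂ ^ k) / (k.factorial : ℂ)) • (Polynomial.X : Polynomial ℂ) ^ k := by
  refine Polynomial.funext fun s => ?_
  rw [Polynomial.eval_smul, Polynomial.eval_finsetSum, smul_eq_mul]
  change binom s i = _
  rw [← sum_pow_mul_coeff_log_pow s (Nat.lt_succ_self i)]
  refine sum_congr rfl fun k _ => ?_
  simp only [Polynomial.eval_smul, Polynomial.eval_pow, Polynomial.eval_X, smul_eq_mul]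
  ring

/-- `∑ᵢ cᵢ x^i = log(1 + x)^k`, where `log(1 + X)^k = ∑ᵢ cᵢ X^i`. -/
theorem hasSum_coeff_log_pow (k : ℕ) {x : ℂ} (hx : ‖x‖ < 1) :
    HasSum (fun i : ℕ => coeff i (log ℂ ^ k) * x ^ i) (Complex.log (1 + x) ^ k) := by
  induction k with
  | zero =>
    have h : ∀ i, i ≠ 0 → coeff i (log ℂ ^ 0) * x ^ i = 0 := by
      intro i hi
      simp [coeff_one, hi]
    convert hasSum_single 0 h using 1
    simp
  | succ k ih =>
    have h1 : HasSum (fun i : ℕ => coeff i (log ℂ) * x ^ i) (Complex.log (1 + x)) := by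
      convert Complex.hasSum_taylorSeries_log hx using 2 with n
      rw [coeff_log]
      by_cases hn : n = 0
      · simp [hn]
      · simp [hn]; ring
    have hs := (summable_norm_sum_mul_antidiagonal_of_summable_norm ih.summable.norm
      h1.summable.norm).of_norm.hasSum
    rw [← tsum_mul_tsum_eq_tsum_sum_antidiagonal_of_summable_norm ih.summable.norm
      h1.summable.norm, ih.tsum_eq, h1.tsum_eq, ← pow_succ] at hs
    have he : (fun i : ℕ => coeff i (log ℂ ^ (k + 1)) * x ^ i) = fun n => ∑ p ∈ antidiagonal n,
        coeff p.1 (log ℂ ^ k) * x ^ p.1 * (coeff p.2 (log ℂ) * x ^ p.2) := by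
      funext n
      rw [pow_succ, coeff_mul, sum_mul]
      refine sum_congr rfl fun p hp => ?_
      rw [← mem_antidiagonal.1 hp, pow_add]
      ring
    rw [he]
    exact hs

end LogSeries

/-! ### Exponential polynomials and Laurent series -/

namespace ExpPoly

open Complex Filter Topology

/-- The space of exponential polynomials, spanned by the functions `exp(cy) y^k`. -/
def expPoly : Submodule ℂ (ℂ → ℂ) :=
  Submodule.span ℂ (Set.range fun p : ℂ × ℕ => fun y : ℂ => exp (p.1 * y) * y ^ p.2)

theorem monomial_mem (c : ℂ) (k : ℕ) : (fun y : ℂ => exp (c * y) * y ^ k) ∈ expPoly :=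
  Submodule.subset_span ⟨(c, k), rfl⟩

theorem const_mem (c : ℂ) : (fun _ : ℂ => c) ∈ expPoly := by
  have := Submodule.smul_mem _ c (monomial_mem 0 0)
  convert this using 1
  funext y; simp

theorem exp_mem (c : ℂ) : (fun y : ℂ => exp (c * y)) ∈ expPoly := by
  simpa using monomial_mem c 0

theorem id_mem : (fun y : ℂ => y) ∈ expPoly := by
  simpa using monomial_mem 0 1

theorem mul_mem {f h : ℂ → ℂ} (hf : f ∈ expPoly) (hh : h ∈ expPoly) :
    (fun y => f y * h y) ∈ expPoly := by
  change f * h ∈ expPoly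
  have := Submodule.mul_mem_mul hf hh
  rw [expPoly, Submodule.span_mul_span] at this
  refine Submodule.span_le.2 ?_ this
  rintro _ ⟨_, ⟨p, rfl⟩, _, ⟨q, rfl⟩, rfl⟩
  have he : (fun y : ℂ => exp (p.1 * y) * y ^ p.2) * (fun y : ℂ => exp (q.1 * y) * y ^ q.2)
      = fun y : ℂ => exp ((p.1 + q.1) * y) * y ^ (p.2 + q.2) := by
    funext y
    simp only [Pi.mul_apply, add_mul, exp_add, pow_add]
    ring
  have hm := monomial_mem (p.1 + q.1) (p.2 + q.2)
  rw [← he] at hm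
  exact hm

theorem pow_mem {f : ℂ → ℂ} (hf : f ∈ expPoly) (n : ℕ) : (fun y => f y ^ n) ∈ expPoly := by
  induction n with
  | zero => simpa using const_mem 1
  | succ n ih => simpa only [pow_succ] using mul_mem ih hf

theorem comp_neg_mem {f : ℂ → ℂ} (hf : f ∈ expPoly) : (fun y => f (-y)) ∈ expPoly := by
  induction hf using Submodule.span_induction with
  | mem f hf =>
    obtain ⟨p, rfl⟩ := hf
    have he : (fun y : ℂ => exp (p.1 * -y) * (-y) ^ p.2)
        = fun y => exp (-p.1 * y) * ((-1) ^ p.2 * y ^ p.2) := by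
      funext y
      rw [neg_pow y, mul_neg, neg_mul]
    have hm := mul_mem (exp_mem (-p.1)) (mul_mem (const_mem ((-1) ^ p.2)) (pow_mem id_mem p.2))
    rw [← he] at hm
    exact hm
  | zero => exact Submodule.zero_mem _
  | add f h _ _ hf hh => exact Submodule.add_mem _ hf hh
  | smul c f _ hf => exact Submodule.smul_mem _ c hf

theorem sum_mem {ι : Type*} (s : Finset ι) {f : ι → ℂ → ℂ} (hf : ∀ i ∈ s, f i ∈ expPoly) :
    (fun y => ∑ i ∈ s, f i y) ∈ expPoly := by
  convert Submodule.sum_mem _ hf using 1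
  funext y; simp

theorem differentiable {f : ℂ → ℂ} (hf : f ∈ expPoly) : Differentiable ℂ f := by
  induction hf using Submodule.span_induction with
  | mem f hf => obtain ⟨p, rfl⟩ := hf; fun_prop
  | zero => exact differentiable_const 0
  | add f h _ _ hf hh => exact hf.add hh
  | smul c f _ hf => exact hf.const_smul c

/-- The translation `f ↦ f(· - 1)`. -/
def shift : Module.End ℂ (ℂ → ℂ) := LinearMap.funLeft ℂ ℂ fun y => y - 1

theorem shift_pow_apply (n : ℕ) (f : ℂ → ℂ) (y : ℂ) : (shift ^ n) f y = f (y - n) := by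
  induction n generalizing y with
  | zero => simp
  | succ n ih =>
    rw [pow_succ', Module.End.mul_apply, shift, LinearMap.funLeft_apply, ← shift, ih]
    push_cast; ring_nf

/-- The functions killed by a nonzero polynomial in the translation. -/
def shiftTorsion : Submodule ℂ (ℂ → ℂ) where
  carrier := {f | ∃ q : Polynomial ℂ, q ≠ 0 ∧ Polynomial.aeval shift q f = 0}
  zero_mem' := ⟨1, one_ne_zero, map_zero _⟩
  add_mem' := by
    rintro f h ⟨q, hq, hf⟩ ⟨r, hr, hh⟩
    refine ⟨r * q, mul_ne_zero hr hq, ?_⟩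
    rw [map_add, map_mul, Module.End.mul_apply, hf, map_zero, zero_add, ← map_mul, mul_comm,
      map_mul, Module.End.mul_apply, hh, map_zero]
  smul_mem' := by
    rintro c f ⟨q, hq, hf⟩
    exact ⟨q, hq, by rw [map_smul, hf, smul_zero]⟩

theorem expPoly_le_shiftTorsion : expPoly ≤ shiftTorsion := by
  refine Submodule.span_le.2 ?_
  rintro _ ⟨⟨c, k⟩, rfl⟩
  induction k using Nat.strong_induction_on with
  | _ k ih =>
    set f : ℂ → ℂ := fun y => exp (c * y) * y ^ k with hf
    -- `shift - exp(-c)` lowers the degree of the polynomial factor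
    have h1 : Polynomial.aeval shift (Polynomial.X - Polynomial.C (exp (-c))) f ∈ shiftTorsion := by
      have : Polynomial.aeval shift (Polynomial.X - Polynomial.C (exp (-c))) f
          = ∑ j ∈ Finset.range k, (exp (-c) * ((-1) ^ (k - j) * (k.choose j : ℂ))) •
            fun y : ℂ => exp (c * y) * y ^ j := by
        funext y
        rw [map_sub, Polynomial.aeval_X, Polynomial.aeval_C, LinearMap.sub_apply,
          Module.algebraMap_end_apply, Pi.sub_apply, shift, LinearMap.funLeft_apply, hf]
        simp only [Pi.smul_apply, Finset.sum_apply, smul_eq_mul]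
        rw [sub_eq_add_neg y 1, add_pow, Finset.sum_range_succ]
        have h2 : exp (c * (y + -1)) = exp (-c) * exp (c * y) := by
          rw [← exp_add]; ring_nf
        rw [h2, mul_add, Finset.mul_sum]
        simp only [tsub_self, pow_zero, Nat.choose_self, Nat.cast_one, mul_one]
        rw [← mul_assoc, add_sub_cancel_right]
        refine Finset.sum_congr rfl fun j _ => ?_
        ring
      rw [this]
      exact Submodule.sum_mem _ fun j hj =>
        Submodule.smul_mem _ _ (ih j (Finset.mem_range.1 hj))
    obtain ⟨q, hq, hq'⟩ := h1
    refine ⟨q * (Polynomial.X - Polynomial.C (exp (-c))),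
      mul_ne_zero hq (Polynomial.X_sub_C_ne_zero _), ?_⟩
    rw [map_mul, Module.End.mul_apply, hq']

/-- A power series that vanishes on the interval `(0, 1)` is zero. -/
theorem coeff_eq_zero_of_hasSum_zero {b : ℕ → ℂ}
    (h : ∀ r : ℝ, 0 < r → r < 1 → HasSum (fun n => b n * (r : ℂ) ^ n) 0) : b = 0 := by
  have hsum : ∀ z : ℂ, ‖z‖ < 1 / 2 → Summable fun n => b n * z ^ n := by
    intro z hz
    refine Summable.of_norm_bounded (h (1 / 2) (by norm_num) (by norm_num)).summable.norm
      fun n => ?_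
    rw [norm_mul, norm_mul, norm_pow, norm_pow]
    refine mul_le_mul_of_nonneg_left (pow_le_pow_left₀ (norm_nonneg _) ?_ n) (norm_nonneg _)
    rw [Complex.norm_real, Real.norm_of_nonneg (by norm_num)]
    exact hz.le
  set f : ℂ → ℂ := fun z => ∑' n, b n * z ^ n with hf
  set p := FormalMultilinearSeries.ofScalars ℂ b with hp
  have hfp : HasFPowerSeriesAt f p 0 := by
    rw [hasFPowerSeriesAt_iff]
    filter_upwards [Metric.ball_mem_nhds (0 : ℂ) (by norm_num : (0 : ℝ) < 1 / 2)] with z hz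
    rw [mem_ball_zero_iff] at hz
    rw [zero_add]
    refine (hsum z hz).hasSum.congr_eq (fun n => ?_) rfl
    rw [hp, FormalMultilinearSeries.coeff_ofScalars, smul_eq_mul, mul_comm]
  have hlim : Tendsto (fun n : ℕ => ((1 / ((n : ℝ) + 2) : ℝ) : ℂ)) atTop (𝓝[≠] 0) := by
    refine tendsto_nhdsWithin_iff.2 ⟨?_, Eventually.of_forall fun n => ?_⟩
    · have h0 : Tendsto (fun n : ℕ => 1 / ((n : ℝ) + 2)) atTop (𝓝 0) := by
        simpa using (tendsto_const_nhds (x := (1 : ℝ))).div_atTop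
          (tendsto_atTop_add_const_right _ (2 : ℝ) tendsto_natCast_atTop_atTop)
      exact_mod_cast (Complex.continuous_ofReal.tendsto 0).comp h0
    · have : (0 : ℝ) < 1 / ((n : ℝ) + 2) := by positivity
      exact Complex.ofReal_ne_zero.2 this.ne'
  have hfreq : ∃ᶠ z in 𝓝[≠] (0 : ℂ), f z = 0 := by
    refine hlim.frequently (Frequently.of_forall fun n => ?_)
    refine (h _ (by positivity) ?_).tsum_eq
    rw [div_lt_one (by positivity)]
    have : (0 : ℝ) ≤ n := n.cast_nonneg
    linarith
  have hz := hfp.analyticAt.frequently_zero_iff_eventually_zero.1 hfreq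
  have hp0 : p = 0 := HasFPowerSeriesAt.eq_zero (hfp.congr hz)
  funext n
  have : p.coeff n = 0 := by rw [hp0]; simp [FormalMultilinearSeries.coeff]
  rwa [hp, FormalMultilinearSeries.coeff_ofScalars] at this

/-- A Laurent series with finitely many negative powers that vanishes on `(0, 1)` is zero. -/
theorem laurent_coeff_eq_zero {b : ℤ → ℂ} {k₀ : ℤ} (hb : ∀ k < k₀, b k = 0)
    (h : ∀ y : ℝ, y < 0 → HasSum (fun k : ℤ => b k * exp (k * y)) 0) (k : ℤ) : b k = 0 := by
  have key : (fun n : ℕ => b (k₀ + n)) = 0 := by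
    refine coeff_eq_zero_of_hasSum_zero fun r hr0 hr1 => ?_
    have h1 := (h (Real.log r) (Real.log_neg hr0 hr1)).mul_left (exp (-(k₀ * Real.log r)))
    have hinj : Function.Injective fun n : ℕ => k₀ + (n : ℤ) := fun m n hmn => by
      simpa using hmn
    rw [mul_zero, ← hinj.hasSum_iff] at h1
    · refine h1.congr_eq (fun n => ?_) rfl
      rw [Function.comp_apply]
      have : (r : ℂ) ^ n = exp (n * Real.log r) := by
        rw [exp_nat_mul, ← ofReal_exp, Real.exp_log hr0]
      rw [this, mul_left_comm, ← exp_add]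
      congr 2
      push_cast; ring
    · intro k hk
      rw [hb k, zero_mul, mul_zero]
      by_contra hlt
      exact hk ⟨(k - k₀).toNat, by simp only; omega⟩
  by_cases hk : k < k₀
  · exact hb k hk
  · have := congrFun key (k - k₀).toNat
    rw [show k = k₀ + ((k - k₀).toNat : ℤ) by omega]
    exact this

theorem hasSum_one_sub_mul {c : ℤ → ℂ} {ζ s : ℂ} (hζ : ζ ≠ 0)
    (h : HasSum (fun k : ℤ => c k * ζ ^ k) s) :
    HasSum (fun k : ℤ => (c k - c (k - 1)) * ζ ^ k) ((1 - ζ) * s) := by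
  have h2 := (Equiv.subRight (1 : ℤ)).hasSum_iff.2 (h.mul_left ζ)
  refine (h.sub h2).congr_eq (fun k => ?_) (by ring)
  rw [Function.comp_apply, Equiv.subRight_apply, zpow_sub_one₀ hζ]
  field_simp

/-- Multiplying a Laurent series by `(1 - ζ)^t`. -/
theorem exists_one_sub_pow_mul (t : ℕ) {c : ℤ → ℂ} {k₀ : ℤ} (hc : ∀ k < k₀, c k = 0)
    (s : ℂ → ℂ) (D : Set ℂ) (h0 : ∀ ζ ∈ D, ζ ≠ 0)
    (h : ∀ ζ ∈ D, HasSum (fun k : ℤ => c k * ζ ^ k) (s ζ)) :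
    ∃ b : ℤ → ℂ, (∀ k < k₀, b k = 0) ∧
      ∀ ζ ∈ D, HasSum (fun k : ℤ => b k * ζ ^ k) ((1 - ζ) ^ t * s ζ) := by
  induction t with
  | zero => exact ⟨c, hc, by simpa using h⟩
  | succ t ih =>
    obtain ⟨b, hb, hs⟩ := ih
    refine ⟨fun k => b k - b (k - 1), fun k hk => ?_, fun ζ hζ => ?_⟩
    · simp only [hb k hk, hb (k - 1) (by omega), sub_zero]
    · rw [pow_succ', mul_assoc]
      exact hasSum_one_sub_mul (h0 ζ hζ) (hs ζ hζ)

/-- If a Laurent series with finitely many negative powers agrees with an exponential polynomial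
on negative reals, then only finitely many of its coefficients are nonzero: the exponential
polynomial is killed by some `q(shift)`, which multiplies the coefficient of `exp(ky)`
by `q(exp(-k))`. -/
theorem finite_support_of_hasSum {b : ℤ → ℂ} {k₀ : ℤ} (hb : ∀ k < k₀, b k = 0) {G : ℂ → ℂ}
    (hG : G ∈ expPoly) (h : ∀ y : ℝ, y < 0 → HasSum (fun k : ℤ => b k * exp (k * y)) (G y)) :
    (Function.support b).Finite := by
  obtain ⟨q, hq, hqG⟩ := expPoly_le_shiftTorsion hG
  have hkey : ∀ k, q.eval (exp (-(k : ℤ))) * b k = 0 := by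
    refine laurent_coeff_eq_zero (k₀ := k₀) (fun k hk => by rw [hb k hk, mul_zero]) fun y hy => ?_
    have h1 : HasSum (fun k : ℤ => ∑ i ∈ Finset.range (q.natDegree + 1),
        q.coeff i * (b k * exp (k * ((y - i : ℝ) : ℂ))))
        (∑ i ∈ Finset.range (q.natDegree + 1), q.coeff i * G ((y - i : ℝ) : ℂ)) := by
      refine hasSum_sum fun i _ => (h (y - i) ?_).mul_left _
      have : (0 : ℝ) ≤ i := i.cast_nonneg
      linarith
    have h2 : ∑ i ∈ Finset.range (q.natDegree + 1), q.coeff i * G ((y - i : ℝ) : ℂ) = 0 := by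
      have := congrFun hqG y
      rw [Polynomial.aeval_eq_sum_range, LinearMap.sum_apply, Finset.sum_apply] at this
      simp only [LinearMap.smul_apply, Pi.smul_apply, shift_pow_apply, smul_eq_mul,
        Pi.zero_apply] at this
      push_cast
      exact this
    rw [h2] at h1
    refine h1.congr_eq (fun k => ?_) rfl
    rw [Polynomial.eval_eq_sum_range, Finset.sum_mul, Finset.sum_mul]
    refine Finset.sum_congr rfl fun i _ => ?_
    rw [← exp_nat_mul]
    have : exp (k * ((y - i : ℝ) : ℂ)) = exp (i * -(k : ℂ)) * exp (k * y) := by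
      rw [← exp_add]; push_cast; ring_nf
    rw [this]; ring
  have hinj : Function.Injective fun k : ℤ => exp (-(k : ℂ)) := by
    intro k l hkl
    have : exp ((-(k : ℝ) : ℝ) : ℂ) = exp ((-(l : ℝ) : ℝ) : ℂ) := by simpa using hkl
    rw [← ofReal_exp, ← ofReal_exp, ofReal_inj, Real.exp_eq_exp, neg_inj] at this
    exact_mod_cast this
  refine (((q.roots.toFinset).finite_toSet).preimage hinj.injOn).subset fun k hk => ?_
  have := (mul_eq_zero.1 (hkey k)).resolve_right hk
  simpa [hq] using this

/-- Entire functions that agree at the negative reals are equal. -/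
theorem eq_of_eq_on_negative_reals {f h : ℂ → ℂ} (hf : Differentiable ℂ f) (hh : Differentiable ℂ h)
    (he : ∀ y : ℝ, y < 0 → f y = h y) : f = h := by
  refine AnalyticOnNhd.eq_of_frequently_eq (z₀ := -1)
    (hf.differentiableOn.analyticOnNhd isOpen_univ) (hh.differentiableOn.analyticOnNhd isOpen_univ) ?_
  have hlim : Tendsto (fun n : ℕ => ((-1 - 1 / ((n : ℝ) + 1) : ℝ) : ℂ)) atTop (𝓝[≠] (-1)) := by
    refine tendsto_nhdsWithin_iff.2 ⟨?_, Eventually.of_forall fun n => ?_⟩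
    · have h0 := (tendsto_const_nhds (x := (-1 : ℝ))).sub tendsto_one_div_add_atTop_nhds_zero_nat
      simpa [Function.comp_def] using (Complex.continuous_ofReal.tendsto _).comp h0
    · have : (0 : ℝ) < 1 / ((n : ℝ) + 1) := by positivity
      intro h
      have h' : ((-1 - 1 / ((n : ℝ) + 1) : ℝ) : ℂ) = ((-1 : ℝ) : ℂ) := by simpa using h
      rw [ofReal_inj] at h'
      linarith
  refine hlim.frequently (Frequently.of_forall fun n => he _ ?_)
  have : (0 : ℝ) < 1 / ((n : ℝ) + 1) := by positivity
  linarith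

/-- A Laurent series on the punctured unit disc which, multiplied by `(1 - ζ)^t`, agrees on `(0, 1)`
with an exponential polynomial in `log ζ` represents a rational function, and the exponential
polynomial is a Laurent polynomial in the exponential function. -/
theorem exists_laurent_of_expPoly {c : ℤ → ℂ} {k₀ : ℤ} (hc : ∀ k < k₀, c k = 0) (t : ℕ)
    {G : ℂ → ℂ} (hG : G ∈ expPoly) (s : ℂ → ℂ)
    (hs : ∀ ζ : ℂ, 0 < ‖ζ‖ → ‖ζ‖ < 1 → HasSum (fun k : ℤ => c k * ζ ^ k) (s ζ))
    (h : ∀ y : ℝ, y < 0 → (1 - exp y) ^ t * s (exp y) = G y) :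
    ∃ (S : Finset ℤ) (C : ℤ → ℂ),
      (∀ ζ : ℂ, 0 < ‖ζ‖ → ‖ζ‖ < 1 → (1 - ζ) ^ t * s ζ = ∑ k ∈ S, C k * ζ ^ k) ∧
      ∀ y : ℂ, G y = ∑ k ∈ S, C k * exp y ^ k := by
  obtain ⟨b, hb, hbs⟩ := exists_one_sub_pow_mul t hc s {ζ | 0 < ‖ζ‖ ∧ ‖ζ‖ < 1}
    (fun ζ hζ => norm_pos_iff.1 hζ.1) fun ζ hζ => hs ζ hζ.1 hζ.2
  have hmem : ∀ y : ℝ, y < 0 → 0 < ‖exp (y : ℂ)‖ ∧ ‖exp (y : ℂ)‖ < 1 := by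
    intro y hy
    rw [norm_exp, ofReal_re]
    exact ⟨Real.exp_pos y, by simpa using hy⟩
  have hfin : (Function.support b).Finite := by
    refine finite_support_of_hasSum hb hG fun y hy => ?_
    have := hbs _ (hmem y hy)
    rw [h y hy] at this
    exact this.congr_eq (fun k => by rw [← exp_int_mul]) rfl
  have hval : ∀ ζ : ℂ, 0 < ‖ζ‖ → ‖ζ‖ < 1 →
      (1 - ζ) ^ t * s ζ = ∑ k ∈ hfin.toFinset, b k * ζ ^ k := by
    intro ζ h1 h2
    refine (hbs ζ ⟨h1, h2⟩).unique (hasSum_sum_of_ne_finset_zero fun k hk => ?_)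
    rw [Set.Finite.mem_toFinset, Function.notMem_support] at hk
    rw [hk, zero_mul]
  refine ⟨hfin.toFinset, b, hval, fun y => ?_⟩
  have hd : Differentiable ℂ fun y : ℂ => ∑ k ∈ hfin.toFinset, b k * exp y ^ k := by
    simp only [← exp_int_mul]
    fun_prop
  refine congrFun (eq_of_eq_on_negative_reals (differentiable hG) hd fun y hy => ?_) y
  rw [← h y hy, hval _ (hmem y hy).1 (hmem y hy).2]

end ExpPoly

/-! ### Functional calculus for locally nilpotent operators -/

section FunctionalCalculus

open PowerSeries Finset

variable {V : Type*} [AddCommGroup V] [Module ℂ V]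

theorem Module.End.pow_apply_eq_zero_of_le {T : Module.End ℂ V} {r k : ℕ} {x : V}
    (h : (T ^ r) x = 0) (hk : r ≤ k) : (T ^ k) x = 0 := by
  obtain ⟨j, rfl⟩ := Nat.exists_eq_add_of_le' hk
  rw [pow_add, Module.End.mul_apply, h, map_zero]

theorem aeval_apply_eq_sum_range {T : Module.End ℂ V} {r : ℕ} {x : V} (h : (T ^ r) x = 0)
    (p : Polynomial ℂ) : Polynomial.aeval T p x = ∑ i ∈ range r, p.coeff i • (T ^ i) x := by
  rw [Polynomial.aeval_eq_sum_range' (n := p.natDegree + 1 + r) (by omega), LinearMap.sum_apply]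
  refine (sum_subset (range_subset_range.2 (by omega)) fun i _ hi => ?_).symm
  rw [mem_range, not_lt] at hi
  rw [LinearMap.smul_apply, Module.End.pow_apply_eq_zero_of_le h hi, smul_zero]

theorem aeval_trunc_apply {T : Module.End ℂ V} {r : ℕ} {x : V} (h : (T ^ r) x = 0)
    (f : ℂ⟦X⟧) : Polynomial.aeval T (trunc r f) x = ∑ i ∈ range r, coeff i f • (T ^ i) x := by
  rw [aeval_apply_eq_sum_range h]
  refine sum_congr rfl fun i hi => ?_
  rw [coeff_trunc, if_pos (mem_range.1 hi)]

theorem aeval_trunc_mul {T : Module.End ℂ V} {r : ℕ} {x : V} (h : (T ^ r) x = 0) (f f' : ℂ⟦X⟧) :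
    Polynomial.aeval T (trunc r f) (Polynomial.aeval T (trunc r f') x)
      = Polynomial.aeval T (trunc r (f * f')) x := by
  rw [← Module.End.mul_apply, ← map_mul, aeval_apply_eq_sum_range h, aeval_trunc_apply h]
  refine sum_congr rfl fun i hi => ?_
  rw [coeff_mul_eq_coeff_trunc_mul_trunc f f' (mem_range.1 hi), ← Polynomial.coe_mul,
    Polynomial.coeff_coe]

theorem pow_aeval_apply_eq_zero {T : Module.End ℂ V} {r : ℕ} {x : V} (h : (T ^ r) x = 0)
    (p : Polynomial ℂ) : (T ^ r) (Polynomial.aeval T p x) = 0 := by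
  have : T ^ r = Polynomial.aeval T (Polynomial.X ^ r : Polynomial ℂ) := by simp
  rw [this, ← Module.End.mul_apply, ← map_mul, mul_comm, map_mul, Module.End.mul_apply, ← this, h,
    map_zero]

/-- A polynomial function with coefficients in a vector space that vanishes on an infinite set
is zero. -/
theorem eq_zero_of_polynomial {W ι : Type*} [AddCommGroup W] [Module ℂ W] (s : Finset ι)
    (e : ι → ℕ) (x : ι → W) {S : Set ℂ} (hS : S.Infinite)
    (h : ∀ l ∈ S, ∑ i ∈ s, l ^ e i • x i = 0) (l : ℂ) : ∑ i ∈ s, l ^ e i • x i = 0 := by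
  refine (Module.forall_dual_apply_eq_zero_iff ℂ _).1 fun φ => ?_
  set p : Polynomial ℂ := ∑ i ∈ s, Polynomial.monomial (e i) (φ (x i)) with hp
  have hev : ∀ l, φ (∑ i ∈ s, l ^ e i • x i) = p.eval l := by
    intro l
    rw [hp, Polynomial.eval_finsetSum, map_sum]
    refine sum_congr rfl fun i _ => ?_
    rw [map_smul, Polynomial.eval_monomial, smul_eq_mul, mul_comm]
  have hp0 : p = 0 := by
    refine Polynomial.eq_zero_of_infinite_isRoot p (hS.mono fun l hl => ?_)
    rw [Set.mem_ofPred_eq, Polynomial.IsRoot, ← hev, h l hl, map_zero]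
  rw [hev, hp0, Polynomial.eval_zero]

theorem infinite_range_mul_natCast {c : ℂ} (hc : c ≠ 0) : (Set.range fun n : ℕ => c * n).Infinite := by
  refine Set.infinite_range_of_injective fun m n h => ?_
  exact_mod_cast mul_left_cancel₀ hc h

end FunctionalCalculus

/-! ### The operators `exp(l𝒩)` -/

namespace VertexOperatorAlgebra.Automorphism

open PowerSeries Finset

variable {V : Type*} [AddCommGroup V] [Module ℂ V] {A : VertexOperatorAlgebra V}
  (g : A.Automorphism)

theorem nilLog_apply {r : ℕ} {x : V} (h : ((g.unipotentPart - 1) ^ r) x = 0) :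
    g.nilLog x = (2 * (Real.pi : ℂ) * Complex.I)⁻¹ •
      Polynomial.aeval (g.unipotentPart - 1) (trunc r (log ℂ)) x := by
  change ∑ᶠ j : ℕ, _ = _
  rw [finsum_eq_sum_of_support_subset (s := range r), aeval_trunc_apply h, smul_sum]
  · have hr : ∑ i ∈ range r, (2 * (Real.pi : ℂ) * Complex.I)⁻¹ •
        coeff i (log ℂ) • ((g.unipotentPart - 1) ^ i) x = ∑ i ∈ range (r + 1),
        (2 * (Real.pi : ℂ) * Complex.I)⁻¹ • coeff i (log ℂ) • ((g.unipotentPart - 1) ^ i) x := by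
      rw [sum_range_succ, h, smul_zero, smul_zero, add_zero]
    rw [hr, sum_range_succ', coeff_log, if_pos rfl, zero_smul, smul_zero, add_zero]
    refine sum_congr rfl fun j _ => ?_
    rw [smul_smul, coeff_log, if_neg (Nat.succ_ne_zero j)]
    congr 1
    have h' : ((j : ℂ) + 1) ≠ 0 := by exact_mod_cast j.succ_ne_zero
    have hpi := Complex.two_pi_I_ne_zero
    simp only [pow_succ, map_div₀, map_mul, map_neg, map_one, map_natCast, map_pow]
    push_cast
    field_simp
  · intro j hj
    rw [coe_range, Set.mem_Iio]
    by_contra hlt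
    refine hj ?_
    simp only
    rw [Module.End.pow_apply_eq_zero_of_le h (by omega), smul_zero]

theorem nilLog_pow_apply {r : ℕ} {x : V} (h : ((g.unipotentPart - 1) ^ r) x = 0) (k : ℕ) :
    (g.nilLog ^ k) x = ((2 * (Real.pi : ℂ) * Complex.I)⁻¹ ^ k) •
      Polynomial.aeval (g.unipotentPart - 1) (trunc r (log ℂ ^ k)) x := by
  induction k with
  | zero =>
    have h1 := aeval_apply_eq_sum_range h (1 : Polynomial ℂ)
    rw [map_one, Module.End.one_apply] at h1
    rw [pow_zero, pow_zero, pow_zero, one_smul, Module.End.one_apply, aeval_trunc_apply h]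
    refine h1.trans (sum_congr rfl fun i _ => ?_)
    rw [PowerSeries.coeff_one, Polynomial.coeff_one]
  | succ k ih =>
    rw [pow_succ', Module.End.mul_apply, ih, map_smul,
      g.nilLog_apply (pow_aeval_apply_eq_zero h _), aeval_trunc_mul h, smul_smul, ← pow_succ,
      ← pow_succ']

theorem nilLog_pow_eq_zero {r : ℕ} {x : V} (h : ((g.unipotentPart - 1) ^ r) x = 0) :
    (g.nilLog ^ r) x = 0 := by
  rw [g.nilLog_pow_apply h, aeval_trunc_apply h, sum_eq_zero, smul_zero]
  intro i hi
  rw [LogSeries.coeff_log_pow_of_lt (mem_range.1 hi), zero_smul]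

theorem exists_nilLog_pow_eq_zero (x : V) : ∃ r, (g.nilLog ^ r) x = 0 := by
  obtain ⟨r, hr⟩ := g.unipotentPart_locallyUnipotent x
  exact ⟨r, g.nilLog_pow_eq_zero hr⟩

theorem expNilLog_support (l : ℂ) {r : ℕ} {x : V} (h : (g.nilLog ^ r) x = 0) :
    (Function.support fun k : ℕ => (l ^ k / (k.factorial : ℂ)) • (g.nilLog ^ k) x) ⊆ range r := by
  intro k hk
  rw [coe_range, Set.mem_Iio]
  by_contra hlt
  refine hk ?_
  simp only
  rw [Module.End.pow_apply_eq_zero_of_le h (by omega), smul_zero]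

theorem expNilLog_finite_support (l : ℂ) (x : V) :
    (Function.support fun k : ℕ => (l ^ k / (k.factorial : ℂ)) • (g.nilLog ^ k) x).Finite := by
  obtain ⟨r, hr⟩ := g.exists_nilLog_pow_eq_zero x
  exact (range r).finite_toSet.subset (g.expNilLog_support l hr)

/-- The operator `exp(l𝒩) = ∑ₖ l^k 𝒩^k / k!`, a finite sum on each vector. -/
def expNilLog (l : ℂ) : Module.End ℂ V where
  toFun x := ∑ᶠ k : ℕ, (l ^ k / (k.factorial : ℂ)) • (g.nilLog ^ k) x
  map_add' x y := by
    rw [← finsum_add_distrib (g.expNilLog_finite_support l x) (g.expNilLog_finite_support l y)]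
    simp only [map_add, smul_add]
  map_smul' c x := by
    rw [RingHom.id_apply, smul_finsum' c (g.expNilLog_finite_support l x)]
    refine finsum_congr fun j => ?_
    rw [map_smul, smul_comm]

theorem expNilLog_apply (l : ℂ) {r : ℕ} {x : V} (h : (g.nilLog ^ r) x = 0) :
    g.expNilLog l x = ∑ k ∈ range r, (l ^ k / (k.factorial : ℂ)) • (g.nilLog ^ k) x :=
  finsum_eq_sum_of_support_subset _ (g.expNilLog_support l h)

theorem expNilLog_eq_aeval (l : ℂ) {r : ℕ} {x : V} (h : (g.nilLog ^ r) x = 0) :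
    g.expNilLog l x = Polynomial.aeval g.nilLog (trunc r (rescale l (exp ℂ))) x := by
  rw [g.expNilLog_apply l h, aeval_trunc_apply h]
  refine sum_congr rfl fun k _ => ?_
  rw [coeff_rescale, coeff_exp]
  simp [div_eq_mul_inv]

theorem expNilLog_add (s t : ℂ) (x : V) :
    g.expNilLog s (g.expNilLog t x) = g.expNilLog (s + t) x := by
  obtain ⟨r, hr⟩ := g.exists_nilLog_pow_eq_zero x
  rw [g.expNilLog_eq_aeval t hr, g.expNilLog_eq_aeval s (pow_aeval_apply_eq_zero hr _),
    aeval_trunc_mul hr, exp_mul_exp_eq_exp_add, g.expNilLog_eq_aeval (s + t) hr]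

theorem expNilLog_zero (x : V) : g.expNilLog 0 x = x := by
  obtain ⟨r, hr⟩ := g.exists_nilLog_pow_eq_zero x
  have hr' : (g.nilLog ^ (r + 1)) x = 0 := by
    rw [pow_succ', Module.End.mul_apply, hr, map_zero]
  rw [g.expNilLog_apply 0 hr', sum_range_succ', sum_eq_zero]
  · simp
  · intro k _
    rw [zero_pow (Nat.succ_ne_zero k), zero_div, zero_smul]

/-- `exp(2πi𝒩) = g_u`. -/
theorem expNilLog_two_pi_I_mul (n : ℕ) (x : V) :
    g.expNilLog (2 * (Real.pi : ℂ) * Complex.I * n) x = (g.unipotentPart ^ n) x := by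
  obtain ⟨r, hr⟩ := g.unipotentPart_locallyUnipotent x
  have hpi := Complex.two_pi_I_ne_zero
  rw [g.expNilLog_apply _ (g.nilLog_pow_eq_zero hr)]
  have h1 : ∀ k ∈ range r, ((2 * (Real.pi : ℂ) * Complex.I * n) ^ k / (k.factorial : ℂ)) •
      (g.nilLog ^ k) x = ∑ i ∈ range r, ((n : ℂ) ^ k / (k.factorial : ℂ) * coeff i (log ℂ ^ k)) •
        ((g.unipotentPart - 1) ^ i) x := by
    intro k _
    rw [g.nilLog_pow_apply hr, aeval_trunc_apply hr, smul_smul, smul_sum]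
    refine sum_congr rfl fun i _ => ?_
    rw [smul_smul]
    congr 2
    rw [mul_pow, inv_pow]
    field_simp
  rw [sum_congr rfl h1, sum_comm]
  have h2 : (g.unipotentPart ^ n) x
      = Polynomial.aeval (g.unipotentPart - 1) ((1 + Polynomial.X) ^ n : Polynomial ℂ) x := by
    simp
  rw [h2, aeval_apply_eq_sum_range hr]
  refine sum_congr rfl fun i hi => ?_
  rw [← sum_smul, LogSeries.sum_pow_mul_coeff_log_pow _ (mem_range.1 hi), LogSeries.binom_natCast,
    Polynomial.coeff_one_add_X_pow]

theorem expNilLog_two_pi_I (x : V) :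
    g.expNilLog (2 * (Real.pi : ℂ) * Complex.I) x = g.unipotentPart x := by
  simpa using g.expNilLog_two_pi_I_mul 1 x

theorem binomNilLog_apply (i : ℕ) {K : ℕ} {x : V} (h : (g.nilLog ^ K) x = 0) :
    g.binomNilLog i x = ∑ k ∈ range K,
      (coeff i (log ℂ ^ k) / (k.factorial : ℂ)) • (g.nilLog ^ k) x := by
  rw [binomNilLog, ← map_smul, LogSeries.descPochhammer_eq_sum, map_sum, LinearMap.sum_apply]
  have h1 : ∀ k, Polynomial.aeval g.nilLog ((coeff i (log ℂ ^ k) / (k.factorial : ℂ)) •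
      (Polynomial.X : Polynomial ℂ) ^ k) x
      = (coeff i (log ℂ ^ k) / (k.factorial : ℂ)) • (g.nilLog ^ k) x := by
    intro k; simp
  simp only [h1]
  have e1 : range (i + 1) ⊆ range (i + 1 + K) := range_subset_range.2 (by omega)
  have e2 : range K ⊆ range (i + 1 + K) := range_subset_range.2 (by omega)
  rw [sum_subset e1, sum_subset e2]
  · intro k _ hk
    rw [mem_range, not_lt] at hk
    rw [Module.End.pow_apply_eq_zero_of_le h hk, smul_zero]
  · intro k _ hk
    rw [mem_range, not_lt] at hk
    rw [LogSeries.coeff_log_pow_of_lt (by omega), zero_div, zero_smul]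

/-! ### Compatibility of `exp(l𝒩)` with the vertex operators -/

theorem toEnd_mode (n : ℤ) (u v : V) :
    g.toEnd (A.mode n u v) = A.mode n (g.toEnd u) (g.toEnd v) := g.map_mode n u v

theorem mem_maxGenEigenspace_of_sub {μ : ℂ} {x : V}
    (h : g.toEnd x - μ • x ∈ g.toEnd.maxGenEigenspace μ) : x ∈ g.toEnd.maxGenEigenspace μ := by
  obtain ⟨k, hk⟩ := (Module.End.mem_maxGenEigenspace _ _ _).1 h
  refine (Module.End.mem_maxGenEigenspace _ _ _).2 ⟨k + 1, ?_⟩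
  rw [pow_succ, Module.End.mul_apply]
  simpa using hk

theorem mode_mem_maxGenEigenspace {μ ν : ℂ} {u v : V} (hu : u ∈ g.toEnd.maxGenEigenspace μ)
    (hv : v ∈ g.toEnd.maxGenEigenspace ν) (n : ℤ) :
    A.mode n u v ∈ g.toEnd.maxGenEigenspace (μ * ν) := by
  obtain ⟨j, hj⟩ := (Module.End.mem_maxGenEigenspace _ _ _).1 hu
  obtain ⟨k, hk⟩ := (Module.End.mem_maxGenEigenspace _ _ _).1 hv
  clear hu hv
  induction hN : j + k generalizing j k u v with
  | zero =>
    obtain rfl : j = 0 := by omega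
    have : u = 0 := by simpa using hj
    rw [this, map_zero, LinearMap.zero_apply]
    exact Submodule.zero_mem _
  | succ N ih =>
    cases j with
    | zero =>
      have : u = 0 := by simpa using hj
      rw [this, map_zero, LinearMap.zero_apply]
      exact Submodule.zero_mem _
    | succ j =>
      cases k with
      | zero =>
        have : v = 0 := by simpa using hk
        rw [this, map_zero]
        exact Submodule.zero_mem _
      | succ k =>
        refine g.mem_maxGenEigenspace_of_sub ?_
        have he : g.toEnd (A.mode n u v) - (μ * ν) • A.mode n u v
            = A.mode n ((g.toEnd - μ • 1) u) (g.toEnd v)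
              + μ • A.mode n u ((g.toEnd - ν • 1) v) := by
          rw [toEnd_mode]
          simp only [LinearMap.sub_apply, LinearMap.smul_apply, Module.End.one_apply, map_sub,
            map_smul, smul_sub, smul_smul]
          abel
        rw [he]
        refine Submodule.add_mem _ (ih j ?_ (k + 1) ?_ (by omega))
          (Submodule.smul_mem _ _ (ih (j + 1) hj k ?_ (by omega)))
        · rw [← Module.End.mul_apply, ← pow_succ, hj]
        · have hc : Commute ((g.toEnd - ν • 1) ^ (k + 1)) g.toEnd :=
            ((Commute.refl g.toEnd).sub_left
              ((Commute.one_left g.toEnd).smul_left ν)).pow_left (k + 1)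
          rw [← Module.End.mul_apply, hc.eq, Module.End.mul_apply, hk, map_zero]
        · rw [← Module.End.mul_apply, ← pow_succ, hk]

theorem mem_iSup_maxGenEigenspace (v : V) : v ∈ ⨆ μ, g.toEnd.maxGenEigenspace μ := by
  rw [g.isInternal_maxGenEigenspace.submodule_iSup_eq_top]; trivial

theorem unipotentPart_mode (n : ℤ) (u v : V) :
    g.unipotentPart (A.mode n u v) = A.mode n (g.unipotentPart u) (g.unipotentPart v) := by
  induction g.mem_iSup_maxGenEigenspace u using Submodule.iSup_induction' with
  | zero => simp
  | add x y _ _ hx hy => simp only [map_add, LinearMap.add_apply, hx, hy]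
  | mem μ u hu =>
    induction g.mem_iSup_maxGenEigenspace v using Submodule.iSup_induction' with
    | zero => simp
    | add x y _ _ hx hy => simp only [map_add, hx, hy]
    | mem ν v hv =>
      rw [g.unipotentPart_apply (g.mode_mem_maxGenEigenspace hu hv n), g.unipotentPart_apply hu,
        g.unipotentPart_apply hv, toEnd_mode]
      simp only [map_smul, LinearMap.smul_apply, smul_smul]
      rw [mul_inv, mul_comm]

theorem unipotentPart_pow_mode (k : ℕ) (n : ℤ) (u v : V) : (g.unipotentPart ^ k) (A.mode n u v)
    = A.mode n ((g.unipotentPart ^ k) u) ((g.unipotentPart ^ k) v) := by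
  induction k generalizing u v with
  | zero => simp
  | succ k ih =>
    simp only [pow_succ, Module.End.mul_apply]
    rw [unipotentPart_mode, ih]

/-- The operators `exp(l𝒩)` are automorphisms: both sides are polynomials in `l` that agree at
the multiples of `2πi`, where `exp(l𝒩)` is a power of `g_u`. -/
theorem expNilLog_mode (l : ℂ) (n : ℤ) (u v : V) : g.expNilLog l (A.mode n u v)
    = A.mode n (g.expNilLog l u) (g.expNilLog l v) := by
  obtain ⟨r₀, h₀⟩ := g.exists_nilLog_pow_eq_zero (A.mode n u v)
  obtain ⟨r₁, h₁⟩ := g.exists_nilLog_pow_eq_zero u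
  obtain ⟨r₂, h₂⟩ := g.exists_nilLog_pow_eq_zero v
  have hpoly : ∀ l, g.expNilLog l (A.mode n u v) - A.mode n (g.expNilLog l u) (g.expNilLog l v)
      = ∑ i ∈ (range r₀).disjSum (range r₁ ×ˢ range r₂), l ^ (Sum.elim id (fun p => p.1 + p.2) i) •
        Sum.elim (fun k => ((k.factorial : ℂ)⁻¹) • (g.nilLog ^ k) (A.mode n u v))
          (fun p => -((p.1.factorial : ℂ)⁻¹ * (p.2.factorial : ℂ)⁻¹) •
            A.mode n ((g.nilLog ^ p.1) u) ((g.nilLog ^ p.2) v)) i := by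
    intro l
    rw [g.expNilLog_apply l h₀, g.expNilLog_apply l h₁, g.expNilLog_apply l h₂, sum_disjSum,
      sum_product, sub_eq_add_neg]
    simp only [Sum.elim_inl, Sum.elim_inr, id_eq, map_sum, LinearMap.sum_apply, map_smul,
      LinearMap.smul_apply]
    congr 1
    · refine sum_congr rfl fun k _ => ?_
      rw [smul_smul, div_eq_mul_inv]
    · rw [sum_comm, ← sum_neg_distrib]
      refine sum_congr rfl fun k _ => ?_
      rw [smul_sum, ← sum_neg_distrib]
      refine sum_congr rfl fun j _ => ?_
      rw [smul_smul, smul_smul, ← neg_smul]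
      congr 1
      rw [pow_add]; ring
  refine sub_eq_zero.1 ?_
  rw [hpoly]
  refine eq_zero_of_polynomial _ _ _ (infinite_range_mul_natCast Complex.two_pi_I_ne_zero) ?_ l
  rintro _ ⟨k, rfl⟩
  rw [← hpoly]
  simp only [expNilLog_two_pi_I_mul, unipotentPart_pow_mode, sub_self]

/-! ### Homogeneous generalized eigenvectors -/

/-- The space of generalized eigenvectors of `g` with eigenvalue `exp(2πia)` in `V₍ₘ₎`. -/
def homSpace (m : ℤ) (a : ℂ) : Submodule ℂ V := A.deg m ⊓ g.genSpace a

theorem toEnd_mem_homSpace {m : ℤ} {a : ℂ} {x : V} (hx : x ∈ g.homSpace m a) :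
    g.toEnd x ∈ g.homSpace m a :=
  ⟨g.map_deg m hx.1, Module.End.mapsTo_maxGenEigenspace_of_comm (Commute.refl g.toEnd) _ hx.2⟩

theorem unipotentPart_sub_one_pow_mem {m : ℤ} {a : ℂ} {x : V} (hx : x ∈ g.homSpace m a) (k : ℕ) :
    ((g.unipotentPart - 1) ^ k) x ∈ g.homSpace m a := by
  induction k with
  | zero => simpa using hx
  | succ k ih =>
    rw [pow_succ', Module.End.mul_apply, LinearMap.sub_apply, Module.End.one_apply,
      g.unipotentPart_apply ih.2]
    exact Submodule.sub_mem _ (Submodule.smul_mem _ _ (g.toEnd_mem_homSpace ih)) ih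

theorem nilLog_mem_homSpace {m : ℤ} {a : ℂ} {x : V} (hx : x ∈ g.homSpace m a) :
    g.nilLog x ∈ g.homSpace m a := by
  obtain ⟨r, hr⟩ := g.unipotentPart_locallyUnipotent x
  rw [g.nilLog_apply hr, aeval_trunc_apply hr]
  exact Submodule.smul_mem _ _ (Submodule.sum_mem _ fun i _ =>
    Submodule.smul_mem _ _ (g.unipotentPart_sub_one_pow_mem hx i))

theorem nilLog_pow_mem_homSpace {m : ℤ} {a : ℂ} {x : V} (hx : x ∈ g.homSpace m a) (k : ℕ) :
    (g.nilLog ^ k) x ∈ g.homSpace m a := by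
  induction k with
  | zero => simpa using hx
  | succ k ih =>
    rw [pow_succ', Module.End.mul_apply]
    exact g.nilLog_mem_homSpace ih

theorem expNilLog_mem_homSpace {m : ℤ} {a : ℂ} {x : V} (hx : x ∈ g.homSpace m a) (l : ℂ) :
    g.expNilLog l x ∈ g.homSpace m a := by
  obtain ⟨r, hr⟩ := g.exists_nilLog_pow_eq_zero x
  rw [g.expNilLog_apply l hr]
  exact Submodule.sum_mem _ fun k _ => Submodule.smul_mem _ _ (g.nilLog_pow_mem_homSpace hx k)

theorem mode_mem_homSpace {m m' : ℤ} {a b : ℂ} {u v : V} (hu : u ∈ g.homSpace m a)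
    (hv : v ∈ g.homSpace m' b) (n : ℤ) : A.mode n u v ∈ g.homSpace (m + m' - n - 1) (a + b) := by
  refine ⟨A.mode_mem m m' n u hu.1 v hv.1, ?_⟩
  have := g.mode_mem_maxGenEigenspace hu.2 hv.2 n
  rwa [← Complex.exp_add, ← mul_add] at this

/-- On `V^[a+ℤ]`, `g = exp(2πia) g_u`. -/
theorem toEnd_apply_of_mem {a : ℂ} {x : V} (hx : x ∈ g.genSpace a) : g.toEnd x
    = Complex.exp (2 * (Real.pi : ℂ) * Complex.I * a) • g.unipotentPart x := by
  rw [g.unipotentPart_apply hx, smul_smul, mul_inv_cancel₀ (Complex.exp_ne_zero _), one_smul]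

theorem genSpace_le_iSup_homSpace (a : ℂ) : g.genSpace a ≤ ⨆ m, g.homSpace m a := by
  intro x hx
  have hproj : ∀ (m : ℤ) (y : V), gradedProj A.deg A.isInternal {m} (g.toEnd y)
      = g.toEnd (gradedProj A.deg A.isInternal {m} y) := by
    intro m y
    have hy : y ∈ ⨆ i, A.deg i := by rw [A.isInternal.submodule_iSup_eq_top]; trivial
    induction hy using Submodule.iSup_induction' with
    | zero => simp
    | add x y _ _ hx hy => simp only [map_add, hx, hy]
    | mem i y hy =>
      rw [gradedProj_apply _ _ _ hy, gradedProj_apply _ _ _ (g.map_deg i hy)]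
      split_ifs <;> simp
  have hmem : ∀ (m : ℤ) (y : V), gradedProj A.deg A.isInternal {m} y ∈ A.deg m := by
    intro m y
    have hy : y ∈ ⨆ i, A.deg i := by rw [A.isInternal.submodule_iSup_eq_top]; trivial
    induction hy using Submodule.iSup_induction' with
    | zero => simp
    | add x y _ _ hx hy => rw [map_add]; exact Submodule.add_mem _ hx hy
    | mem i y hy =>
      rw [gradedProj_apply _ _ _ hy]
      split_ifs with h
      · rwa [← Set.mem_singleton_iff.1 h]
      · exact Submodule.zero_mem _
  have hsum : ∀ y : V, ∃ S : Finset ℤ, ∀ S', S ⊆ S' →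
      ∑ m ∈ S', gradedProj A.deg A.isInternal {m} y = y := by
    intro y
    have hy : y ∈ ⨆ i, A.deg i := by rw [A.isInternal.submodule_iSup_eq_top]; trivial
    induction hy using Submodule.iSup_induction' with
    | zero => exact ⟨∅, fun _ _ => by simp⟩
    | add x y _ _ hx hy =>
      obtain ⟨S, hS⟩ := hx
      obtain ⟨T, hT⟩ := hy
      refine ⟨S ∪ T, fun S' h => ?_⟩
      simp only [map_add, sum_add_distrib]
      rw [hS _ (union_subset_left h), hT _ (union_subset_right h)]
    | mem i y hy =>
      refine ⟨{i}, fun S' h => ?_⟩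
      rw [sum_eq_single_of_mem i (h (mem_singleton_self i)), gradedProj_apply _ _ _ hy,
        if_pos (Set.mem_singleton i)]
      intro j _ hj
      rw [gradedProj_apply _ _ _ hy, if_neg fun h => hj h.symm]
  obtain ⟨S, hS⟩ := hsum x
  rw [← hS S subset_rfl]
  refine Submodule.sum_mem _ fun m _ => Submodule.mem_iSup_of_mem m ⟨hmem m x, ?_⟩
  obtain ⟨k, hk⟩ := (Module.End.mem_maxGenEigenspace _ _ _).1 hx
  refine (Module.End.mem_maxGenEigenspace _ _ _).2 ⟨k, ?_⟩
  have hc : Commute (gradedProj A.deg A.isInternal {m})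
      (g.toEnd - Complex.exp (2 * (Real.pi : ℂ) * Complex.I * a) • 1) := by
    refine LinearMap.ext fun y => ?_
    simp [hproj]
  rw [← Module.End.mul_apply, ← (hc.pow_right k).eq, Module.End.mul_apply, hk, map_zero]

end VertexOperatorAlgebra.Automorphism

/-! ### Branches of the logarithm -/

section LogBranch

theorem logBranch_im (z : ℂ) : (logBranch 0 z).im = argPos z := by
  simp [logBranch]

theorem exp_logBranch {z : ℂ} (hz : z ≠ 0) : Complex.exp (logBranch 0 z) = z := by
  have h : logBranch 0 z = Complex.log z + (argPos z - z.arg : ℝ) * Complex.I := by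
    rw [logBranch, Complex.log]
    push_cast
    ring
  rw [h, Complex.exp_add, Complex.exp_log hz, argPos]
  split_ifs
  · simp
  · rw [add_sub_cancel_left]
    push_cast
    rw [Complex.exp_two_pi_mul_I, mul_one]

theorem logBranch_exp {l : ℂ} (h0 : 0 ≤ l.im) (h1 : l.im < 2 * Real.pi) :
    logBranch 0 (Complex.exp l) = l := by
  have key : argPos (Complex.exp l) = l.im := by
    rcases le_or_gt l.im Real.pi with h | h
    · have : (Complex.exp l).arg = l.im := by
        have h2 := Complex.log_exp (x := l) (by linarith [Real.pi_pos]) h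
        rw [← Complex.log_im, h2]
      rw [argPos, this, if_pos h0]
    · have h3 : (l - 2 * Real.pi * Complex.I).im = l.im - 2 * Real.pi := by simp
      have : (Complex.exp l).arg = l.im - 2 * Real.pi := by
        have h2 := Complex.log_exp (x := l - 2 * Real.pi * Complex.I) (by rw [h3]; linarith)
          (by rw [h3]; linarith)
        rw [← Complex.exp_periodic.sub_eq l, ← Complex.log_im, h2, h3]
      rw [argPos, this, if_neg (by linarith)]
      ring
  rw [logBranch, key, Complex.norm_exp, Real.log_exp]
  simp [Complex.re_add_im]

theorem logBranch_one (z : ℂ) :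
    logBranch 1 z = logBranch 0 z + 2 * (Real.pi : ℂ) * Complex.I := by
  simp [logBranch]

end LogBranch

/-- A polynomial with `λ p(x + c) = p(x)` is constant, and zero if `λ ≠ 1`. -/
theorem Polynomial.eval_eq_of_quasiperiodic {p : Polynomial ℂ} {c lam : ℂ} (hc : c ≠ 0)
    (h : ∀ x : ℝ, lam * p.eval ((x : ℂ) + c) = p.eval (x : ℂ)) :
    (∀ l, p.eval l = p.eval 0) ∧ (lam ≠ 1 → p = 0) := by
  have hp : Polynomial.C lam * p.comp (Polynomial.X + Polynomial.C c) = p := by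
    refine sub_eq_zero.1 (Polynomial.eq_zero_of_infinite_isRoot _
      ((Set.infinite_range_of_injective Complex.ofReal_injective).mono ?_))
    rintro _ ⟨x, rfl⟩
    have := h x
    simp [Polynomial.IsRoot, this]
  have hlam : lam ≠ 1 → p = 0 := by
    intro hlam
    by_contra hne
    have := congrArg Polynomial.leadingCoeff hp
    rw [Polynomial.leadingCoeff_mul, Polynomial.leadingCoeff_C,
      Polynomial.leadingCoeff_comp (by simp), Polynomial.leadingCoeff_X_add_C, one_pow,
      mul_one] at this
    exact hlam (mul_right_cancel₀ (Polynomial.leadingCoeff_ne_zero.2 hne) (by rw [this, one_mul]))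
  refine ⟨?_, hlam⟩
  by_cases h1 : lam = 1
  · subst h1
    have hper : ∀ n : ℕ, p.eval (c * n) = p.eval 0 := by
      intro n
      induction n with
      | zero => simp
      | succ n ih =>
        rw [← ih]
        nth_rw 2 [← hp]
        simp [mul_add]
    have h0 : p - Polynomial.C (p.eval 0) = 0 := by
      refine Polynomial.eq_zero_of_infinite_isRoot _ ((infinite_range_mul_natCast hc).mono ?_)
      rintro _ ⟨n, rfl⟩
      simp [Polynomial.IsRoot, hper]
    intro l
    have := congrArg (Polynomial.eval l) h0
    simpa [sub_eq_zero] using this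
  · simp [hlam h1]

namespace WeakTwistedModule

open Finset VertexOperatorAlgebra

variable {V : Type*} [AddCommGroup V] [Module ℂ V] {A : VertexOperatorAlgebra V}
  {g : A.Automorphism} {W : Type*} [AddCommGroup W] [Module ℂ W] (M : WeakTwistedModule A g W)

/-! ### The grading of a twisted module -/

theorem proj_of_mem {d : ℂ} {x : W} (hx : x ∈ degSpace M.piece d) (e : ℂ) :
    M.proj e x = if d = e then x else 0 := by
  rw [degSpace] at hx
  induction hx using Submodule.iSup_induction' with
  | zero => simp
  | add x y _ _ hx hy =>
    rw [map_add, hx, hy]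
    split_ifs <;> simp
  | mem α x hx =>
    rw [proj, gradedProj_apply _ _ _ hx]
    rfl

theorem mem_iSup_degSpace (x : W) : x ∈ ⨆ d, degSpace M.piece d := by
  have hx : x ∈ ⨆ i, M.piece i := by rw [M.isInternal.submodule_iSup_eq_top]; trivial
  refine (iSup_le fun i => ?_ : (⨆ i, M.piece i) ≤ ⨆ d, degSpace M.piece d) hx
  exact le_iSup_of_le i.1 (le_iSup_of_le (f := fun α => M.piece (i.1, α)) i.2 le_rfl)

theorem degSpace_eq_bot {d : ℂ} (hd : d.re < 0) : degSpace M.piece d = ⊥ := by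
  rw [degSpace, iSup_eq_bot]
  exact fun α => M.piece_eq_bot d α hd

theorem proj_mem (d : ℂ) (x : W) : M.proj d x ∈ degSpace M.piece d := by
  induction M.mem_iSup_degSpace x using Submodule.iSup_induction' with
  | zero => simp
  | add x y _ _ hx hy => rw [map_add]; exact Submodule.add_mem _ hx hy
  | mem e x hx =>
    rw [M.proj_of_mem hx]
    split_ifs with h
    · rwa [← h]
    · exact Submodule.zero_mem _

theorem proj_eq_sum {w' : Module.Dual ℂ W} (hw' : w' ∈ gradedDual M.piece) :
    ∃ S : Finset ℂ, ∀ x, w' x = ∑ d ∈ S, w' (M.proj d x) := by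
  classical
  have hfin : {i | ∃ x ∈ M.piece i, w' x ≠ 0}.Finite := hw'
  refine ⟨hfin.toFinset.image Prod.fst, fun x => ?_⟩
  have hx : x ∈ ⨆ i, M.piece i := by rw [M.isInternal.submodule_iSup_eq_top]; trivial
  induction hx using Submodule.iSup_induction' with
  | zero => simp
  | add x y _ _ hx hy => simp only [map_add, sum_add_distrib, hx, hy]
  | mem i x hx =>
    have h1 : ∀ d, w' (M.proj d x) = if i.1 = d then w' x else 0 := by
      intro d
      rw [proj, gradedProj_apply _ _ _ hx, Set.mem_ofPred_eq]
      split_ifs <;> simp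
    simp only [h1]
    rw [sum_ite_eq]
    split_ifs with h
    · rfl
    · by_contra h0
      exact h (mem_image_of_mem _ (hfin.mem_toFinset.2 ⟨x, hx, h0⟩))

theorem comp_proj_mem_gradedDual {w' : Module.Dual ℂ W} (hw' : w' ∈ gradedDual M.piece) (d : ℂ) :
    w'.comp (M.proj d) ∈ gradedDual M.piece := by
  have hfin : {i | ∃ x ∈ M.piece i, w' x ≠ 0}.Finite := hw'
  refine hfin.subset ?_
  rintro i ⟨x, hx, h⟩
  refine ⟨x, hx, fun h0 => h ?_⟩
  rw [LinearMap.comp_apply, proj, gradedProj_apply _ _ _ hx]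
  split_ifs
  · exact h0
  · exact map_zero _

/-! ### Bilinearity of the evaluated vertex operators -/

/-- The properties of the modes of a twisted module that make its evaluations finite sums; they
are shared by the modes of the twisted vertex operators and of their non-logarithmic components. -/
structure IsGradedModes (Y : ℂ → ℕ → V →ₗ[ℂ] W →ₗ[ℂ] W) : Prop where
  mem : ∀ (m : ℤ), ∀ v ∈ A.deg m, ∀ (d : ℂ), ∀ w ∈ degSpace M.piece d, ∀ (n : ℂ) (k : ℕ),
    Y n k v w ∈ degSpace M.piece (m - n - 1 + d)
  bounded : ∀ (v : V) (w : W), ∃ N : ℕ, ∀ (n : ℂ) (k : ℕ), N < k → Y n k v w = 0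

theorem isGradedModes_modes : M.IsGradedModes M.modes := ⟨M.modes_mem, M.log_bounded⟩

theorem isGradedModes_nonlog : M.IsGradedModes (nonlog M.modes) where
  mem m v hv d w hw n k := by
    rw [nonlog]
    split_ifs
    · exact M.modes_mem m v hv d w hw n 0
    · exact Submodule.zero_mem _
  bounded v w := ⟨0, fun n k hk => by rw [nonlog, if_neg hk.ne']; rfl⟩

theorem mem_iSup_deg (v : V) : v ∈ ⨆ m, A.deg m := by
  rw [A.isInternal.submodule_iSup_eq_top]; trivial

variable {M} {Y : ℂ → ℕ → V →ₗ[ℂ] W →ₗ[ℂ] W}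

namespace IsGradedModes

theorem finite_proj (hY : M.IsGradedModes Y) (d : ℂ) (v : V) (w : W) :
    {q : ℂ × ℕ | M.proj d (Y q.1 q.2 v w) ≠ 0}.Finite := by
  induction mem_iSup_deg (A := A) v using Submodule.iSup_induction' with
  | zero => simp
  | add x y _ _ hx hy =>
    refine (hx.union hy).subset fun q hq => ?_
    by_contra h
    simp only [Set.mem_union, Set.mem_ofPred_eq, not_or, not_not] at h
    refine hq ?_
    rw [map_add, LinearMap.add_apply, map_add, h.1, h.2, add_zero]
  | mem m v hv =>
    induction M.mem_iSup_degSpace w using Submodule.iSup_induction' with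
    | zero => simp
    | add x y _ _ hx hy =>
      refine (hx.union hy).subset fun q hq => ?_
      by_contra h
      simp only [Set.mem_union, Set.mem_ofPred_eq, not_or, not_not] at h
      refine hq ?_
      rw [map_add, map_add, h.1, h.2, add_zero]
    | mem e w hw =>
      obtain ⟨N, hN⟩ := hY.bounded v w
      refine (({(m : ℂ) - 1 + e - d} ×ˢ range (N + 1) : Finset (ℂ × ℕ)).finite_toSet).subset
        fun q hq => ?_
      rw [Set.mem_ofPred_eq, M.proj_of_mem (hY.mem m v hv e w hw q.1 q.2)] at hq
      rw [mem_coe, mem_product, mem_singleton, mem_range]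
      split_ifs at hq with h
      · refine ⟨by rw [← h]; ring, ?_⟩
        by_contra hlt
        exact hq (hN _ _ (by omega))
      · exact absurd rfl hq

theorem finite_pair (hY : M.IsGradedModes Y) {w' : Module.Dual ℂ W} (hw' : w' ∈ gradedDual M.piece)
    (v : V) (w : W) : {q : ℂ × ℕ | w' (Y q.1 q.2 v w) ≠ 0}.Finite := by
  obtain ⟨S, hS⟩ := M.proj_eq_sum hw'
  refine (S.finite_toSet.biUnion fun d _ => hY.finite_proj d v w).subset fun q hq => ?_
  by_contra h
  simp only [Set.mem_iUnion, mem_coe, Set.mem_ofPred_eq, not_exists, not_not] at h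
  refine hq ?_
  rw [hS]
  exact sum_eq_zero fun d hd => by rw [h d hd, map_zero]

theorem support_evalProj (hY : M.IsGradedModes Y) (d : ℂ) (l : ℂ) (v : V) (w : W) :
    (Function.support fun q : ℂ × ℕ =>
      (Complex.exp ((-q.1 - 1) * l) * l ^ q.2) • M.proj d (Y q.1 q.2 v w)).Finite :=
  (hY.finite_proj d v w).subset fun q hq h => hq (by simp only [h, smul_zero])

theorem support_evalPair (hY : M.IsGradedModes Y) {w' : Module.Dual ℂ W}
    (hw' : w' ∈ gradedDual M.piece) (l : ℂ) (v : V) (w : W) :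
    (Function.support fun q : ℂ × ℕ =>
      (Complex.exp ((-q.1 - 1) * l) * l ^ q.2) * w' (Y q.1 q.2 v w)).Finite :=
  (hY.finite_pair hw' v w).subset fun q hq h => hq (by simp only [h, mul_zero])

/-- `(v, w) ↦ π_d (Y(v, x) w)` as a bilinear map. -/
def evalProjL (hY : M.IsGradedModes Y) (d l : ℂ) : V →ₗ[ℂ] W →ₗ[ℂ] W :=
  LinearMap.mk₂ ℂ (evalProj Y (M.proj d) l)
    (fun v v' w => by
      rw [evalProj, evalProj, evalProj, ← finsum_add_distrib (hY.support_evalProj d l v w)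
        (hY.support_evalProj d l v' w)]
      simp only [map_add, LinearMap.add_apply, smul_add])
    (fun c v w => by
      rw [evalProj, evalProj, smul_finsum' c (hY.support_evalProj d l v w)]
      refine finsum_congr fun q => ?_
      rw [map_smul, LinearMap.smul_apply, map_smul, smul_comm])
    (fun v w w₂ => by
      rw [evalProj, evalProj, evalProj, ← finsum_add_distrib (hY.support_evalProj d l v w)
        (hY.support_evalProj d l v w₂)]
      simp only [map_add, smul_add])
    (fun c v w => by
      rw [evalProj, evalProj, smul_finsum' c (hY.support_evalProj d l v w)]
      refine finsum_congr fun q => ?_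
      rw [map_smul, map_smul, smul_comm])

theorem evalProjL_apply (hY : M.IsGradedModes Y) (d l : ℂ) (v : V) (w : W) :
    hY.evalProjL d l v w = evalProj Y (M.proj d) l v w := rfl

/-- `(v, w) ↦ ⟨w', Y(v, x) w⟩` as a bilinear map. -/
def evalPairL (hY : M.IsGradedModes Y) {w' : Module.Dual ℂ W} (hw' : w' ∈ gradedDual M.piece)
    (l : ℂ) : V →ₗ[ℂ] W →ₗ[ℂ] ℂ :=
  LinearMap.mk₂ ℂ (evalPair Y w' l)
    (fun v v' w => by
      rw [evalPair, evalPair, evalPair, ← finsum_add_distrib (hY.support_evalPair hw' l v w)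
        (hY.support_evalPair hw' l v' w)]
      simp only [map_add, LinearMap.add_apply, mul_add])
    (fun c v w => by
      rw [evalPair, evalPair, smul_finsum' c (hY.support_evalPair hw' l v w)]
      refine finsum_congr fun q => ?_
      rw [map_smul, LinearMap.smul_apply, map_smul, smul_eq_mul, smul_eq_mul, mul_left_comm])
    (fun v w w₂ => by
      rw [evalPair, evalPair, evalPair, ← finsum_add_distrib (hY.support_evalPair hw' l v w)
        (hY.support_evalPair hw' l v w₂)]
      simp only [map_add, mul_add])
    (fun c v w => by
      rw [evalPair, evalPair, smul_finsum' c (hY.support_evalPair hw' l v w)]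
      refine finsum_congr fun q => ?_
      rw [map_smul, map_smul, smul_eq_mul, smul_eq_mul, mul_left_comm])

theorem evalPairL_apply (hY : M.IsGradedModes Y) {w' : Module.Dual ℂ W}
    (hw' : w' ∈ gradedDual M.piece) (l : ℂ) (v : V) (w : W) :
    hY.evalPairL hw' l v w = evalPair Y w' l v w := rfl

theorem evalProj_of_mem (hY : M.IsGradedModes Y) {m : ℤ} {v : V} (hv : v ∈ A.deg m) {e : ℂ} {w : W}
    (hw : w ∈ degSpace M.piece e) {K : ℕ} (hK : ∀ (n : ℂ) (k : ℕ), K < k → Y n k v w = 0)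
    (n l : ℂ) : evalProj Y (M.proj (m - n - 1 + e)) l v w
      = Complex.exp ((-n - 1) * l) • ∑ k ∈ range (K + 1), l ^ k • Y n k v w := by
  rw [evalProj, finsum_eq_sum_of_support_subset (s := {n} ×ˢ range (K + 1)), sum_product,
    sum_singleton, smul_sum]
  · refine sum_congr rfl fun k _ => ?_
    rw [M.proj_of_mem (hY.mem m v hv e w hw n k), if_pos rfl, smul_smul]
  · intro q hq
    rw [mem_coe, mem_product, mem_singleton, mem_range]
    rw [Function.mem_support, M.proj_of_mem (hY.mem m v hv e w hw q.1 q.2)] at hq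
    split_ifs at hq with h
    · refine ⟨by linear_combination -h, ?_⟩
      by_contra hlt
      exact hq (by rw [hK _ _ (by omega), smul_zero])
    · exact absurd (smul_zero _) hq

theorem evalPair_eq_sum (hY : M.IsGradedModes Y) {w' : Module.Dual ℂ W} {S : Finset ℂ}
    (hS : ∀ x, w' x = ∑ d ∈ S, w' (M.proj d x)) (l : ℂ) (v : V) (w : W) :
    evalPair Y w' l v w = ∑ d ∈ S, w' (evalProj Y (M.proj d) l v w) := by
  have h1 : ∀ d, w' (evalProj Y (M.proj d) l v w) = ∑ᶠ q : ℂ × ℕ,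
      (Complex.exp ((-q.1 - 1) * l) * l ^ q.2) * w' (M.proj d (Y q.1 q.2 v w)) := by
    intro d
    rw [evalProj, map_finsum w' (hY.support_evalProj d l v w)]
    simp only [map_smul, smul_eq_mul]
  simp only [h1]
  rw [← finsum_sum_comm]
  · rw [evalPair]
    refine finsum_congr fun q => ?_
    rw [hS, mul_sum]
  · intro d _
    refine (hY.finite_proj d v w).subset fun q hq h => hq ?_
    simp only [h, map_zero, mul_zero]

end IsGradedModes

theorem evalProj_nonlog_of_mem {m : ℤ} {v : V} (hv : v ∈ A.deg m) {e : ℂ} {w : W}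
    (hw : w ∈ degSpace M.piece e) (n l : ℂ) :
    evalProj (nonlog M.modes) (M.proj (m - n - 1 + e)) l v w
      = Complex.exp ((-n - 1) * l) • M.modes n 0 v w := by
  rw [M.isGradedModes_nonlog.evalProj_of_mem hv hw (K := 0)
    (fun n k hk => by rw [nonlog, if_neg hk.ne']; rfl)]
  simp [nonlog]

/-! ### The non-logarithmic component of a twisted vertex operator -/

/-- The equivariance property makes `λ F(l + 2πi) = F(l)` hold for the polynomial
`F(l) = ∑ₖ l^k Y^g_{n,k}(exp(l𝒩) v) w`, with `λ = exp(2πi(a - n))`; hence `F` is constant, with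
value `Y^g_{n,0}(v) w`, and is zero if `n ∉ a + ℤ`. -/
theorem sum_modes_expNilLog {m : ℤ} {a : ℂ} {v : V} (hv : v ∈ g.homSpace m a) {e : ℂ} {w : W}
    (hw : w ∈ degSpace M.piece e) (n : ℂ) :
    (∀ l, evalProj M.modes (M.proj (m - n - 1 + e)) l (g.expNilLog l v) w
      = Complex.exp ((-n - 1) * l) • M.modes n 0 v w) ∧
    ((¬ ∃ j : ℤ, n = a + j) → M.modes n 0 v w = 0) := by
  obtain ⟨r, hr⟩ := g.exists_nilLog_pow_eq_zero v
  choose B hB using fun i : ℕ => M.log_bounded ((g.nilLog ^ i) v) w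
  obtain ⟨K, hK⟩ : ∃ K, ∀ i < r, B i ≤ K :=
    ⟨(range r).sup B, fun i hi => le_sup (f := B) (mem_range.2 hi)⟩
  have hK' : ∀ l n k, K < k → M.modes n k (g.expNilLog l v) w = 0 := by
    intro l n k hk
    rw [g.expNilLog_apply l hr, map_sum, LinearMap.sum_apply]
    refine sum_eq_zero fun i hi => ?_
    rw [map_smul, LinearMap.smul_apply, hB i n k ((hK i (mem_range.1 hi)).trans_lt hk), smul_zero]
  set F : ℂ → W := fun l => ∑ k ∈ range (K + 1), l ^ k • M.modes n k (g.expNilLog l v) w with hF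
  have hev : ∀ l c : ℂ, evalProj M.modes (M.proj (m - n - 1 + e)) l (c • g.expNilLog l v) w
      = c • Complex.exp ((-n - 1) * l) • F l := by
    intro l c
    rw [← M.isGradedModes_modes.evalProjL_apply, map_smul, LinearMap.smul_apply,
      M.isGradedModes_modes.evalProjL_apply,
      M.isGradedModes_modes.evalProj_of_mem (g.expNilLog_mem_homSpace hv l).1 hw (hK' l)]
  set lam : ℂ := Complex.exp (2 * (Real.pi : ℂ) * Complex.I * (a - n)) with hlam
  have hquasi : ∀ x : ℝ, lam • F ((x : ℂ) + 2 * (Real.pi : ℂ) * Complex.I) = F x := by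
    intro x
    have h0 : logBranch 0 (Complex.exp x) = x :=
      logBranch_exp (by simp) (by simpa using Real.pi_pos)
    have h1 := M.equivariance 0 (Complex.exp x) (Complex.exp_ne_zero _) (g.expNilLog x v) w
      (m - n - 1 + e)
    rw [zero_add, logBranch_one, h0, g.toEnd_apply_of_mem (g.expNilLog_mem_homSpace hv x).2,
      ← g.expNilLog_two_pi_I, g.expNilLog_add, add_comm (2 * (Real.pi : ℂ) * Complex.I)] at h1
    have h2 := hev (x + 2 * (Real.pi : ℂ) * Complex.I)
      (Complex.exp (2 * (Real.pi : ℂ) * Complex.I * a))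
    have h3 := hev x 1
    rw [one_smul, one_smul] at h3
    have h4 := (h2.symm.trans h1).trans h3
    rw [← smul_right_injective W (Complex.exp_ne_zero ((-n - 1) * (x : ℂ))) |>.eq_iff, ← h4,
      smul_smul, smul_smul, hlam, ← Complex.exp_add, ← Complex.exp_add]
    congr 1
    rw [Complex.exp_eq_exp_iff_exists_int]
    exact ⟨1, by push_cast; ring⟩
  have hpoly : ∀ φ : Module.Dual ℂ W, ∃ p : Polynomial ℂ, ∀ l, φ (F l) = p.eval l := by
    intro φ
    refine ⟨∑ k ∈ range (K + 1), ∑ i ∈ range r, Polynomial.monomial (k + i)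
      ((i.factorial : ℂ)⁻¹ * φ (M.modes n k ((g.nilLog ^ i) v) w)), fun l => ?_⟩
    rw [Polynomial.eval_finsetSum, hF, map_sum]
    refine sum_congr rfl fun k _ => ?_
    rw [Polynomial.eval_finsetSum, g.expNilLog_apply l hr, map_sum, LinearMap.sum_apply, map_smul,
      map_sum, smul_eq_mul, mul_sum]
    refine sum_congr rfl fun i _ => ?_
    rw [map_smul, LinearMap.smul_apply, map_smul, Polynomial.eval_monomial, smul_eq_mul, pow_add]
    ring
  have hF0 : F 0 = M.modes n 0 v w := by
    simp only [hF]
    rw [sum_range_succ', sum_eq_zero fun k _ => by rw [zero_pow (Nat.succ_ne_zero k), zero_smul],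
      zero_add, pow_zero, one_smul, g.expNilLog_zero]
  have hconst : ∀ φ : Module.Dual ℂ W, (∀ l, φ (F l) = φ (F 0)) ∧ (lam ≠ 1 → φ (F 0) = 0) := by
    intro φ
    obtain ⟨p, hp⟩ := hpoly φ
    have := Polynomial.eval_eq_of_quasiperiodic (p := p) (lam := lam) Complex.two_pi_I_ne_zero
      fun x => by rw [← hp, ← hp, ← hquasi x, map_smul, smul_eq_mul]
    refine ⟨fun l => by rw [hp, hp, this.1], fun h => by rw [hp, this.2 h, Polynomial.eval_zero]⟩
  refine ⟨fun l => ?_, fun hn => ?_⟩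
  · have h1 := hev l 1
    rw [one_smul, one_smul] at h1
    rw [h1, ← hF0]
    congr 1
    refine sub_eq_zero.1 ((Module.forall_dual_apply_eq_zero_iff ℂ _).1 fun φ => ?_)
    rw [map_sub, (hconst φ).1 l, sub_self]
  · rw [← hF0]
    refine (Module.forall_dual_apply_eq_zero_iff ℂ _).1 fun φ => (hconst φ).2 fun h1 => hn ?_
    rw [hlam, Complex.exp_eq_one_iff] at h1
    obtain ⟨j, hj⟩ := h1
    refine ⟨-j, ?_⟩
    have : a - n = j := by
      apply mul_left_cancel₀ Complex.two_pi_I_ne_zero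
      rw [hj]; ring
    push_cast
    linear_combination -this

/-- `Y^g_0(v, x) = Y^g(x^𝒩 v, x)`. -/
theorem evalProj_nonlog {m : ℤ} {a : ℂ} {v : V} (hv : v ∈ g.homSpace m a) (d l : ℂ) (w : W) :
    evalProj (nonlog M.modes) (M.proj d) l v w
      = evalProj M.modes (M.proj d) l (g.expNilLog l v) w := by
  induction M.mem_iSup_degSpace w using Submodule.iSup_induction' with
  | zero => rw [← M.isGradedModes_nonlog.evalProjL_apply, ← M.isGradedModes_modes.evalProjL_apply,
      map_zero, map_zero]
  | add x y _ _ hx hy =>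
    rw [← M.isGradedModes_nonlog.evalProjL_apply, ← M.isGradedModes_modes.evalProjL_apply] at *
    rw [map_add, map_add, hx, hy]
  | mem e w hw =>
    have hd : d = m - (m - 1 + e - d) - 1 + e := by ring
    rw [hd, evalProj_nonlog_of_mem hv.1 hw, (sum_modes_expNilLog hv hw _).1]

theorem evalPair_nonlog {m : ℤ} {a : ℂ} {v : V} (hv : v ∈ g.homSpace m a) {w' : Module.Dual ℂ W}
    (hw' : w' ∈ gradedDual M.piece) (l : ℂ) (w : W) :
    evalPair (nonlog M.modes) w' l v w = evalPair M.modes w' l (g.expNilLog l v) w := by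
  obtain ⟨S, hS⟩ := M.proj_eq_sum hw'
  rw [M.isGradedModes_nonlog.evalPair_eq_sum hS, M.isGradedModes_modes.evalPair_eq_sum hS]
  exact sum_congr rfl fun d _ => by rw [evalProj_nonlog hv]

end WeakTwistedModule

namespace VertexOperatorAlgebra

variable {V : Type*} [AddCommGroup V] [Module ℂ V] (A : VertexOperatorAlgebra V)

/-! ### Evaluated vertex operators of the algebra -/

theorem finite_proj_mode (d : ℤ) (u v : V) :
    {n : ℤ | gradedProj A.deg A.isInternal {d} (A.mode n u v) ≠ 0}.Finite := by
  induction WeakTwistedModule.mem_iSup_deg (A := A) u using Submodule.iSup_induction' with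
  | zero => simp
  | add x y _ _ hx hy =>
    refine (hx.union hy).subset fun q hq => ?_
    by_contra h
    simp only [Set.mem_union, Set.mem_ofPred_eq, not_or, not_not] at h
    refine hq ?_
    rw [map_add, LinearMap.add_apply, map_add, h.1, h.2, add_zero]
  | mem m u hu =>
    induction WeakTwistedModule.mem_iSup_deg (A := A) v using Submodule.iSup_induction' with
    | zero => simp
    | add x y _ _ hx hy =>
      refine (hx.union hy).subset fun q hq => ?_
      by_contra h
      simp only [Set.mem_union, Set.mem_ofPred_eq, not_or, not_not] at h
      refine hq ?_
      rw [map_add, map_add, h.1, h.2, add_zero]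
    | mem m' v hv =>
      refine (Set.finite_singleton (m + m' - d - 1)).subset fun n hn => ?_
      rw [Set.mem_ofPred_eq, gradedProj_apply _ _ _ (A.mode_mem m m' n u hu v hv)] at hn
      split_ifs at hn with h
      · rw [Set.mem_singleton_iff] at h ⊢
        omega
      · exact absurd rfl hn

theorem support_modeSum (z : ℂ) (d : ℤ) (u v : V) : (Function.support fun n : ℤ =>
    z ^ (-n - 1) • gradedProj A.deg A.isInternal {d} (A.mode n u v)).Finite :=
  (A.finite_proj_mode d u v).subset fun q hq h => hq (by simp only [h, smul_zero])

/-- `(u, v) ↦ π_d (Y(u, z) v)` as a bilinear map. -/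
def modeSumL (z : ℂ) (d : ℤ) : V →ₗ[ℂ] V →ₗ[ℂ] V :=
  LinearMap.mk₂ ℂ (fun u v => A.modeSum z u v d)
    (fun v v' w => by
      rw [modeSum, modeSum, modeSum, ← finsum_add_distrib (A.support_modeSum z d v w)
        (A.support_modeSum z d v' w)]
      simp only [map_add, LinearMap.add_apply, smul_add])
    (fun c v w => by
      rw [modeSum, modeSum, smul_finsum' c (A.support_modeSum z d v w)]
      refine finsum_congr fun q => ?_
      rw [map_smul, LinearMap.smul_apply, map_smul, smul_comm])
    (fun v w w₂ => by
      rw [modeSum, modeSum, modeSum, ← finsum_add_distrib (A.support_modeSum z d v w)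
        (A.support_modeSum z d v w₂)]
      simp only [map_add, smul_add])
    (fun c v w => by
      rw [modeSum, modeSum, smul_finsum' c (A.support_modeSum z d v w)]
      refine finsum_congr fun q => ?_
      rw [map_smul, map_smul, smul_comm])

theorem modeSumL_apply (z : ℂ) (d : ℤ) (u v : V) : A.modeSumL z d u v = A.modeSum z u v d := rfl

variable {A}

theorem modeSum_of_mem {m m' : ℤ} {u v : V} (hu : u ∈ A.deg m) (hv : v ∈ A.deg m') (z : ℂ) (d : ℤ) :
    A.modeSum z u v d = z ^ (d - m - m') • A.mode (m + m' - d - 1) u v := by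
  rw [modeSum, finsum_eq_single _ (m + m' - d - 1)]
  · rw [gradedProj_apply _ _ _ (A.mode_mem m m' _ u hu v hv), if_pos]
    · congr 2; ring
    · rw [Set.mem_singleton_iff]; ring
  · intro n hn
    rw [gradedProj_apply _ _ _ (A.mode_mem m m' _ u hu v hv), if_neg, smul_zero]
    rw [Set.mem_singleton_iff]
    omega

variable {g : A.Automorphism}

theorem modeSum_mem_homSpace {m m' : ℤ} {a b : ℂ} {u v : V} (hu : u ∈ g.homSpace m a)
    (hv : v ∈ g.homSpace m' b) (z : ℂ) (d : ℤ) : A.modeSum z u v d ∈ g.homSpace d (a + b) := by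
  rw [modeSum_of_mem hu.1 hv.1]
  have := g.mode_mem_homSpace hu hv (m + m' - d - 1)
  rw [show m + m' - (m + m' - d - 1) - 1 = d by ring] at this
  exact Submodule.smul_mem _ _ this

theorem expNilLog_modeSum {m m' : ℤ} {a b : ℂ} {u v : V} (hu : u ∈ g.homSpace m a)
    (hv : v ∈ g.homSpace m' b) (z l : ℂ) (d : ℤ) : g.expNilLog l (A.modeSum z u v d)
      = A.modeSum z (g.expNilLog l u) (g.expNilLog l v) d := by
  rw [modeSum_of_mem hu.1 hv.1, map_smul, g.expNilLog_mode,
    modeSum_of_mem (g.expNilLog_mem_homSpace hu l).1 (g.expNilLog_mem_homSpace hv l).1]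

end VertexOperatorAlgebra

namespace WeakTwistedModule

open Finset VertexOperatorAlgebra

variable {V : Type*} [AddCommGroup V] [Module ℂ V] {A : VertexOperatorAlgebra V}
  {g : A.Automorphism} {W : Type*} [AddCommGroup W] [Module ℂ W] (M : WeakTwistedModule A g W)

/-! ### Correlation functions of homogeneous vectors -/

section Homogeneous

variable {M} {m m' : ℤ} {a b e e₀ : ℂ} {u v : V} {w : W} {w' : Module.Dual ℂ W}

theorem evalPair_nonlog_of_mem (hu : u ∈ A.deg m) (hw : w ∈ degSpace M.piece e₀)
    (he : ∀ x, w' x = w' (M.proj e x)) (l : ℂ) : evalPair (nonlog M.modes) w' l u w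
      = Complex.exp ((e - m - e₀) * l) * w' (M.modes (m - 1 + e₀ - e) 0 u w) := by
  rw [M.isGradedModes_nonlog.evalPair_eq_sum (S := {e}) (fun x => by rw [sum_singleton, ← he x]),
    sum_singleton]
  have h : e = m - (m - 1 + e₀ - e) - 1 + e₀ := by ring
  nth_rw 1 [h]
  rw [evalProj_nonlog_of_mem hu hw, map_smul, smul_eq_mul]
  congr 2
  ring

theorem productTerm_of_mem (hu : u ∈ A.deg m) (hv : v ∈ A.deg m')
    (hw : w ∈ degSpace M.piece e₀) (he : ∀ x, w' x = w' (M.proj e x)) (z₁ z₂ d : ℂ) :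
    M.productTerm w' u z₁ v z₂ w d
      = Complex.exp ((e - m - d) * logBranch 0 z₁) * Complex.exp ((d - m' - e₀) * logBranch 0 z₂) *
        w' (M.modes (m - 1 + d - e) 0 u (M.modes (m' - 1 + e₀ - d) 0 v w)) := by
  have h : d = m' - (m' - 1 + e₀ - d) - 1 + e₀ := by ring
  have hd : M.modes (m' - 1 + e₀ - d) 0 v w ∈ degSpace M.piece d := by
    have := M.modes_mem m' v hv e₀ w hw (m' - 1 + e₀ - d) 0
    rwa [← h] at this
  rw [productTerm]
  nth_rw 1 [h]
  rw [evalProj_nonlog_of_mem hv hw, evalPair_nonlog_of_mem hu (Submodule.smul_mem _ _ hd) he,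
    map_smul, map_smul, smul_eq_mul]
  rw [show (-(m' - 1 + e₀ - d) - 1 : ℂ) = d - m' - e₀ by ring]
  ring

theorem productTerm_eq_zero (hu : u ∈ g.homSpace m a) (hv : v ∈ g.homSpace m' b)
    (hw : w ∈ degSpace M.piece e₀) (he : ∀ x, w' x = w' (M.proj e x))
    (hh : ¬ ∃ h : ℤ, e - e₀ + a + b = h) (z₁ z₂ d : ℂ) : M.productTerm w' u z₁ v z₂ w d = 0 := by
  rw [productTerm_of_mem hu.1 hv.1 hw he]
  have hd : M.modes (m' - 1 + e₀ - d) 0 v w ∈ degSpace M.piece d := by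
    have := M.modes_mem m' v hv.1 e₀ w hw (m' - 1 + e₀ - d) 0
    rwa [show (m' - (m' - 1 + e₀ - d) - 1 + e₀ : ℂ) = d by ring] at this
  by_cases h1 : ∃ j : ℤ, m' - 1 + e₀ - d = b + j
  · by_cases h2 : ∃ j : ℤ, m - 1 + d - e = a + j
    · exfalso
      obtain ⟨j, hj⟩ := h1
      obtain ⟨k, hk⟩ := h2
      refine hh ⟨m + m' - 2 - j - k, ?_⟩
      push_cast
      linear_combination -hj - hk
    · rw [(sum_modes_expNilLog hu hd _).2 h2, map_zero, mul_zero]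
  · rw [(sum_modes_expNilLog hv hw _).2 h1, map_zero, map_zero, mul_zero]

theorem exp_mul_logBranch {z : ℂ} (hz : z ≠ 0) (c : ℂ) (k : ℤ) :
    Complex.exp ((-c + k) * logBranch 0 z) = Complex.exp (-c * logBranch 0 z) * z ^ k := by
  rw [add_mul, Complex.exp_add, Complex.exp_int_mul, exp_logBranch hz]

/-- The products of homogeneous components are, up to the factor `z₁^(-a) z₂^(-b)` and integral
powers of `z₁` and `z₂`, given by a Laurent series in `z₂ / z₁` with finitely many negative
powers. -/
theorem exists_series_productTerm (hu : u ∈ g.homSpace m a) (hv : v ∈ g.homSpace m' b)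
    (hw : w ∈ degSpace M.piece e₀) (he : ∀ x, w' x = w' (M.proj e x)) {h : ℤ}
    (hh : e - e₀ + a + b = h) : ∃ (c : ℤ → ℂ) (k₀ : ℤ), (∀ k < k₀, c k = 0) ∧
      ∀ z₁ z₂ s : ℂ, z₁ ≠ 0 → z₂ ≠ 0 → (HasSum (fun d => M.productTerm w' u z₁ v z₂ w d) s ↔
        HasSum (fun k : ℤ => Complex.exp (-a * logBranch 0 z₁) * Complex.exp (-b * logBranch 0 z₂) *
          (z₁ ^ (h - m) * z₂ ^ (-m')) * (c k * (z₂ / z₁) ^ k)) s) := by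
  set c : ℤ → ℂ := fun k => w' (M.modes (m - 1 + (e₀ - b + k) - e) 0 u
    (M.modes (m' - 1 + e₀ - (e₀ - b + k)) 0 v w)) with hc
  refine ⟨c, ⌊(b - e₀).re⌋, fun k hk => ?_, fun z₁ z₂ s h1 h2 => ?_⟩
  · have hd : M.modes (m' - 1 + e₀ - (e₀ - b + k)) 0 v w ∈ degSpace M.piece (e₀ - b + k) := by
      have := M.modes_mem m' v hv.1 e₀ w hw (m' - 1 + e₀ - (e₀ - b + k)) 0
      rwa [show (m' - (m' - 1 + e₀ - (e₀ - b + k)) - 1 + e₀ : ℂ) = e₀ - b + k by ring] at this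
    rw [M.degSpace_eq_bot, Submodule.mem_bot] at hd
    · simp only [hc, hd, map_zero]
    · have h3 : (k : ℝ) < (b - e₀).re := (Int.cast_lt.2 hk).trans_le (Int.floor_le _)
      rw [Complex.sub_re] at h3
      rw [Complex.add_re, Complex.sub_re, Complex.intCast_re]
      linarith
  · have hinj : Function.Injective fun k : ℤ => e₀ - b + k := fun k l hkl => by
      simpa using hkl
    rw [← hinj.hasSum_iff]
    · have hfun : (fun d => M.productTerm w' u z₁ v z₂ w d) ∘ (fun k : ℤ => e₀ - b + k)
          = fun k : ℤ => Complex.exp (-a * logBranch 0 z₁) * Complex.exp (-b * logBranch 0 z₂) *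
          (z₁ ^ (h - m) * z₂ ^ (-m')) * (c k * (z₂ / z₁) ^ k) := by
        funext k
        rw [Function.comp_apply, productTerm_of_mem hu.1 hv.1 hw he,
          show e - m - (e₀ - b + k) = -a + ((h - m - k : ℤ) : ℂ) by
            push_cast; linear_combination hh,
          show e₀ - b + k - m' - e₀ = -b + ((k - m' : ℤ) : ℂ) by push_cast; ring,
          exp_mul_logBranch h1, exp_mul_logBranch h2, zpow_sub₀ h1 (h - m), sub_eq_add_neg k m',
          zpow_add₀ h2, div_zpow]
        ring
      rw [hfun]
    · intro d hd
      rw [productTerm_of_mem hu.1 hv.1 hw he, (sum_modes_expNilLog hv hw _).2, map_zero, map_zero,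
        mul_zero]
      rintro ⟨j, hj⟩
      refine hd ⟨m' - 1 - j, ?_⟩
      push_cast
      linear_combination hj

theorem iterate_of_mem (hu : u ∈ g.homSpace m a) (hv : v ∈ g.homSpace m' b)
    (hw : w ∈ degSpace M.piece e₀) (he : ∀ x, w' x = w' (M.proj e x)) (z l : ℂ) (d : ℤ) :
    evalPair (nonlog M.modes) w' l (A.modeSum z u v d) w
      = Complex.exp ((e - d - e₀) * l) * z ^ (d - m - m') *
        w' (M.modes (d - 1 + e₀ - e) 0 (A.mode (m + m' - d - 1) u v) w) := by
  rw [evalPair_nonlog_of_mem (modeSum_mem_homSpace hu hv z d).1 hw he,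
    modeSum_of_mem hu.1 hv.1, map_smul, LinearMap.smul_apply, map_smul, smul_eq_mul]
  ring

theorem iterate_eq_zero (hu : u ∈ g.homSpace m a) (hv : v ∈ g.homSpace m' b)
    (hw : w ∈ degSpace M.piece e₀) (he : ∀ x, w' x = w' (M.proj e x))
    (hh : ¬ ∃ h : ℤ, e - e₀ + a + b = h) (z l : ℂ) (d : ℤ) :
    evalPair (nonlog M.modes) w' l (A.modeSum z u v d) w = 0 := by
  rw [iterate_of_mem hu hv hw he]
  have hm := g.mode_mem_homSpace hu hv (m + m' - d - 1)
  rw [show m + m' - (m + m' - d - 1) - 1 = d by ring] at hm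
  rw [(sum_modes_expNilLog hm hw _).2, map_zero, mul_zero]
  rintro ⟨j, hj⟩
  refine hh ⟨d - 1 - j, ?_⟩
  push_cast
  linear_combination -hj

/-- The iterates of homogeneous components depend only on `(z₁ - z₂) / z₂`, up to an explicit
factor. -/
theorem iterate_scaling (hu : u ∈ g.homSpace m a) (hv : v ∈ g.homSpace m' b)
    (hw : w ∈ degSpace M.piece e₀) (he : ∀ x, w' x = w' (M.proj e x)) {h : ℤ}
    (hh : e - e₀ + a + b = h) {z₂ : ℂ} (hz₂ : z₂ ≠ 0) (x : ℂ) (d : ℤ) :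
    evalPair (nonlog M.modes) w' (logBranch 0 z₂) (A.modeSum (x * z₂) u v d) w
      = Complex.exp (-(a + b) * (logBranch 0 z₂ - Real.pi * Complex.I)) *
          (-z₂) ^ (h - m - m') *
        evalPair (nonlog M.modes) w' (Real.pi * Complex.I) (A.modeSum (-x) u v d) w := by
  rw [iterate_of_mem hu hv hw he, iterate_of_mem hu hv hw he]
  have h1 : e - d - e₀ = -(a + b) + ((h - d : ℤ) : ℂ) := by push_cast; linear_combination hh
  have h2 : Complex.exp ((-(a + b) + ((h - d : ℤ) : ℂ)) * (Real.pi * Complex.I))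
      = Complex.exp (-(a + b) * (Real.pi * Complex.I)) * (-1) ^ (h - d) := by
    rw [add_mul, Complex.exp_add, Complex.exp_int_mul, Complex.exp_pi_mul_I]
  rw [h1, exp_mul_logBranch hz₂, h2, mul_sub, Complex.exp_sub, mul_zpow, neg_eq_neg_one_mul z₂,
    mul_zpow, neg_eq_neg_one_mul x, mul_zpow]
  have h3 : z₂ ^ (h - d) * z₂ ^ (d - m - m') = z₂ ^ (h - m - m') := by
    rw [← zpow_add₀ hz₂]; congr 1; ring
  have h4 : (-1 : ℂ) ^ (h - m - m') * (-1) ^ (h - d) * (-1) ^ (d - m - m') = 1 := by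
    rw [← zpow_add₀ (by norm_num), ← zpow_add₀ (by norm_num),
      show h - m - m' + (h - d) + (d - m - m') = 2 * (h - m - m') by ring, zpow_mul]
    norm_num
  have h5 := Complex.exp_ne_zero (-(a + b) * (Real.pi * Complex.I))
  rw [← h3]
  field_simp
  linear_combination (-(x ^ (d - m - m') *
    w' (M.modes (d - 1 + e₀ - e) 0 (A.mode (m + m' - d - 1) u v) w))) * h4

/-! ### Reduction to the twisted vertex operators -/

theorem productTerm_eq_sum (hu : u ∈ g.homSpace m a) (hv : v ∈ g.homSpace m' b)
    (hw' : w' ∈ gradedDual M.piece) {r r' : ℕ} (hr : (g.nilLog ^ r) u = 0)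
    (hr' : (g.nilLog ^ r') v = 0) (z₁ z₂ d : ℂ) : M.productTerm w' u z₁ v z₂ w d
      = ∑ p ∈ range r ×ˢ range r', (logBranch 0 z₁ ^ p.1 / (p.1.factorial : ℂ)) *
        (logBranch 0 z₂ ^ p.2 / (p.2.factorial : ℂ)) * evalPair M.modes w' (logBranch 0 z₁)
          ((g.nilLog ^ p.1) u)
          (evalProj M.modes (M.proj d) (logBranch 0 z₂) ((g.nilLog ^ p.2) v) w) := by
  rw [productTerm, evalPair_nonlog hu hw', evalProj_nonlog hv, sum_product,
    ← M.isGradedModes_modes.evalPairL_apply hw', ← M.isGradedModes_modes.evalProjL_apply,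
    g.expNilLog_apply _ hr, g.expNilLog_apply _ hr']
  simp only [map_sum, LinearMap.sum_apply, map_smul, LinearMap.smul_apply, smul_eq_mul, mul_sum]
  rw [sum_comm]
  refine sum_congr rfl fun i _ => sum_congr rfl fun j _ => ?_
  rw [M.isGradedModes_modes.evalPairL_apply, M.isGradedModes_modes.evalProjL_apply]
  ring

theorem iterate_eq_sum (hu : u ∈ g.homSpace m a) (hv : v ∈ g.homSpace m' b)
    (hw' : w' ∈ gradedDual M.piece) {r r' : ℕ} (hr : (g.nilLog ^ r) u = 0)
    (hr' : (g.nilLog ^ r') v = 0) (z y l : ℂ) (d : ℤ) :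
    evalPair (nonlog M.modes) w' l (A.modeSum z (g.expNilLog y u) v d) w
      = ∑ p ∈ range r ×ˢ range r', ((l + y) ^ p.1 / (p.1.factorial : ℂ)) *
        (l ^ p.2 / (p.2.factorial : ℂ)) * evalPair M.modes w' l
          (A.modeSum z ((g.nilLog ^ p.1) u) ((g.nilLog ^ p.2) v) d) w := by
  have hu' := g.expNilLog_mem_homSpace hu y
  rw [evalPair_nonlog (modeSum_mem_homSpace hu' hv z d) hw', expNilLog_modeSum hu' hv,
    g.expNilLog_add, sum_product, ← M.isGradedModes_modes.evalPairL_apply hw',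
    ← A.modeSumL_apply, g.expNilLog_apply _ hr, g.expNilLog_apply _ hr']
  simp only [map_sum, LinearMap.sum_apply, map_smul, LinearMap.smul_apply, smul_eq_mul, mul_sum]
  rw [sum_comm]
  refine sum_congr rfl fun i _ => sum_congr rfl fun j _ => ?_
  rw [M.isGradedModes_modes.evalPairL_apply, A.modeSumL_apply]
  ring

end Homogeneous

end WeakTwistedModule

namespace WeakTwistedModule

open Finset VertexOperatorAlgebra ExpPoly

variable {V : Type*} [AddCommGroup V] [Module ℂ V] {A : VertexOperatorAlgebra V}
  {g : A.Automorphism} {W : Type*} [AddCommGroup W] [Module ℂ W] {M : WeakTwistedModule A g W}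

/-! ### Consequences of duality -/

theorem logBranch_neg_exp {y : ℂ} (hy : |y.im| < Real.pi / 2) :
    logBranch 0 (-Complex.exp y) = y + Real.pi * Complex.I := by
  have h1 : -Complex.exp y = Complex.exp (y + Real.pi * Complex.I) := by
    rw [Complex.exp_add, Complex.exp_pi_mul_I, mul_neg_one]
  have h2 := abs_lt.1 hy
  have h3 : (y + Real.pi * Complex.I).im = y.im + Real.pi := by simp
  rw [h1, logBranch_exp] <;> rw [h3] <;> linarith [Real.pi_pos]

theorem logBranch_neg_one : logBranch 0 (-1) = Real.pi * Complex.I := by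
  have := logBranch_neg_exp (y := 0) (by simpa using Real.pi_pos)
  simpa using this

/-- The function appearing in the duality property, restricted to `z₂ = -1`, `z₁ = -exp y`. -/
theorem duality_at_neg_one (u v : V) (w : W) {w' : Module.Dual ℂ W}
    (hw' : w' ∈ gradedDual M.piece) : ∃ G ∈ expPoly, ∃ t : ℕ,
      (∀ y : ℝ, 0 < y → HasSum (fun d : ℂ => evalPair M.modes w' (y + Real.pi * Complex.I) u
        (evalProj M.modes (M.proj d) (Real.pi * Complex.I) v w))
        (G y * ((1 - Complex.exp y) ^ t)⁻¹)) ∧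
      (∀ y : ℝ, y < 0 → HasSum (fun d : ℂ => evalPair M.modes w' (Real.pi * Complex.I) v
        (evalProj M.modes (M.proj d) (y + Real.pi * Complex.I) u w))
        (G y * ((1 - Complex.exp y) ^ t)⁻¹)) ∧
      (∀ y : ℂ, |y.im| < Real.pi / 2 → ‖Complex.exp y - 1‖ < 1 → Complex.exp y ≠ 1 →
        HasSum (fun d : ℤ => evalPair M.modes w' (Real.pi * Complex.I)
          (A.modeSum (1 - Complex.exp y) u v d) w) (G y * ((1 - Complex.exp y) ^ t)⁻¹)) := by
  obtain ⟨N, c, m, n, t, -, hd⟩ := M.duality u v w w' hw'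
  refine ⟨fun y => ∑ i, ∑ j, ∑ k, ∑ l, c i j k l * Complex.exp (m i * (y + Real.pi * Complex.I)) *
          Complex.exp (n j * (Real.pi * Complex.I)) * (y + Real.pi * Complex.I) ^ (k : ℕ) *
          (Real.pi * Complex.I) ^ (l : ℕ), ?_, t, ?_⟩
  · have hy : (fun y : ℂ => y + Real.pi * Complex.I) ∈ expPoly :=
      Submodule.add_mem _ id_mem (const_mem _)
    refine sum_mem _ fun i _ => sum_mem _ fun j _ => sum_mem _ fun k _ => sum_mem _ fun l _ => ?_
    refine mul_mem (mul_mem (mul_mem (mul_mem (const_mem _) ?_) (const_mem _)) (pow_mem hy _))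
      (const_mem _)
    simp only [mul_add, Complex.exp_add]
    exact mul_mem (exp_mem _) (const_mem _)
  · have key : ∀ y : ℂ, |y.im| < Real.pi / 2 →
        |argPos (-Complex.exp y) - argPos (-1)| < Real.pi / 2 := by
      intro y hy
      rw [← logBranch_im, ← logBranch_im, logBranch_neg_exp hy, logBranch_neg_one]
      simpa using hy
    have hre : ∀ y : ℝ, |(y : ℂ).im| < Real.pi / 2 := fun y => by simpa using Real.pi_pos
    have hsub : ∀ y : ℂ, -Complex.exp y - -1 = 1 - Complex.exp y := fun y => by ring
    simp only [sum_mul]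
    refine ⟨fun y hy => ?_, fun y hy => ?_, fun y hy h1 h2 => ?_⟩
    · have h := ((hd 0 (-Complex.exp y) (-1)).1 ?_ ?_).2 (key y (hre y))
      · rw [logBranch_neg_exp (hre y), logBranch_neg_one, hsub] at h
        exact h
      · rw [norm_neg, norm_neg, norm_one, Complex.norm_exp, Complex.ofReal_re]
        exact Real.one_lt_exp_iff.2 hy
      · simp
    · have h := ((hd 0 (-Complex.exp y) (-1)).2.1 ?_ ?_).2 (key y (hre y))
      · rw [logBranch_neg_exp (hre y), logBranch_neg_one, hsub] at h
        exact h
      · rw [norm_neg, norm_neg, norm_one, Complex.norm_exp, Complex.ofReal_re]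
        simpa using hy
      · rw [norm_neg, norm_pos_iff]
        exact Complex.exp_ne_zero _
    · have h := ((hd 0 (-Complex.exp y) (-1)).2.2 ?_ ?_).2 (key y hy)
      · rw [logBranch_neg_exp hy, logBranch_neg_one, hsub] at h
        exact h
      · rwa [hsub, norm_neg, norm_one, norm_sub_rev]
      · rw [hsub, norm_pos_iff, sub_ne_zero]
        exact h2.symm

section Homogeneous

variable {m m' : ℤ} {a b e e₀ : ℂ} {u v : V} {w : W} {w' : Module.Dual ℂ W}

theorem summable_productTerm (hu : u ∈ g.homSpace m a) (hv : v ∈ g.homSpace m' b)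
    (hw' : w' ∈ gradedDual M.piece) {z₁ z₂ : ℂ} (h1 : ‖z₂‖ < ‖z₁‖) (h2 : 0 < ‖z₂‖) :
    Summable fun d => M.productTerm w' u z₁ v z₂ w d := by
  obtain ⟨r, hr⟩ := g.exists_nilLog_pow_eq_zero u
  obtain ⟨r', hr'⟩ := g.exists_nilLog_pow_eq_zero v
  simp only [productTerm_eq_sum hu hv hw' hr hr']
  refine summable_sum fun p _ => Summable.mul_left _ ?_
  obtain ⟨N, c, m, n, t, -, hd⟩ := M.duality ((g.nilLog ^ p.1) u) ((g.nilLog ^ p.2) v) w w' hw'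
  exact ((hd 0 z₁ z₂).1 h1 h2).1.of_norm

theorem summable_iterate (hu : u ∈ g.homSpace m a) (hv : v ∈ g.homSpace m' b)
    (hw' : w' ∈ gradedDual M.piece) {z₁ z₂ : ℂ} (h1 : ‖z₁ - z₂‖ < ‖z₂‖) (h2 : 0 < ‖z₁ - z₂‖) :
    Summable fun d : ℤ =>
      evalPair (nonlog M.modes) w' (logBranch 0 z₂) (A.modeSum (z₁ - z₂) u v d) w := by
  obtain ⟨r, hr⟩ := g.exists_nilLog_pow_eq_zero u
  obtain ⟨r', hr'⟩ := g.exists_nilLog_pow_eq_zero v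
  have h := iterate_eq_sum (w := w) hu hv hw' hr hr' (z₁ - z₂) 0 (logBranch 0 z₂)
  rw [g.expNilLog_zero] at h
  simp only [h]
  refine summable_sum fun p _ => Summable.mul_left _ ?_
  obtain ⟨N, c, m, n, t, -, hd⟩ := M.duality ((g.nilLog ^ p.1) u) ((g.nilLog ^ p.2) v) w w' hw'
  exact ((hd 0 z₁ z₂).2.2 h1 h2).1.of_norm

/-- At `z₂ = -1`, `z₁ = -exp y`, the two products and the iterate formed with the non-logarithmic
components are expressed by one exponential polynomial in `y`. -/
theorem exists_expPoly (hu : u ∈ g.homSpace m a) (hv : v ∈ g.homSpace m' b)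
    (hw' : w' ∈ gradedDual M.piece) : ∃ Φ ∈ expPoly, ∃ t : ℕ,
      (∀ y : ℝ, 0 < y → HasSum (fun d : ℂ => M.productTerm w' u (-Complex.exp y) v (-1) w d)
        (Φ y * ((1 - Complex.exp y) ^ t)⁻¹)) ∧
      (∀ y : ℝ, y < 0 → HasSum (fun d : ℂ => M.productTerm w' v (-1) u (-Complex.exp y) w d)
        (Φ y * ((1 - Complex.exp y) ^ t)⁻¹)) ∧
      (∀ y : ℂ, |y.im| < Real.pi / 2 → ‖Complex.exp y - 1‖ < 1 → Complex.exp y ≠ 1 →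
        HasSum (fun d : ℤ => evalPair (nonlog M.modes) w' (Real.pi * Complex.I)
          (A.modeSum (1 - Complex.exp y) (g.expNilLog y u) v d) w)
          (Φ y * ((1 - Complex.exp y) ^ t)⁻¹)) := by
  obtain ⟨r, hr⟩ := g.exists_nilLog_pow_eq_zero u
  obtain ⟨r', hr'⟩ := g.exists_nilLog_pow_eq_zero v
  choose G hG t h₁ h₂ h₃ using fun p : ℕ × ℕ =>
    duality_at_neg_one ((g.nilLog ^ p.1) u) ((g.nilLog ^ p.2) v) w hw'
  set s := range r ×ˢ range r' with hs
  set T := ∑ p ∈ s, t p with hT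
  have ht : ∀ p ∈ s, t p ≤ T := fun p hp => single_le_sum (fun _ _ => Nat.zero_le _) hp
  set q : ℂ → ℕ × ℕ → ℂ := fun y p => ((y + Real.pi * Complex.I) ^ p.1 / (p.1.factorial : ℂ)) *
    ((Real.pi * Complex.I) ^ p.2 / (p.2.factorial : ℂ)) with hq
  have hval : ∀ y : ℂ, 1 - Complex.exp y ≠ 0 →
      (∑ p ∈ s, q y p * G p y * (1 - Complex.exp y) ^ (T - t p)) * ((1 - Complex.exp y) ^ T)⁻¹
        = ∑ p ∈ s, q y p * (G p y * ((1 - Complex.exp y) ^ t p)⁻¹) := by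
    intro y hy
    rw [sum_mul]
    refine sum_congr rfl fun p hp => ?_
    have : (1 - Complex.exp y) ^ T = (1 - Complex.exp y) ^ (T - t p) * (1 - Complex.exp y) ^ t p := by
      rw [← pow_add, Nat.sub_add_cancel (ht p hp)]
    rw [this]
    field_simp
  have hne : ∀ y : ℝ, y ≠ 0 → 1 - Complex.exp (y : ℂ) ≠ 0 := by
    intro y hy h
    rw [sub_eq_zero, ← Complex.ofReal_exp, eq_comm, Complex.ofReal_eq_one, Real.exp_eq_one_iff] at h
    exact hy h
  have hre : ∀ y : ℝ, |(y : ℂ).im| < Real.pi / 2 := fun y => by simpa using Real.pi_pos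
  refine ⟨fun y => ∑ p ∈ s, q y p * G p y * (1 - Complex.exp y) ^ (T - t p), ?_, T,
    fun y hy => ?_, fun y hy => ?_, fun y hy h1 h2 => ?_⟩
  · have hy : (fun y : ℂ => y + Real.pi * Complex.I) ∈ expPoly :=
      Submodule.add_mem _ id_mem (const_mem _)
    have hy' : (fun y : ℂ => 1 - Complex.exp y) ∈ expPoly :=
      Submodule.sub_mem _ (const_mem _) (by simpa using exp_mem 1)
    refine sum_mem _ fun p _ => mul_mem (mul_mem ?_ (hG p)) (pow_mem hy' _)
    simp only [hq, div_eq_mul_inv]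
    exact mul_mem (mul_mem (pow_mem hy _) (const_mem _)) (const_mem _)
  · rw [hval _ (hne y hy.ne')]
    simp only [productTerm_eq_sum hu hv hw' hr hr', logBranch_neg_exp (hre y), logBranch_neg_one]
    exact hasSum_sum fun p _ => (h₁ p y hy).mul_left _
  · rw [hval _ (hne y hy.ne)]
    have hswap : ∀ d, M.productTerm w' v (-1) u (-Complex.exp y) w d
        = ∑ p ∈ s, q y p * evalPair M.modes w' (Real.pi * Complex.I) ((g.nilLog ^ p.2) v)
          (evalProj M.modes (M.proj d) (y + Real.pi * Complex.I) ((g.nilLog ^ p.1) u) w) := by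
      intro d
      rw [productTerm_eq_sum hv hu hw' hr' hr, hs, sum_product, sum_product, sum_comm,
        logBranch_neg_exp (hre y), logBranch_neg_one]
      refine sum_congr rfl fun i _ => sum_congr rfl fun j _ => ?_
      rw [hq]
      ring
    simp only [hswap]
    exact hasSum_sum fun p _ => (h₂ p y hy).mul_left _
  · rw [hval _ (sub_ne_zero.2 h2.symm)]
    have h := iterate_eq_sum (w := w) hu hv hw' hr hr' (1 - Complex.exp y) y (Real.pi * Complex.I)
    simp only [h, add_comm (Real.pi * Complex.I : ℂ) y]
    exact hasSum_sum fun p _ => (h₃ p y hy h1 h2).mul_left _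

end Homogeneous

end WeakTwistedModule

/-! ### Rational functions with poles along the axes and the diagonal -/

section RationalSums

open MvPolynomial

/-- The value of `P(z₁, z₂) / (z₁^r z₂^s (z₁ - z₂)^t)`. -/
def ratVal (P : MvPolynomial (Fin 2) ℂ) (r s t : ℤ) (z₁ z₂ : ℂ) : ℂ :=
  eval ![z₁, z₂] P / (z₁ ^ r * z₂ ^ s * (z₁ - z₂) ^ t)

theorem exists_ratVal_eq_of_le (P : MvPolynomial (Fin 2) ℂ) {r s t r' s' t' : ℤ} (hr : r ≤ r')
    (hs : s ≤ s') (ht : t ≤ t') : ∃ Q, ∀ z₁ z₂ : ℂ, z₁ ≠ 0 → z₂ ≠ 0 → z₁ ≠ z₂ →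
      ratVal P r s t z₁ z₂ = ratVal Q r' s' t' z₁ z₂ := by
  refine ⟨P * X 0 ^ (r' - r).toNat * X 1 ^ (s' - s).toNat * (X 0 - X 1) ^ (t' - t).toNat,
    fun z₁ z₂ h₁ h₂ h => ?_⟩
  have h' : z₁ - z₂ ≠ 0 := sub_ne_zero.2 h
  have key : ∀ (z : ℂ) (i j : ℤ), z ≠ 0 → i ≤ j → z ^ j = z ^ i * z ^ (j - i).toNat := by
    intro z i j hz hij
    rw [← zpow_natCast, ← zpow_add₀ hz]
    congr 1
    omega
  rw [ratVal, ratVal, key z₁ r r' h₁ hr, key z₂ s s' h₂ hs, key (z₁ - z₂) t t' h' ht]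
  have e1 := zpow_ne_zero r h₁
  have e2 := zpow_ne_zero s h₂
  have e3 := zpow_ne_zero t h'
  simp only [map_mul, map_pow, map_sub, eval_X, Matrix.cons_val_zero, Matrix.cons_val_one]
  field_simp

theorem exists_ratVal_add (P P' : MvPolynomial (Fin 2) ℂ) (r s t r' s' t' : ℤ) :
    ∃ Q r₀ s₀ t₀, ∀ z₁ z₂ : ℂ, z₁ ≠ 0 → z₂ ≠ 0 → z₁ ≠ z₂ →
      ratVal Q r₀ s₀ t₀ z₁ z₂ = ratVal P r s t z₁ z₂ + ratVal P' r' s' t' z₁ z₂ := by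
  obtain ⟨Q, hQ⟩ := exists_ratVal_eq_of_le P (le_max_left r r') (le_max_left s s')
    (le_max_left t t')
  obtain ⟨Q', hQ'⟩ := exists_ratVal_eq_of_le P' (le_max_right r r') (le_max_right s s')
    (le_max_right t t')
  refine ⟨Q + Q', max r r', max s s', max t t', fun z₁ z₂ h₁ h₂ h => ?_⟩
  rw [hQ z₁ z₂ h₁ h₂ h, hQ' z₁ z₂ h₁ h₂ h, ratVal, ratVal, ratVal, ← add_div, ← map_add]

theorem exists_ratVal_laurent (S : Finset ℤ) (C : ℤ → ℂ) (t : ℕ) (i j : ℤ) :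
    ∃ P r s t', ∀ z₁ z₂ : ℂ, z₁ ≠ 0 → z₂ ≠ 0 → z₁ ≠ z₂ → ratVal P r s t' z₁ z₂
      = z₁ ^ i * z₂ ^ j * ((∑ k ∈ S, C k * (z₁ / z₂) ^ k) * ((1 - z₁ / z₂) ^ t)⁻¹) := by
  obtain ⟨K, hK⟩ : ∃ K : ℕ, ∀ k ∈ S, k.natAbs ≤ K :=
    ⟨S.sup Int.natAbs, fun k hk => Finset.le_sup (f := Int.natAbs) hk⟩
  refine ⟨∑ k ∈ S, MvPolynomial.C (C k * (-1) ^ t) * X 0 ^ (K + k).toNat * X 1 ^ (K - k).toNat,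
    K - i, K - j - t, t, fun z₁ z₂ h₁ h₂ h => ?_⟩
  have h' : z₁ - z₂ ≠ 0 := sub_ne_zero.2 h
  have e0 : 1 - z₁ / z₂ = -(z₁ - z₂) / z₂ := by field_simp; ring
  rw [ratVal, map_sum, Finset.sum_div, Finset.sum_mul, Finset.mul_sum, e0]
  refine Finset.sum_congr rfl fun k hk => ?_
  have hk' := hK k hk
  simp only [map_mul, map_pow, eval_C, eval_X, Matrix.cons_val_zero, Matrix.cons_val_one]
  rw [← zpow_natCast z₁, ← zpow_natCast z₂, Int.toNat_of_nonneg (by omega),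
    Int.toNat_of_nonneg (by omega), zpow_natCast, zpow_sub₀ h₁, zpow_sub₀ h₂ ((K : ℤ) - j),
    zpow_sub₀ h₂ (K : ℤ), zpow_sub₀ h₂ (K : ℤ), zpow_add₀ h₁, div_pow, neg_pow (z₁ - z₂) t, div_zpow,
    zpow_natCast]
  have e1 : ((-1 : ℂ) ^ t) * (-1) ^ t = 1 := by rw [← mul_pow]; norm_num
  have e2 : (-1 : ℂ) ^ t ≠ 0 := pow_ne_zero _ (by norm_num)
  have f1 := zpow_ne_zero i h₁
  have f2 := zpow_ne_zero j h₂
  have f3 := zpow_ne_zero k h₁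
  have f4 := zpow_ne_zero k h₂
  simp only [zpow_natCast]
  field_simp
  linear_combination C k * e1

/-- The families `f₁`, `f₂` (depending on `z₁`, `z₂`) sum to `z₁^(-a) z₂^(-b) R(z₁, z₂)` for
`|z₁| > |z₂| > 0` and `|z₂| > |z₁| > 0`, respectively, and `f₃` sums to it for
`|z₂| > |z₁ - z₂| > 0`, with the value of `log z₁` nearest to `log z₂`, for a common rational function
`R` with poles along `z₁ = 0`, `z₂ = 0`, `z₁ = z₂`. -/
def RationalSums (a b : ℂ) (f₁ f₂ : ℂ → ℂ → ℂ → ℂ) (f₃ : ℂ → ℂ → ℕ × ℤ → ℂ) : Prop :=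
  ∃ (P : MvPolynomial (Fin 2) ℂ) (r s t : ℤ),
    (∀ z₁ z₂ : ℂ, ‖z₂‖ < ‖z₁‖ → 0 < ‖z₂‖ → HasSum (f₁ z₁ z₂)
      (Complex.exp (-a * logBranch 0 z₁) * Complex.exp (-b * logBranch 0 z₂) *
        ratVal P r s t z₁ z₂)) ∧
    (∀ z₁ z₂ : ℂ, ‖z₁‖ < ‖z₂‖ → 0 < ‖z₁‖ → HasSum (f₂ z₁ z₂)
      (Complex.exp (-a * logBranch 0 z₁) * Complex.exp (-b * logBranch 0 z₂) *
        ratVal P r s t z₁ z₂)) ∧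
    (∀ z₁ z₂ l₁ : ℂ, ‖z₁ - z₂‖ < ‖z₂‖ → 0 < ‖z₁ - z₂‖ →
      Complex.exp l₁ = z₁ → |l₁.im - argPos z₂| < Real.pi / 2 → HasSum (f₃ z₁ z₂)
      (Complex.exp (-a * l₁) * Complex.exp (-b * logBranch 0 z₂) * ratVal P r s t z₁ z₂))

theorem ne_of_norm_lt {z₁ z₂ : ℂ} (h : ‖z₁‖ < ‖z₂‖) : z₁ ≠ z₂ := fun he => by simp [he] at h

theorem ne_zero_of_norm_lt {z₁ z₂ : ℂ} (h : ‖z₁‖ < ‖z₂‖) : z₂ ≠ 0 :=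
  norm_pos_iff.1 ((norm_nonneg _).trans_lt h)

theorem ne_zero_of_norm_sub_lt {z₁ z₂ : ℂ} (h : ‖z₁ - z₂‖ < ‖z₂‖) : z₁ ≠ 0 :=
  fun he => by simp [he] at h

namespace RationalSums

variable {a b : ℂ} {f₁ f₂ h₁ h₂ : ℂ → ℂ → ℂ → ℂ} {f₃ h₃ : ℂ → ℂ → ℕ × ℤ → ℂ}

theorem zero : RationalSums a b (fun _ _ _ => 0) (fun _ _ _ => 0) (fun _ _ _ => 0) := by
  refine ⟨0, 0, 0, 0, fun _ _ _ _ => ?_, fun _ _ _ _ => ?_, fun _ _ _ _ _ _ _ => ?_⟩ <;>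
  simp [ratVal, hasSum_zero]

theorem add (hf : RationalSums a b f₁ f₂ f₃) (hh : RationalSums a b h₁ h₂ h₃) :
    RationalSums a b (fun z₁ z₂ d => f₁ z₁ z₂ d + h₁ z₁ z₂ d)
      (fun z₁ z₂ d => f₂ z₁ z₂ d + h₂ z₁ z₂ d) (fun z₁ z₂ q => f₃ z₁ z₂ q + h₃ z₁ z₂ q) := by
  obtain ⟨P, r, s, t, p₁, p₂, p₃⟩ := hf
  obtain ⟨P', r', s', t', p₁', p₂', p₃'⟩ := hh
  obtain ⟨Q, r₀, s₀, t₀, hQ⟩ := exists_ratVal_add P P' r s t r' s' t'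
  refine ⟨Q, r₀, s₀, t₀, fun z₁ z₂ e₁ e₂ => ?_, fun z₁ z₂ e₁ e₂ => ?_,
    fun z₁ z₂ l e₁ e₂ e₃ e₄ => ?_⟩
  · rw [hQ _ _ (ne_zero_of_norm_lt e₁) (norm_pos_iff.1 e₂) (ne_of_norm_lt e₁).symm, mul_add]
    exact (p₁ z₁ z₂ e₁ e₂).add (p₁' z₁ z₂ e₁ e₂)
  · rw [hQ _ _ (norm_pos_iff.1 e₂) (ne_zero_of_norm_lt e₁) (ne_of_norm_lt e₁), mul_add]
    exact (p₂ z₁ z₂ e₁ e₂).add (p₂' z₁ z₂ e₁ e₂)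
  · rw [hQ _ _ (ne_zero_of_norm_sub_lt e₁) (ne_zero_of_norm_lt e₁)
      (sub_ne_zero.1 (norm_pos_iff.1 e₂)), mul_add]
    exact (p₃ z₁ z₂ l e₁ e₂ e₃ e₄).add (p₃' z₁ z₂ l e₁ e₂ e₃ e₄)

theorem congr (hf : RationalSums a b f₁ f₂ f₃) (e₁ : ∀ z₁ z₂ d, h₁ z₁ z₂ d = f₁ z₁ z₂ d)
    (e₂ : ∀ z₁ z₂ d, h₂ z₁ z₂ d = f₂ z₁ z₂ d) (e₃ : ∀ z₁ z₂ q, h₃ z₁ z₂ q = f₃ z₁ z₂ q) :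
    RationalSums a b h₁ h₂ h₃ := by
  obtain rfl : h₁ = f₁ := funext fun _ => funext fun _ => funext fun _ => e₁ _ _ _
  obtain rfl : h₂ = f₂ := funext fun _ => funext fun _ => funext fun _ => e₂ _ _ _
  obtain rfl : h₃ = f₃ := funext fun _ => funext fun _ => funext fun _ => e₃ _ _ _
  exact hf

end RationalSums

end RationalSums

namespace WeakTwistedModule

open Finset VertexOperatorAlgebra ExpPoly

variable {V : Type*} [AddCommGroup V] [Module ℂ V] {A : VertexOperatorAlgebra V}
  {g : A.Automorphism} {W : Type*} [AddCommGroup W] [Module ℂ W] {M : WeakTwistedModule A g W}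

/-! ### The correlation functions of homogeneous vectors as rational functions -/

section Homogeneous

variable {m m' : ℤ} {a b e e₀ : ℂ} {u v : V} {w : W} {w' : Module.Dual ℂ W}

/-- The Laurent series of `exists_series_productTerm` converges on the whole punctured unit disc, by the
absolute convergence of the products at `z₁ = 1`. -/
theorem exists_series_sum (hu : u ∈ g.homSpace m a) (hv : v ∈ g.homSpace m' b)
    (hw : w ∈ degSpace M.piece e₀) (hw' : w' ∈ gradedDual M.piece)
    (he : ∀ x, w' x = w' (M.proj e x)) {h : ℤ} (hh : e - e₀ + a + b = h) :
    ∃ (c : ℤ → ℂ) (k₀ : ℤ) (s : ℂ → ℂ), (∀ k < k₀, c k = 0) ∧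
      (∀ ζ : ℂ, 0 < ‖ζ‖ → ‖ζ‖ < 1 → HasSum (fun k : ℤ => c k * ζ ^ k) (s ζ)) ∧
      ∀ z₁ z₂ : ℂ, ‖z₂‖ < ‖z₁‖ → 0 < ‖z₂‖ → HasSum (fun d => M.productTerm w' u z₁ v z₂ w d)
        (Complex.exp (-a * logBranch 0 z₁) * Complex.exp (-b * logBranch 0 z₂) *
          (z₁ ^ (h - m) * z₂ ^ (-m')) * s (z₂ / z₁)) := by
  obtain ⟨c, k₀, hc, hs⟩ := exists_series_productTerm hu hv hw he hh
  have hsum : ∀ ζ : ℂ, 0 < ‖ζ‖ → ‖ζ‖ < 1 → HasSum (fun k : ℤ => c k * ζ ^ k)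
      (∑' k : ℤ, c k * ζ ^ k) := by
    intro ζ h0 h1
    have hne : ζ ≠ 0 := norm_pos_iff.1 h0
    have h2 := (summable_productTerm (w := w) hu hv hw' (z₁ := 1) (z₂ := ζ)
      (by rwa [norm_one]) h0).hasSum
    rw [hs 1 ζ _ one_ne_zero hne] at h2
    have h3 := h2.summable
    rw [summable_mul_left_iff] at h3
    · simpa using h3.hasSum
    · exact mul_ne_zero (mul_ne_zero (Complex.exp_ne_zero _) (Complex.exp_ne_zero _))
        (mul_ne_zero (zpow_ne_zero _ one_ne_zero) (zpow_ne_zero _ hne))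
  refine ⟨c, k₀, fun ζ => ∑' k : ℤ, c k * ζ ^ k, hc, hsum, fun z₁ z₂ h1 h2 => ?_⟩
  have hz₁ := ne_zero_of_norm_lt h1
  rw [hs z₁ z₂ _ hz₁ (norm_pos_iff.1 h2)]
  refine (hsum (z₂ / z₁) ?_ ?_).mul_left _
  · rw [norm_div]
    exact div_pos h2 (h2.trans h1)
  · rw [norm_div]
    exact (div_lt_one (h2.trans h1)).2 h1

/-- The double series over the powers `i` of `(z₁ - z₂) / z₂` and the degrees `d` is summed by expanding
`binom(𝒩, i) u` in the finitely many nonzero vectors `𝒩^k u`: it becomes a finite sum over `k` of products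
of a series in `i`, with sum `log(z₁ / z₂)^k / k!`, and a series in `d`. -/
theorem iterate_family_hasSum (hu : u ∈ g.homSpace m a) (hv : v ∈ g.homSpace m' b)
    (hw' : w' ∈ gradedDual M.piece) {z₁ z₂ : ℂ} (h1 : ‖z₁ - z₂‖ < ‖z₂‖) (h2 : 0 < ‖z₁ - z₂‖)
    {s : ℂ} (hs : HasSum (fun d : ℤ => evalPair (nonlog M.modes) w' (logBranch 0 z₂)
      (A.modeSum (z₁ - z₂) (g.expNilLog (Complex.log (z₁ / z₂)) u) v d) w) s) :
    HasSum (fun q : ℕ × ℤ => M.iterateTerm w' u z₁ v z₂ w q) s := by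
  obtain ⟨r, hr⟩ := g.exists_nilLog_pow_eq_zero u
  have hz₂ := ne_zero_of_norm_lt h1
  set x := (z₁ - z₂) / z₂ with hx
  have hx1 : ‖x‖ < 1 := by
    rw [hx, norm_div]
    exact (div_lt_one (h2.trans h1)).2 h1
  have hxy : 1 + x = z₁ / z₂ := by rw [hx]; field_simp; ring
  set J : ℕ → ℤ → ℂ := fun k d => evalPair (nonlog M.modes) w' (logBranch 0 z₂)
    (A.modeSum (z₁ - z₂) ((g.nilLog ^ k) u) v d) w with hJ
  have hJs : ∀ k, Summable (J k) := fun k =>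
    summable_iterate (g.nilLog_pow_mem_homSpace hu k) hv hw' h1 h2
  have hlin : ∀ (c : ℕ → ℂ) (d : ℤ), evalPair (nonlog M.modes) w' (logBranch 0 z₂)
      (A.modeSum (z₁ - z₂) (∑ k ∈ range r, c k • (g.nilLog ^ k) u) v d) w
      = ∑ k ∈ range r, c k * J k d := by
    intro c d
    rw [← M.isGradedModes_nonlog.evalPairL_apply hw', ← A.modeSumL_apply]
    simp only [map_sum, LinearMap.sum_apply, map_smul, LinearMap.smul_apply, smul_eq_mul]
    refine sum_congr rfl fun k _ => ?_
    rw [A.modeSumL_apply, M.isGradedModes_nonlog.evalPairL_apply]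
  have hval : s = ∑ k ∈ range r, Complex.log (z₁ / z₂) ^ k / (k.factorial : ℂ) * ∑' d, J k d := by
    refine hs.unique ?_
    rw [g.expNilLog_apply _ hr]
    simp only [hlin]
    exact hasSum_sum fun k _ => (hJs k).hasSum.mul_left _
  rw [hval]
  have hterm : ∀ q : ℕ × ℤ, M.iterateTerm w' u z₁ v z₂ w q = ∑ k ∈ range r,
      (PowerSeries.coeff q.1 (PowerSeries.log ℂ ^ k) * x ^ q.1 / (k.factorial : ℂ)) * J k q.2 := by
    intro q
    rw [iterateTerm, g.binomNilLog_apply q.1 hr, hlin, mul_sum]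
    refine sum_congr rfl fun k _ => ?_
    rw [← hx]
    ring
  simp only [hterm]
  refine hasSum_sum fun k _ => ?_
  have h3 := (LogSeries.hasSum_coeff_log_pow k hx1).div_const (k.factorial : ℂ)
  rw [hxy] at h3
  set f : ℕ → ℂ := fun i =>
    PowerSeries.coeff i (PowerSeries.log ℂ ^ k) * x ^ i / (k.factorial : ℂ) with hf
  have h4 : Summable fun q : ℕ × ℤ => f q.1 * J k q.2 :=
    summable_mul_of_summable_norm h3.summable.norm (hJs k).norm
  exact h3.mul (hJs k).hasSum h4

/-- The case of homogeneous vectors. Writing `h = e - e₀ + a + b`, where `e₀` and `e` are the degrees of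
`w` and `w'`, all the series vanish unless `h` is an integer; if it is, the rational function is
`z₁^(-m) z₂^(h - m') p(z₁ / z₂) / (1 - z₁ / z₂)^t` with a Laurent polynomial `p`. -/
theorem rationalSums_of_mem (hu : u ∈ g.homSpace m a) (hv : v ∈ g.homSpace m' b)
    (hw : w ∈ degSpace M.piece e₀) (hw' : w' ∈ gradedDual M.piece)
    (he : ∀ x, w' x = w' (M.proj e x)) :
    RationalSums a b (fun z₁ z₂ d => M.productTerm w' u z₁ v z₂ w d)
      (fun z₁ z₂ d => M.productTerm w' v z₂ u z₁ w d)
      (fun z₁ z₂ q => M.iterateTerm w' u z₁ v z₂ w q) := by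
  by_cases hh : ∃ h : ℤ, e - e₀ + a + b = h
  swap
  · refine RationalSums.zero.congr (fun z₁ z₂ d => ?_) (fun z₁ z₂ d => ?_) fun z₁ z₂ q => ?_
    · exact productTerm_eq_zero hu hv hw he hh z₁ z₂ d
    · refine productTerm_eq_zero hv hu hw he ?_ z₂ z₁ d
      rwa [add_right_comm]
    · obtain ⟨r, hr⟩ := g.exists_nilLog_pow_eq_zero u
      rw [iterateTerm, iterate_eq_zero (m := m) (m' := m') _ hv hw he hh, mul_zero]
      rw [g.binomNilLog_apply q.1 hr]
      exact Submodule.sum_mem _ fun k _ =>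
        Submodule.smul_mem _ _ (g.nilLog_pow_mem_homSpace hu k)
  obtain ⟨h, hh⟩ := hh
  obtain ⟨Φ, hΦ, t, hΦ₁, hΦ₂, hΦ₃⟩ := exists_expPoly (w := w) hu hv hw'
  obtain ⟨c₁, k₁, s₁, hc₁, hs₁, hp₁⟩ := exists_series_sum hu hv hw hw' he hh
  obtain ⟨c₂, k₂, s₂, hc₂, hs₂, hp₂⟩ := exists_series_sum hv hu hw hw' he
    ((add_right_comm _ _ _).trans hh)
  have hre : ∀ y : ℝ, |(y : ℂ).im| < Real.pi / 2 := fun y => by simpa using Real.pi_pos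
  have hne : ∀ y : ℝ, y ≠ 0 → 1 - Complex.exp (y : ℂ) ≠ 0 := by
    intro y hy h
    rw [sub_eq_zero, ← Complex.ofReal_exp, eq_comm, Complex.ofReal_eq_one, Real.exp_eq_one_iff] at h
    exact hy h
  -- the exponential polynomial `Φ` without its factors `z₁^(-a)` and `z₂^(-b)`
  set Ψ : ℂ → ℂ := fun y => Complex.exp (a * (y + Real.pi * Complex.I)) *
    Complex.exp (b * (Real.pi * Complex.I)) * Φ y with hΨ
  have hΨm : Ψ ∈ expPoly := by
    refine mul_mem (mul_mem ?_ (const_mem _)) hΦ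
    simp only [mul_add, Complex.exp_add]
    exact mul_mem (exp_mem _) (const_mem _)
  have hΦΨ : ∀ y, Φ y = Complex.exp (-a * (y + Real.pi * Complex.I)) *
      Complex.exp (-b * (Real.pi * Complex.I)) * Ψ y := by
    intro y
    simp only [hΨ, neg_mul, Complex.exp_neg]
    have e1 := Complex.exp_ne_zero (a * (y + Real.pi * Complex.I))
    have e2 := Complex.exp_ne_zero (b * (Real.pi * Complex.I))
    field_simp
  have hneg : ∀ (y : ℂ) (k : ℤ), (-Complex.exp y) ^ k = (-1) ^ k * Complex.exp y ^ k := by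
    intro y k
    rw [← mul_zpow, neg_one_mul]
  have hsgn : ∀ k : ℤ, ((-1 : ℂ) ^ k) * (-1) ^ k = 1 := fun k => by
    rw [← mul_zpow]; norm_num
  have hA₁ : ∀ y : ℝ, 0 < y → (-Complex.exp y) ^ (h - m) * (-1) ^ (-m') *
      s₁ (Complex.exp (-y)) * (1 - Complex.exp y) ^ t = Ψ y := by
    intro y hy
    have h1 := (hp₁ (-Complex.exp y) (-1) (by
      rw [norm_neg, norm_neg, norm_one, Complex.norm_exp, Complex.ofReal_re]
      exact Real.one_lt_exp_iff.2 hy) (by simp)).unique (hΦ₁ y hy)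
    rw [logBranch_neg_exp (hre y), logBranch_neg_one, hΦΨ, mul_assoc _ (Ψ y), mul_assoc _ _ (s₁ _)]
      at h1
    have h2 := mul_left_cancel₀ (mul_ne_zero (Complex.exp_ne_zero _) (Complex.exp_ne_zero _)) h1
    rw [neg_div_neg_eq, one_div, ← Complex.exp_neg] at h2
    rw [h2, mul_assoc, inv_mul_cancel₀ (pow_ne_zero _ (hne y hy.ne')), mul_one]
  have hA₂ : ∀ y : ℝ, y < 0 → (-1) ^ (h - m') * (-Complex.exp y) ^ (-m) *
      s₂ (Complex.exp y) * (1 - Complex.exp y) ^ t = Ψ y := by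
    intro y hy
    have h1 := (hp₂ (-1) (-Complex.exp y) (by
      rw [norm_neg, norm_neg, norm_one, Complex.norm_exp, Complex.ofReal_re]
      simpa using hy) (by
      rw [norm_neg, norm_pos_iff]
      exact Complex.exp_ne_zero _)).unique (hΦ₂ y hy)
    rw [logBranch_neg_exp (hre y), logBranch_neg_one, hΦΨ, mul_assoc _ (Ψ y), mul_assoc _ _ (s₂ _),
      mul_comm (Complex.exp (-b * _))] at h1
    have h2 := mul_left_cancel₀ (mul_ne_zero (Complex.exp_ne_zero _) (Complex.exp_ne_zero _)) h1
    rw [neg_div_neg_eq, div_one] at h2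
    rw [h2, mul_assoc, inv_mul_cancel₀ (pow_ne_zero _ (hne y hy.ne)), mul_one]
  have hexpm : ∀ k : ℤ, (fun y : ℂ => (-Complex.exp y) ^ k) ∈ expPoly := by
    intro k
    simp only [hneg, ← Complex.exp_int_mul]
    exact mul_mem (const_mem _) (exp_mem _)
  -- the region `|z₁| < |z₂|` determines the Laurent polynomial `p`
  obtain ⟨S, C, hC, hCΨ⟩ := exists_laurent_of_expPoly hc₂ t
    (G := fun y => Ψ y * ((-1) ^ (h - m') * (-Complex.exp y) ^ m))
    (mul_mem hΨm (mul_mem (const_mem _) (hexpm m))) s₂ hs₂ fun y hy => by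
      rw [← hA₂ y hy]
      have e1 := zpow_ne_zero m (neg_ne_zero.2 (Complex.exp_ne_zero (y : ℂ)))
      rw [zpow_neg]
      field_simp
      linear_combination (-(s₂ (Complex.exp y) * (1 - Complex.exp y) ^ t)) * hsgn (h - m')
  set p : ℂ → ℂ := fun ζ => ∑ k ∈ S, C k * ζ ^ k with hp
  have hΨp : ∀ y, Ψ y = (-1) ^ (h - m') * (-Complex.exp y) ^ (-m) * p (Complex.exp y) := by
    intro y
    rw [hp]
    simp only
    rw [← hCΨ y, zpow_neg]
    have e1 := zpow_ne_zero m (neg_ne_zero.2 (Complex.exp_ne_zero y))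
    field_simp
    linear_combination (-Ψ y) * hsgn (h - m')
  have hpow : ∀ E : ℂ, E ≠ 0 → (1 - E⁻¹) ^ t * (-E) ^ t = (1 - E) ^ t := by
    intro E hE
    rw [← mul_pow]
    congr 1
    field_simp
    ring
  have hs₁p : ∀ ζ : ℂ, 0 < ‖ζ‖ → ‖ζ‖ < 1 →
      s₁ ζ = ζ ^ h * (p ζ⁻¹ * ((1 - ζ⁻¹) ^ t)⁻¹) := by
    obtain ⟨S', C', hC', hCΨ'⟩ := exists_laurent_of_expPoly hc₁ t
      (G := fun y => Ψ (-y) * ((-1) ^ m' * (-Complex.exp (-y)) ^ (m - h) * (-Complex.exp y) ^ (t : ℤ)))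
      (mul_mem (comp_neg_mem hΨm) (mul_mem (mul_mem (const_mem _) (comp_neg_mem (hexpm (m - h))))
        (hexpm t))) s₁ hs₁ fun y hy => by
        have h1 := hA₁ (-y) (by linarith)
        push_cast at h1
        rw [neg_neg] at h1
        rw [← h1, ← hpow _ (Complex.exp_ne_zero y), ← Complex.exp_neg, zpow_natCast]
        have e1 := zpow_ne_zero (h - m) (neg_ne_zero.2 (Complex.exp_ne_zero (-y : ℂ)))
        rw [← neg_sub h m, zpow_neg, zpow_neg]
        have e2 := zpow_ne_zero m' (neg_ne_zero.2 (one_ne_zero (α := ℂ)))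
        field_simp
    -- at `y = log ζ`, where `z₁ / z₂ = exp(-y)`
    intro ζ h0 h1
    have hζ : ζ ≠ 0 := norm_pos_iff.1 h0
    have h1ζ : 1 - ζ ≠ 0 := sub_ne_zero.2 fun hζ1 => by simp [← hζ1] at h1
    have h2 := (hC' ζ h0 h1).trans ((by simp only [Complex.exp_log hζ]) :
      _ = ∑ k ∈ S', C' k * Complex.exp (Complex.log ζ) ^ k)
    rw [← hCΨ', hΨp, hneg (-Complex.log ζ), hneg (-Complex.log ζ), Complex.exp_neg,
      Complex.exp_log hζ, zpow_natCast, ← hpow ζ hζ] at h2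
    have e3 : 1 - ζ⁻¹ ≠ 0 := sub_ne_zero.2 fun h3 => h1ζ (by rw [← inv_inv ζ, ← h3]; simp)
    have k1 : (-1 : ℂ) ^ (h - m') * (-1) ^ (-m) * (-1) ^ m' * (-1) ^ (m - h) = 1 := by
      rw [← zpow_add₀ (by norm_num), ← zpow_add₀ (by norm_num), ← zpow_add₀ (by norm_num),
        show h - m' + -m + m' + (m - h) = 0 by ring, zpow_zero]
    have k2 : ζ⁻¹ ^ (-m) * ζ⁻¹ ^ (m - h) = ζ ^ h := by
      rw [← zpow_add₀ (inv_ne_zero hζ), inv_zpow', show -(-m + (m - h)) = h by ring]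
    have h5 : (1 - ζ⁻¹) ^ t * s₁ ζ = ζ ^ h * p ζ⁻¹ := by
      refine mul_right_cancel₀ (pow_ne_zero t (neg_ne_zero.2 hζ)) ?_
      linear_combination h2 + p ζ⁻¹ * (-ζ) ^ t * (ζ⁻¹ ^ (-m) * ζ⁻¹ ^ (m - h)) * k1
        + p ζ⁻¹ * (-ζ) ^ t * k2
    rw [← mul_assoc, ← h5, mul_comm, inv_mul_cancel_left₀ (pow_ne_zero _ e3)]
  have hs₂p : ∀ ζ : ℂ, 0 < ‖ζ‖ → ‖ζ‖ < 1 → s₂ ζ = p ζ * ((1 - ζ) ^ t)⁻¹ := by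
    intro ζ h0 h1
    have h1ζ : 1 - ζ ≠ 0 := sub_ne_zero.2 fun hζ1 => by simp [← hζ1] at h1
    rw [hp]
    simp only
    rw [← hC ζ h0 h1, mul_comm, inv_mul_cancel_left₀ (pow_ne_zero _ h1ζ)]
  obtain ⟨P, r, s, t', hP⟩ := exists_ratVal_laurent S C t (-m) (h - m')
  refine ⟨P, r, s, t', fun z₁ z₂ e₁ e₂ => ?_, fun z₁ z₂ e₁ e₂ => ?_, fun z₁ z₂ l₁ e₁ e₂ e₃ e₄ => ?_⟩
  · have hz₁ := ne_zero_of_norm_lt e₁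
    have hz₂ := norm_pos_iff.1 e₂
    refine (hp₁ z₁ z₂ e₁ e₂).congr_eq (fun _ => rfl) ?_
    rw [hP _ _ hz₁ hz₂ (ne_of_norm_lt e₁).symm, hs₁p (z₂ / z₁)
      (by rw [norm_div]; exact div_pos e₂ (e₂.trans e₁))
      (by rw [norm_div]; exact (div_lt_one (e₂.trans e₁)).2 e₁), inv_div]
    have k : z₁ ^ (-m) * z₂ ^ (h - m') = z₁ ^ (h - m) * z₂ ^ (-m') * (z₂ / z₁) ^ h := by
      have f1 := zpow_ne_zero h hz₁
      rw [div_zpow, zpow_sub₀ hz₁, zpow_sub₀ hz₂, zpow_neg, zpow_neg]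
      field_simp
    rw [k]
    ring
  · have hz₂ := ne_zero_of_norm_lt e₁
    have hz₁ := norm_pos_iff.1 e₂
    refine (hp₂ z₂ z₁ e₁ e₂).congr_eq (fun _ => rfl) ?_
    rw [hP _ _ hz₁ hz₂ (ne_of_norm_lt e₁), hs₂p (z₁ / z₂)
      (by rw [norm_div]; exact div_pos e₂ (e₂.trans e₁))
      (by rw [norm_div]; exact (div_lt_one (e₂.trans e₁)).2 e₁)]
    ring
  · have hz₁ := ne_zero_of_norm_sub_lt e₁
    have hz₂ := ne_zero_of_norm_lt e₁
    have hz := sub_ne_zero.1 (norm_pos_iff.1 e₂)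
    set l₂ := logBranch 0 z₂ with hl₂
    rw [← logBranch_im, ← hl₂, ← Complex.sub_im] at e₄
    have hexp : Complex.exp (l₁ - l₂) = z₁ / z₂ := by
      rw [Complex.exp_sub, e₃, hl₂, exp_logBranch hz₂]
    have hlog : Complex.log (z₁ / z₂) = l₁ - l₂ := by
      have h4 := abs_lt.1 e₄
      rw [← hexp, Complex.log_exp] <;> linarith [Real.pi_pos]
    have hx : z₁ / z₂ - 1 = (z₁ - z₂) / z₂ := by field_simp
    refine iterate_family_hasSum hu hv hw' e₁ e₂ ?_
    rw [hlog]
    have h3 := hΦ₃ (l₁ - l₂) e₄ (by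
      rw [hexp, hx, norm_div]
      exact (div_lt_one (e₂.trans e₁)).2 e₁) (by
      rw [hexp]
      exact fun h1 => hz ((div_eq_one_iff_eq hz₂).1 h1))
    have hsc := iterate_scaling (g.expNilLog_mem_homSpace hu (l₁ - l₂)) hv hw he hh hz₂
      (z₁ / z₂ - 1)
    rw [neg_sub, sub_mul, div_mul_cancel₀ _ hz₂, one_mul, ← hexp, ← hl₂] at hsc
    refine (h3.mul_left _).congr_eq hsc ?_
    rw [hP _ _ hz₁ hz₂ hz, hΦΨ, hΨp, hexp]
    have k1 : Complex.exp (-(a + b) * (l₂ - Real.pi * Complex.I)) *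
        (Complex.exp (-a * (l₁ - l₂ + Real.pi * Complex.I)) *
          Complex.exp (-b * (Real.pi * Complex.I)))
        = Complex.exp (-a * l₁) * Complex.exp (-b * l₂) := by
      rw [← Complex.exp_add, ← Complex.exp_add, ← Complex.exp_add]
      congr 1
      ring
    have k2 : z₁ ^ (-m) * z₂ ^ (h - m')
        = (-z₂) ^ (h - m - m') * ((-1) ^ (h - m') * (-(z₁ / z₂)) ^ (-m)) := by
      have f1 := zpow_ne_zero m hz₁
      have f2 := zpow_ne_zero m hz₂
      have f3 : (-1 : ℂ) ^ (h - m - m') * (-1) ^ (h - m') * (-1) ^ (-m) = 1 := by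
        rw [← zpow_add₀ (by norm_num), ← zpow_add₀ (by norm_num),
          show h - m - m' + (h - m') + -m = 2 * (h - m - m') by ring, zpow_mul]
        norm_num
      have f4 : z₂ ^ (h - m') = z₂ ^ (h - m - m') * z₂ ^ m := by
        rw [← zpow_add₀ hz₂]; congr 1; ring
      rw [neg_eq_neg_one_mul z₂, neg_eq_neg_one_mul (z₁ / z₂), mul_zpow, mul_zpow, f4, div_zpow,
        zpow_neg z₁, zpow_neg z₂, div_inv_eq_mul]
      linear_combination (-((z₁ ^ m)⁻¹ * z₂ ^ (h - m - m') * z₂ ^ m)) * f3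
    rw [← k1, k2]
    ring

end Homogeneous

end WeakTwistedModule

namespace RationalSums

variable {a b : ℂ}

theorem sum {ι : Type*} (S : Finset ι) {f₁ f₂ : ι → ℂ → ℂ → ℂ → ℂ} {f₃ : ι → ℂ → ℂ → ℕ × ℤ → ℂ}
    (h : ∀ i, RationalSums a b (f₁ i) (f₂ i) (f₃ i)) :
    RationalSums a b (fun z₁ z₂ d => ∑ i ∈ S, f₁ i z₁ z₂ d) (fun z₁ z₂ d => ∑ i ∈ S, f₂ i z₁ z₂ d)
      (fun z₁ z₂ q => ∑ i ∈ S, f₃ i z₁ z₂ q) := by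
  classical
  induction S using Finset.induction_on with
  | empty => simpa using RationalSums.zero
  | insert i S hi ih =>
    simp only [Finset.sum_insert hi]
    exact (h i).add ih

/-- For families depending linearly on a vector, it suffices to treat the vectors of subspaces that
span the given one. -/
theorem of_mem_iSup {X ι : Type*} [AddCommGroup X] [Module ℂ X] {p : ι → Submodule ℂ X}
    (F₁ F₂ : ℂ → ℂ → ℂ → X →ₗ[ℂ] ℂ) (F₃ : ℂ → ℂ → ℕ × ℤ → X →ₗ[ℂ] ℂ)
    (h : ∀ i, ∀ x ∈ p i, RationalSums a b (fun z₁ z₂ d => F₁ z₁ z₂ d x)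
      (fun z₁ z₂ d => F₂ z₁ z₂ d x) (fun z₁ z₂ q => F₃ z₁ z₂ q x)) {x : X} (hx : x ∈ ⨆ i, p i) :
    RationalSums a b (fun z₁ z₂ d => F₁ z₁ z₂ d x)
      (fun z₁ z₂ d => F₂ z₁ z₂ d x) (fun z₁ z₂ q => F₃ z₁ z₂ q x) := by
  induction hx using Submodule.iSup_induction' with
  | zero =>
    simp only [map_zero]
    exact RationalSums.zero
  | add x y _ _ hx hy =>
    simp only [map_add]
    exact hx.add hy
  | mem i x hx => exact h i x hx

end RationalSums

namespace WeakTwistedModule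

open Finset VertexOperatorAlgebra

variable {V : Type*} [AddCommGroup V] [Module ℂ V] {A : VertexOperatorAlgebra V}
  {g : A.Automorphism} {W : Type*} [AddCommGroup W] [Module ℂ W] {M : WeakTwistedModule A g W}

/-! ### Reduction to homogeneous vectors -/

theorem proj_proj (d : ℂ) (x : W) : M.proj d (M.proj d x) = M.proj d x := by
  rw [M.proj_of_mem (M.proj_mem d x), if_pos rfl]

theorem evalPair_comp_proj {Y : ℂ → ℕ → V →ₗ[ℂ] W →ₗ[ℂ] W} (hY : M.IsGradedModes Y)
    (w' : Module.Dual ℂ W) (d l : ℂ) (v : V) (w : W) :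
    evalPair Y (w'.comp (M.proj d)) l v w = w' (evalProj Y (M.proj d) l v w) := by
  rw [evalProj, map_finsum w' (hY.support_evalProj d l v w), evalPair]
  simp only [map_smul, smul_eq_mul, LinearMap.comp_apply]

theorem evalPair_eq_sum_comp_proj {Y : ℂ → ℕ → V →ₗ[ℂ] W →ₗ[ℂ] W} (hY : M.IsGradedModes Y)
    {w' : Module.Dual ℂ W} {S : Finset ℂ} (hS : ∀ x, w' x = ∑ d ∈ S, w' (M.proj d x)) (l : ℂ)
    (v : V) (w : W) :
    evalPair Y w' l v w = ∑ d ∈ S, evalPair Y (w'.comp (M.proj d)) l v w := by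
  rw [hY.evalPair_eq_sum hS]
  exact sum_congr rfl fun d _ => (evalPair_comp_proj hY w' d l v w).symm

variable {a b : ℂ} {u v : V} {w' : Module.Dual ℂ W}

theorem rationalSums_of_mem_homSpace {m m' : ℤ} {e₀ : ℂ} {w : W} (hu : u ∈ g.homSpace m a)
    (hv : v ∈ g.homSpace m' b) (hw : w ∈ degSpace M.piece e₀) (hw' : w' ∈ gradedDual M.piece) :
    RationalSums a b (fun z₁ z₂ d => M.productTerm w' u z₁ v z₂ w d)
      (fun z₁ z₂ d => M.productTerm w' v z₂ u z₁ w d)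
      (fun z₁ z₂ q => M.iterateTerm w' u z₁ v z₂ w q) := by
  obtain ⟨S, hS⟩ := M.proj_eq_sum hw'
  refine (RationalSums.sum S fun e => rationalSums_of_mem hu hv hw
    (M.comp_proj_mem_gradedDual hw' e) (e := e) fun x => ?_).congr ?_ ?_ ?_
  · rw [LinearMap.comp_apply, LinearMap.comp_apply, proj_proj]
  · intro z₁ z₂ d
    exact evalPair_eq_sum_comp_proj M.isGradedModes_nonlog hS _ _ _
  · intro z₁ z₂ d
    exact evalPair_eq_sum_comp_proj M.isGradedModes_nonlog hS _ _ _
  · intro z₁ z₂ q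
    simp only [iterateTerm]
    rw [evalPair_eq_sum_comp_proj M.isGradedModes_nonlog hS, mul_sum]

theorem rationalSums (hu : u ∈ g.genSpace a) (hv : v ∈ g.genSpace b) (w : W)
    (hw' : w' ∈ gradedDual M.piece) :
    RationalSums a b (fun z₁ z₂ d => M.productTerm w' u z₁ v z₂ w d)
      (fun z₁ z₂ d => M.productTerm w' v z₂ u z₁ w d)
      (fun z₁ z₂ q => M.iterateTerm w' u z₁ v z₂ w q) := by
  have hY := M.isGradedModes_nonlog
  refine RationalSums.of_mem_iSup
    (fun z₁ z₂ d => (hY.evalPairL hw' (logBranch 0 z₁)).flip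
      (hY.evalProjL d (logBranch 0 z₂) v w))
    (fun z₁ z₂ d => hY.evalPairL hw' (logBranch 0 z₂) v ∘ₗ
      (hY.evalProjL d (logBranch 0 z₁)).flip w)
    (fun z₁ z₂ q => ((z₁ - z₂) / z₂) ^ q.1 • ((hY.evalPairL hw' (logBranch 0 z₂)).flip w ∘ₗ
      (A.modeSumL (z₁ - z₂) q.2).flip v ∘ₗ g.binomNilLog q.1))
    (fun m u hu => ?_) (g.genSpace_le_iSup_homSpace a hu)
  refine RationalSums.of_mem_iSup
    (fun z₁ z₂ d => hY.evalPairL hw' (logBranch 0 z₁) u ∘ₗ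
      (hY.evalProjL d (logBranch 0 z₂)).flip w)
    (fun z₁ z₂ d => (hY.evalPairL hw' (logBranch 0 z₂)).flip
      (hY.evalProjL d (logBranch 0 z₁) u w))
    (fun z₁ z₂ q => ((z₁ - z₂) / z₂) ^ q.1 • ((hY.evalPairL hw' (logBranch 0 z₂)).flip w ∘ₗ
      A.modeSumL (z₁ - z₂) q.2 (g.binomNilLog q.1 u)))
    (fun m' v hv => ?_) (g.genSpace_le_iSup_homSpace b hv)
  refine RationalSums.of_mem_iSup
    (fun z₁ z₂ d => hY.evalPairL hw' (logBranch 0 z₁) u ∘ₗ hY.evalProjL d (logBranch 0 z₂) v)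
    (fun z₁ z₂ d => hY.evalPairL hw' (logBranch 0 z₂) v ∘ₗ hY.evalProjL d (logBranch 0 z₁) u)
    (fun z₁ z₂ q => ((z₁ - z₂) / z₂) ^ q.1 • hY.evalPairL hw' (logBranch 0 z₂)
      (A.modeSumL (z₁ - z₂) q.2 (g.binomNilLog q.1 u) v))
    (fun e₀ w hw => ?_) (M.mem_iSup_degSpace w)
  exact rationalSums_of_mem_homSpace hu hv hw hw'

end WeakTwistedModule

end

theorem theorem2p6 {V : Type*} [AddCommGroup V] [Module ℂ V] (A : VertexOperatorAlgebra V)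
    (g : A.Automorphism) {W : Type*} [AddCommGroup W] [Module ℂ W] (M : WeakTwistedModule A g W)
    (a b : ℂ) (ha : a ∈ g.weights) (hb : b ∈ g.weights)
    (u v : V) (hu : u ∈ g.genSpace a) (hv : v ∈ g.genSpace b)
    (w : W) (w' : Module.Dual ℂ W) (hw' : w' ∈ gradedDual M.piece) :
    ∃ (P : MvPolynomial (Fin 2) ℂ) (r s t : ℤ),
      (∀ z₁ z₂ : ℂ, ‖z₂‖ < ‖z₁‖ → 0 < ‖z₂‖ →
        AbsConvTo (fun d : ℂ => M.productTerm w' u z₁ v z₂ w d)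
          (Complex.exp (-a * logBranch 0 z₁) * Complex.exp (-b * logBranch 0 z₂) *
            (MvPolynomial.eval ![z₁, z₂] P / (z₁ ^ r * z₂ ^ s * (z₁ - z₂) ^ t)))) ∧
      (∀ z₁ z₂ : ℂ, ‖z₁‖ < ‖z₂‖ → 0 < ‖z₁‖ →
        AbsConvTo (fun d : ℂ => M.productTerm w' v z₂ u z₁ w d)
          (Complex.exp (-a * logBranch 0 z₁) * Complex.exp (-b * logBranch 0 z₂) *
            (MvPolynomial.eval ![z₁, z₂] P / (z₁ ^ r * z₂ ^ s * (z₁ - z₂) ^ t)))) ∧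
      -- `l₁` is the value of the logarithm of `z₁` nearest to `log z₂`
      (∀ z₁ z₂ l₁ : ℂ, ‖z₁ - z₂‖ < ‖z₂‖ → 0 < ‖z₁ - z₂‖ →
        Complex.exp l₁ = z₁ → |l₁.im - argPos z₂| < Real.pi / 2 →
        AbsConvTo (fun q : ℕ × ℤ => M.iterateTerm w' u z₁ v z₂ w q)
          (Complex.exp (-a * l₁) * Complex.exp (-b * logBranch 0 z₂) *
            (MvPolynomial.eval ![z₁, z₂] P / (z₁ ^ r * z₂ ^ s * (z₁ - z₂) ^ t)))) := by
  simp only [absConvTo_iff]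
  exact WeakTwistedModule.rationalSums hu hv w hw'
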